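/- Let $\mathrm{GL}=\mathrm{colim}_n\,\mathrm{GL}(n,\mathbb R)$ and let $\Theta$ be a space with a continuous right action of $\mathrm{GL}$ such that $\pi_0\mathrm{GL}$ acts transitively on $\pi_0\Theta$. A $\Theta$-orientation of an $n$-dimensional real vector bundle $W\to B$ is a section of $(\mathrm{Fr}(W)\times\Theta)/\mathrm{GL}(n)\to B$, where $\mathrm{Fr}(W)$ is the frame bundle; equivalently, a continuous $\mathrm{GL}(n)$-equivariant map $\mathrm{Fr}(W)\to\Theta$. Let $d\ge 2$ and let $M$ be a nonempty compact smooth $d$-manifold, possibly with boundary, with a $\Theta$-orientation of $TM$. Identify $D^d\times S^0$ with $\{v=(v_+,v_-)\in\mathbb R^d\times\mathbb R : \|v_+\|^2\|v_-\|^2\le 1,\ f(v)=-1\}$, where $f(v)=\|v_+\|^2-\|v_-\|^2$, via $v\mapsto(\|v_-\|v_+,\|v_-\|^{-1}v_-)$. A $\Theta$-orientation of $T\mathbb R^{d+1}$ then induces one of $T(D^d\times S^0)$: add to a frame of $T(D^d\times S^0)$, as last vector, the normal vector $\nu=\nabla f/\|\nabla f\|^2$. Let $\mathscr C_M$ be the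 following topological category. An object is a finite set $T$ together with a $\Theta$-orientation of the tangent bundle of $\mathbb R^{d+1}\times T$ and a smooth embedding $e_T\colon D^d\times S^0\times T\to M\smallsetminus\partial M$ which respects the $\Theta$-orientations, such that surgery on $e_T$ (remove the interior of the image of $e_T$ and glue in $S^{d-1}\times D^1\times T$ along $S^{d-1}\times S^0\times T$) results in a connected $d$-manifold. A morphism from $(S,e_S)$ to $(T,e_T)$ is an injective map $k\colon S\to T$ such that $k^*e_T=e_S$ and such that $k^*$ takes the $\Theta$-orientation belonging to $T$ to the one belonging to $S$. The set of objects is topologized as a subspace of the disjoint union over all $T$ of the products (space of smooth embeddings $D^d\times S^0\times T\to M\smallsetminus\partial M$, with the $C^\infty$ topology) $\times$ (space of $\Theta$-orientations of the tangent bundle of $\mathbb R^{d+1}\times T$, with the compact-open topology). The set of morphisms is topologized as a subspace of $\mathrm{ob}(\mathscr C_M)\times\mathrm{ob}(\mathscr C_M)$ via (source, target). Then the classifying space $B\mathscr C_M$, defined as the fat realization of the nerve of $\mathscr C_M$ (the quotient of $\coprod_k N_k\mathscr C_M\times\Delta^k$ by the identifications coming from face operators only), is contractible. -/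

import Mathlib

open Set Topology CategoryTheory
open scoped Manifold ContDiff

noncomputable section

/-! ## Topological categories and their classifying spaces -/

section ClassifyingSpace

universe v u

/-- A (small) topological category: a category with topologies on the set of objects and on the
total set of morphisms, such that source, target, identity and composition are continuous. -/
class TopologicalCategory (C : Type u) [Category.{v} C] [TopologicalSpace C] where
  /-- the topology on the total set of morphisms -/
  morTopology : TopologicalSpace (Arrow C)
  continuous_source : Continuous (fun f : Arrow C => f.left)
  continuous_target : Continuous (fun f : Arrow C => f.right)
  continuous_id : Continuous (fun x : C => Arrow.mk (𝟙 x))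
  continuous_comp : Continuous
    (fun p : {p : Arrow C × Arrow C // p.1.right = p.2.left} =>
      Arrow.mk (p.1.1.hom ≫ eqToHom p.2 ≫ p.1.2.hom))

attribute [reducible, instance] TopologicalCategory.morTopology

variable (C : Type u) [Category.{v} C]

/-- The set of `k`-simplices of the nerve: chains `x₀ ⟶ x₁ ⟶ ⋯ ⟶ xₖ`. -/
def NerveSpace (k : ℕ) : Type (max u v) := Fin (k + 1) ⥤ C

/-- The face operator `dᵢ`, which omits the `i`-th object of a chain. -/
def NerveSpace.face {C : Type u} [Category.{v} C] {k : ℕ} (i : Fin (k + 2))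
    (x : NerveSpace C (k + 1)) : NerveSpace C k :=
  (Fin.succAboveOrderEmb i).monotone.functor ⋙ (show Fin (k + 1 + 1) ⥤ C from x)

/-- The objects and the successive morphisms of a chain. -/
def NerveSpace.spine {C : Type u} [Category.{v} C] {k : ℕ} (x : NerveSpace C k) :
    (Fin (k + 1) → C) × (Fin k → Arrow C) :=
  (fun i => CategoryTheory.Functor.obj x i,
   fun i => Arrow.mk (CategoryTheory.Functor.map x (homOfLE (Fin.castSucc_le_succ i))))

/-- The space of `k`-simplices is `mor ×_ob mor ×_ob ⋯ ×_ob mor` (and `ob` for `k = 0`). -/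
instance [TopologicalSpace C] [TopologicalCategory C] (k : ℕ) :
    TopologicalSpace (NerveSpace C k) :=
  TopologicalSpace.induced NerveSpace.spine inferInstance

/-- The identifications `(dᵢ x, t) ∼ (x, δⁱ t)` of the fat realization. -/
inductive FatRel : (Σ k : ℕ, NerveSpace C k × stdSimplex ℝ (Fin (k + 1))) →
    (Σ k : ℕ, NerveSpace C k × stdSimplex ℝ (Fin (k + 1))) → Prop
  | face {k : ℕ} (i : Fin (k + 2)) (x : NerveSpace C (k + 1)) (t : stdSimplex ℝ (Fin (k + 1))) :
      FatRel ⟨k, (NerveSpace.face i x, t)⟩ ⟨k + 1, (x, stdSimplex.map i.succAbove t)⟩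

/-- The classifying space of a topological category: the fat realization of its nerve, i.e. the
quotient of `∐ₖ Nₖ × Δᵏ` by the face identifications only (degeneracies are ignored). -/
def ClassifyingSpace [TopologicalSpace C] [TopologicalCategory C] : Type (max u v) :=
  Quot (FatRel C)

instance [TopologicalSpace C] [TopologicalCategory C] : TopologicalSpace (ClassifyingSpace C) :=
  inferInstanceAs (TopologicalSpace (Quot (FatRel C)))

end ClassifyingSpace

/-! ## Frame bundles and `Θ`-orientations -/

/-- Euclidean space of dimension `n`. -/
abbrev Euc (n : ℕ) : Type := EuclideanSpace ℝ (Fin n)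

/-- The stabilization `A ↦ A ⊕ 1` from `n × n` to `(n+1) × (n+1)` matrices. -/
def matrixStab (n : ℕ) : Matrix (Fin n) (Fin n) ℝ →* Matrix (Fin (n + 1)) (Fin (n + 1)) ℝ where
  toFun A := (Matrix.fromBlocks A 0 0 (1 : Matrix (Fin 1) (Fin 1) ℝ)).submatrix
    finSumFinEquiv.symm finSumFinEquiv.symm
  map_one' := by simp
  map_mul' A B := by
    rw [Matrix.submatrix_mul_equiv, Matrix.fromBlocks_multiply]
    simp

/-- The stabilization homomorphism `GL(n) → GL(n+1)`, `A ↦ A ⊕ 1`. -/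
def glStab (n : ℕ) : GL (Fin n) ℝ →* GL (Fin (n + 1)) ℝ := Units.map (matrixStab n)

/-- A continuous right action on the space `Θ` of the infinite general linear group
`GL = colim (GL(1) → GL(2) → ⋯)`, given as a compatible sequence of continuous right actions
of the groups `GL(n)`. -/
class StableGLAction (Θ : Type*) [TopologicalSpace Θ] where
  act : (n : ℕ) → Θ → GL (Fin n) ℝ → Θ
  act_one : ∀ n θ, act n θ 1 = θ
  act_mul : ∀ n θ g h, act n θ (g * h) = act n (act n θ g) h
  act_stab : ∀ n θ g, act (n + 1) θ (glStab n g) = act n θ g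
  continuous_act : ∀ n, Continuous (fun p : Θ × GL (Fin n) ℝ => act n p.1 p.2)

/-- The action of `π₀ GL` on `π₀ Θ` (path components) is transitive. -/
def StableGLAction.PiZeroTransitive (Θ : Type*) [TopologicalSpace Θ] [StableGLAction Θ] : Prop :=
  ∀ θ θ' : Θ, ∃ (n : ℕ) (g : GL (Fin n) ℝ), Joined (StableGLAction.act n θ g) θ'

section Frames

variable {B : Type*} [TopologicalSpace B] (n : ℕ)
  (F : Type*) [NormedAddCommGroup F] [NormedSpace ℝ F]
  (V : B → Type*) [TopologicalSpace (Bundle.TotalSpace F V)]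
  [∀ b, AddCommGroup (V b)] [∀ b, Module ℝ (V b)] [∀ b, TopologicalSpace (V b)]
  [∀ b, IsTopologicalAddGroup (V b)] [∀ b, ContinuousSMul ℝ (V b)]
  [FiberBundle F V] [VectorBundle ℝ F V]

/-- The frame bundle of an `n`-dimensional vector bundle `V` (with model fiber `F`), as a subspace
of the total space of the vector bundle `Hom(ℝⁿ, V)`: a frame at `b` is a linear isomorphism
`ℝⁿ → V b`. -/
def FrameBundle : Type _ :=
  {x : Bundle.TotalSpace (Euc n →L[ℝ] F) (fun b => Bundle.Trivial B (Euc n) b →L[ℝ] V b) //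
    Function.Bijective x.2}

instance : TopologicalSpace (FrameBundle n F V) :=
  inferInstanceAs (TopologicalSpace {x : Bundle.TotalSpace (Euc n →L[ℝ] F)
    (fun b => Bundle.Trivial B (Euc n) b →L[ℝ] V b) // Function.Bijective x.2})

variable {n F V}

/-- The frame at `b` given by a bijective linear map `ℝⁿ → V b`. -/
def FrameBundle.mk (b : B) (f : Euc n →L[ℝ] V b) (hf : Function.Bijective f) :
    FrameBundle n F V :=
  ⟨⟨b, f⟩, hf⟩

lemma toEuclideanCLM_bijective (g : GL (Fin n) ℝ) : Function.Bijective
    (Matrix.toEuclideanCLM (n := Fin n) (𝕜 := ℝ) (g : Matrix (Fin n) (Fin n) ℝ)) := by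
  have h1 : ∀ a b : Matrix (Fin n) (Fin n) ℝ, a * b = 1 → ∀ v : Euc n,
      Matrix.toEuclideanCLM (n := Fin n) (𝕜 := ℝ) a
        (Matrix.toEuclideanCLM (n := Fin n) (𝕜 := ℝ) b v) = v := by
    intro a b hab v
    have := congrArg (fun c => Matrix.toEuclideanCLM (n := Fin n) (𝕜 := ℝ) c v) hab
    simpa using this
  exact Function.bijective_iff_has_inverse.2
    ⟨Matrix.toEuclideanCLM (n := Fin n) (𝕜 := ℝ)
      ((g⁻¹ : GL (Fin n) ℝ) : Matrix (Fin n) (Fin n) ℝ),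
      h1 _ _ g.inv_mul, h1 _ _ g.mul_inv⟩

/-- The point of the base over which a frame lies. -/
def FrameBundle.base (x : FrameBundle n F V) : B := x.1.1

/-- A frame as a linear map. -/
def FrameBundle.lin (x : FrameBundle n F V) : Euc n →L[ℝ] V x.base := x.1.2

/-- The right action of `GL(n)` on frames: the frame `f` is sent to `f ∘ g`. -/
def FrameBundle.rightMul (x : FrameBundle n F V) (g : GL (Fin n) ℝ) : FrameBundle n F V :=
  FrameBundle.mk x.base
    (x.lin.comp (Matrix.toEuclideanCLM (n := Fin n) (𝕜 := ℝ) (g : Matrix (Fin n) (Fin n) ℝ)))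
    (Function.Bijective.comp (g := x.lin) x.2 (toEuclideanCLM_bijective g))

variable (n F V)

/-- A `Θ`-orientation of an `n`-dimensional vector bundle `V → B`: a section of the associated
bundle `(Fr(V) × Θ)/GL(n) → B`. Such a section `b ↦ [f, φ(f)]`, `f` any frame at `b`, is the same
thing as a continuous `GL(n)`-equivariant map `φ : Fr(V) → Θ`, which is how it is recorded. -/
structure ThetaOrientation (Θ : Type*) [TopologicalSpace Θ] [StableGLAction Θ] where
  toMap : C(FrameBundle n F V, Θ)
  equivariant : ∀ (x : FrameBundle n F V) (g : GL (Fin n) ℝ),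
    toMap (x.rightMul g) = StableGLAction.act n (toMap x) g

/-- The space of `Θ`-orientations carries the compact-open topology. -/
instance (Θ : Type*) [TopologicalSpace Θ] [StableGLAction Θ] :
    TopologicalSpace (ThetaOrientation n F V Θ) :=
  TopologicalSpace.induced ThetaOrientation.toMap inferInstance

end Frames

/-- `Θ`-orientations of the tangent bundle of the Euclidean space `ℝⁿ`. -/
abbrev EucThetaOrientation (n : ℕ) (Θ : Type*) [TopologicalSpace Θ] [StableGLAction Θ] : Type _ :=
  ThetaOrientation n (Euc n) (fun p : Euc n => TangentSpace 𝓘(ℝ, Euc n) p) Θ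

/-- `Θ`-orientations of the tangent bundle of a `d`-manifold (with boundary) `M`. -/
abbrev TangentThetaOrientation (d : ℕ) [NeZero d] (M : Type*) [TopologicalSpace M]
    [ChartedSpace (EuclideanHalfSpace d) M] [IsManifold (𝓡∂ d) ∞ M]
    (Θ : Type*) [TopologicalSpace Θ] [StableGLAction Θ] : Type _ :=
  ThetaOrientation d (Euc d) (fun p : M => TangentSpace (𝓡∂ d) p) Θ

/-! ## The thickened sphere `D^d × S^0` inside `ℝ^{d+1}`

`ℝ^{d+1}` has the involution `ρ(x₁, …, x_d, x_{d+1}) = (x₁, …, x_d, -x_{d+1})`. We write `v₊` for the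
first `d` coordinates and `v₋` for the last one. The points of `S^0` are `1, -1 : ℤˣ`. -/

/-- The closed unit disk `D^d`. -/
abbrev Disk (d : ℕ) : Set (Euc d) := Metric.closedBall 0 1

/-- The projection `v ↦ v₊`. -/
def eucInit (d : ℕ) : Euc (d + 1) →L[ℝ] Euc d :=
  LinearMap.toContinuousLinearMap
    { toFun := fun v => WithLp.toLp 2 (fun i => v i.castSucc)
      map_add' := fun v w => by ext i; simp
      map_smul' := fun c v => by ext i; simp }

/-- The projection `v ↦ v₋`. -/
def eucLast (d : ℕ) : Euc (d + 1) →L[ℝ] ℝ := EuclideanSpace.proj (Fin.last d)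

/-- The vector of `ℝ^{d+1}` with components `v₊ = x` and `v₋ = c`. -/
def eucSnoc {d : ℕ} (x : Euc d) (c : ℝ) : Euc (d + 1) :=
  WithLp.toLp 2 (Fin.snoc (α := fun _ => ℝ) x c)

/-- The Morse function `f(v) = ⟨v, ρ v⟩ = ‖v₊‖² - ‖v₋‖²` on `ℝ^{d+1}`. -/
def morseFn (d : ℕ) (v : Euc (d + 1)) : ℝ := ‖eucInit d v‖ ^ 2 - eucLast d v ^ 2

/-- The normal vector field of the level sets of `f`, normalized by `df(ν) = 1`: it is the
gradient `2 ρ(v)` divided by its squared norm `4 ‖v‖²`. -/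
def morseNormal {d : ℕ} (v : Euc (d + 1)) : Euc (d + 1) :=
  (2 * ‖v‖ ^ 2)⁻¹ • eucSnoc (eucInit d v) (-eucLast d v)

/-- The value of `‖v₋‖` at the point of the level set corresponding to `(x, s)`. -/
def saddleRadius {d : ℕ} (x : Euc d) : ℝ := √((1 + √(1 + 4 * ‖x‖ ^ 2)) / 2)

/-- The identification of `D^d × S^0` with
`{v | ‖v₊‖² ‖v₋‖² ≤ 1, f(v) = -1} ⊆ ℝ^{d+1}` which is inverse to
`v ↦ (‖v₋‖ v₊, ‖v₋‖⁻¹ v₋)`. -/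
def saddlePoint {d : ℕ} (s : ℤˣ) (x : Euc d) : Euc (d + 1) :=
  eucSnoc ((saddleRadius x)⁻¹ • x) (saddleRadius x * ((s : ℤ) : ℝ))

@[simp] lemma eucInit_snoc {d : ℕ} (x : Euc d) (c : ℝ) : eucInit d (eucSnoc x c) = x := by
  ext i; simp [eucInit, eucSnoc]

@[simp] lemma eucLast_snoc {d : ℕ} (x : Euc d) (c : ℝ) : eucLast d (eucSnoc x c) = c := by
  simp [eucLast, eucSnoc]

lemma euc_norm_sq {d : ℕ} (v : Euc (d + 1)) :
    ‖v‖ ^ 2 = ‖eucInit d v‖ ^ 2 + eucLast d v ^ 2 := by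
  rw [EuclideanSpace.norm_sq_eq, EuclideanSpace.norm_sq_eq, Fin.sum_univ_castSucc]
  simp [eucInit, eucLast]

lemma euc_ext {d : ℕ} {v w : Euc (d + 1)} (h1 : eucInit d v = eucInit d w)
    (h2 : eucLast d v = eucLast d w) : v = w := by
  rw [← sub_eq_zero, ← norm_eq_zero, ← sq_eq_zero_iff, euc_norm_sq]
  simp [map_sub, h1, h2]

lemma sign_sq (s : ℤˣ) : ((s : ℤ) : ℝ) * ((s : ℤ) : ℝ) = 1 := by
  rcases Int.units_eq_one_or s with rfl | rfl <;> simp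

lemma saddleRadius_pos {d : ℕ} (x : Euc d) : 0 < saddleRadius x := by
  unfold saddleRadius; positivity

lemma saddleRadius_eq {d : ℕ} (x : Euc d) :
    ‖x‖ ^ 2 = saddleRadius x ^ 2 * (saddleRadius x ^ 2 - 1) := by
  unfold saddleRadius
  rw [Real.sq_sqrt (by positivity)]
  have h : √(1 + 4 * ‖x‖ ^ 2) ^ 2 = 1 + 4 * ‖x‖ ^ 2 := Real.sq_sqrt (by positivity)
  linear_combination (1 / 4) * h.symm

lemma morseFn_saddlePoint {d : ℕ} (s : ℤˣ) (x : Euc d) : morseFn d (saddlePoint s x) = -1 := by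
  have h0 := saddleRadius_pos x
  have h1 := saddleRadius_eq x
  have h2 := sign_sq s
  simp only [morseFn, saddlePoint, eucInit_snoc, eucLast_snoc, norm_smul, mul_pow, norm_inv,
    Real.norm_eq_abs, sq_abs, inv_pow, h1]
  have h3 : (((s : ℤ) : ℝ)) ^ 2 = 1 := by rw [sq]; exact h2
  rw [h3]
  field_simp
  ring

/-- `(x, s)` is recovered from the corresponding point `v` as `(‖v₋‖ v₊, ‖v₋‖⁻¹ v₋)`;
here `‖v₋‖ = s v₋`. -/
lemma saddlePoint_leftInverse {d : ℕ} (s : ℤˣ) (x : Euc d) :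
    (((s : ℤ) : ℝ) * eucLast d (saddlePoint s x)) • eucInit d (saddlePoint s x) = x := by
  have h0 := saddleRadius_pos x
  have h2 := sign_sq s
  simp only [saddlePoint, eucInit_snoc, eucLast_snoc, smul_smul]
  have : ((s : ℤ) : ℝ) * (saddleRadius x * ((s : ℤ) : ℝ)) * (saddleRadius x)⁻¹ = 1 := by
    field_simp; nlinarith
  rw [this, one_smul]

lemma differentiable_saddlePoint {d : ℕ} (s : ℤˣ) :
    Differentiable ℝ (saddlePoint s : Euc d → Euc (d + 1)) := by
  have hr : Differentiable ℝ (saddleRadius : Euc d → ℝ) := by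
    intro x
    have hn : DifferentiableAt ℝ (fun x : Euc d => ‖x‖ ^ 2) x :=
      (contDiff_norm_sq ℝ (n := 1)).differentiable (by simp) x
    unfold saddleRadius
    have h1 : DifferentiableAt ℝ (fun x : Euc d => √(1 + 4 * ‖x‖ ^ 2)) x :=
      DifferentiableAt.sqrt ((hn.const_mul 4).const_add 1) (by positivity)
    have h2 : DifferentiableAt ℝ (fun x : Euc d => (1 + √(1 + 4 * ‖x‖ ^ 2)) / 2) x := by
      simpa [div_eq_mul_inv] using (h1.const_add 1).mul_const (2 : ℝ)⁻¹
    exact h2.sqrt (by positivity)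
  have hri : Differentiable ℝ (fun x : Euc d => (saddleRadius x)⁻¹) := fun x =>
    (hr x).inv (saddleRadius_pos x).ne'
  rw [differentiable_euclidean]
  intro i
  refine Fin.lastCases ?_ (fun j => ?_) i
  · simpa [saddlePoint, eucSnoc] using hr.mul_const _
  · have : Differentiable ℝ (fun x : Euc d => x j) :=
      (EuclideanSpace.proj (𝕜 := ℝ) j : Euc d →L[ℝ] ℝ).differentiable
    have h3 : Differentiable ℝ (fun x : Euc d => (saddleRadius x)⁻¹ * x j) := hri.mul this
    simpa [saddlePoint, eucSnoc] using h3

/-- Extension of a frame `f` of the tangent space of `D^d` at `x`, via the inclusion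
`D^d × {s} → ℝ^{d+1}`, by the normal vector `ν` as last vector. -/
def saddleFrameMap {d : ℕ} (s : ℤˣ) (x : Euc d) (f : Euc d ≃L[ℝ] Euc d) :
    Euc (d + 1) →L[ℝ] Euc (d + 1) :=
  ((fderiv ℝ (saddlePoint s) x).comp (f : Euc d →L[ℝ] Euc d)).comp (eucInit d) +
    (eucLast d).smulRight (morseNormal (saddlePoint s x))

lemma saddleFrameMap_bijective {d : ℕ} (s : ℤˣ) (x : Euc d) (f : Euc d ≃L[ℝ] Euc d) :
    Function.Bijective (saddleFrameMap s x f) := by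
  have hinj : Function.Injective (saddleFrameMap s x f) := by
    rw [injective_iff_map_eq_zero]
    intro w hw
    set v := saddlePoint s x with hv
    have hj : HasFDerivAt (saddlePoint s) (fderiv ℝ (saddlePoint s) x) x :=
      (differentiable_saddlePoint s x).hasFDerivAt
    set u := fderiv ℝ (saddlePoint s) x (f (eucInit d w)) with hu
    have hw' : u + eucLast d w • morseNormal v = 0 := by
      simpa [saddleFrameMap, hu, hv] using hw
    have hvpos : 0 < ‖v‖ ^ 2 := by
      have h1 := morseFn_saddlePoint s x
      rw [← hv, morseFn] at h1
      rw [euc_norm_sq]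
      nlinarith [sq_nonneg ‖eucInit d v‖]
    -- differentiate `f ∘ j = -1`
    have hi : HasFDerivAt (fun y => eucInit d (saddlePoint s y))
        ((eucInit d).comp (fderiv ℝ (saddlePoint s) x)) x :=
      (eucInit d).hasFDerivAt.comp x hj
    have hl : HasFDerivAt (fun y => eucLast d (saddlePoint s y))
        ((eucLast d).comp (fderiv ℝ (saddlePoint s) x)) x :=
      (eucLast d).hasFDerivAt.comp x hj
    have hm := hi.norm_sq.sub (hl.pow 2)
    have hc : HasFDerivAt (fun y : Euc d => (‖eucInit d (saddlePoint s y)‖ ^ 2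
        - eucLast d (saddlePoint s y) ^ 2)) (0 : Euc d →L[ℝ] ℝ) x := by
      have : (fun y : Euc d => (‖eucInit d (saddlePoint s y)‖ ^ 2
        - eucLast d (saddlePoint s y) ^ 2)) = fun _ => (-1 : ℝ) :=
        funext fun y => morseFn_saddlePoint s y
      rw [this]; exact hasFDerivAt_const _ _
    have h1 := DFunLike.congr_fun (hm.unique hc) (f (eucInit d w))
    have h1' : inner ℝ (eucInit d v) (eucInit d u) - eucLast d v * eucLast d u = 0 := by
      simp at h1
      rw [← hu, ← hv] at h1
      linarith
    have hu' : u = -(eucLast d w • morseNormal v) := eq_neg_of_add_eq_zero_left hw'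
    have hlast : eucLast d w = 0 := by
      rw [hu'] at h1'
      simp only [morseNormal, map_neg, map_smul, eucInit_snoc, eucLast_snoc, inner_neg_right,
        inner_smul_right, real_inner_self_eq_norm_sq, smul_eq_mul] at h1'
      have h3 : eucLast d w * ((2 * ‖v‖ ^ 2)⁻¹ * ‖v‖ ^ 2) = 0 := by
        rw [euc_norm_sq v] at h1' ⊢
        linarith
      have h4 : (2 * ‖v‖ ^ 2)⁻¹ * ‖v‖ ^ 2 = 1 / 2 := by
        have := hvpos.ne'
        generalize ‖v‖ ^ 2 = r at *
        field_simp
      rw [h4] at h3; linarith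
    have hu0 : u = 0 := by simpa [hlast] using hw'
    -- differentiate the left inverse
    have hq := (hl.const_mul ((s : ℤ) : ℝ)).smul hi
    have hq' : HasFDerivAt (fun y : Euc d => (((s : ℤ) : ℝ) * eucLast d (saddlePoint s y)) •
        eucInit d (saddlePoint s y)) (ContinuousLinearMap.id ℝ (Euc d)) x := by
      have : (fun y : Euc d => (((s : ℤ) : ℝ) * eucLast d (saddlePoint s y)) •
        eucInit d (saddlePoint s y)) = id := funext fun y => saddlePoint_leftInverse s y
      rw [this]; exact hasFDerivAt_id x
    have h2 := DFunLike.congr_fun (hq.unique hq') (f (eucInit d w))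
    have h2' : f (eucInit d w) = 0 := by
      simp at h2
      rw [← hu, hu0] at h2
      simpa using h2.symm
    have h2'' : eucInit d w = 0 := by simpa using h2'
    exact euc_ext (by simpa using h2'') (by simpa using hlast)
  exact ⟨hinj, (LinearMap.injective_iff_surjective
    (f := (saddleFrameMap s x f : Euc (d + 1) →ₗ[ℝ] Euc (d + 1)))).1 hinj⟩

/-- The frame of `Tℝ^{d+1}` at the point `(x, s)` of `D^d × S^0` obtained from a frame of
`T D^d` at `x` by adding the normal vector `ν`. -/
def saddleFrame {d : ℕ} (s : ℤˣ) (x : Euc d) (f : Euc d ≃L[ℝ] Euc d) :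
    FrameBundle (d + 1) (Euc (d + 1))
      (fun p : Euc (d + 1) => TangentSpace 𝓘(ℝ, Euc (d + 1)) p) :=
  FrameBundle.mk (V := fun p : Euc (d + 1) => TangentSpace 𝓘(ℝ, Euc (d + 1)) p)
    (saddlePoint s x) (saddleFrameMap s x f) (saddleFrameMap_bijective s x f)

/-! ## Embedded thickened `0`-spheres -/

section Surgery

universe w u

variable (d : ℕ) [NeZero d] (M : Type w) [TopologicalSpace M]
  [ChartedSpace (EuclideanHalfSpace d) M]

/-- A map defined on the disk, extended to the whole Euclidean space in an irrelevant way. -/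
def diskExtend {d : ℕ} {M : Type*} (f : Disk d → M) (x : Euc d) : M :=
  haveI := Classical.propDecidable (x ∈ Disk d)
  if h : x ∈ Disk d then f ⟨x, h⟩ else f ⟨0, by simp⟩

/-- Smooth embeddings `e : D^d × S^0 × T → M ∖ ∂M`. -/
structure SphereEmbedding (T : Type) where
  toFun : T → ℤˣ → Disk d → M
  smooth : ∀ t s, ContMDiffOn 𝓘(ℝ, Euc d) (𝓡∂ d) ∞ (diskExtend (toFun t s)) (Disk d)
  immersive : ∀ t s, ∀ x ∈ Disk d, Function.Injective
    (mfderivWithin 𝓘(ℝ, Euc d) (𝓡∂ d) (diskExtend (toFun t s)) (Disk d) x)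
  injective : Function.Injective (fun p : T × ℤˣ × Disk d => toFun p.1 p.2.1 p.2.2)
  mem_interior : ∀ t s x, toFun t s x ∈ (𝓡∂ d).interior M

variable {d M}

namespace SphereEmbedding

/-- The subbasic set of all `g` with `g_{t,s}(K)` inside the domain of the chart at `p` and with
`‖Dᵏ(ψ ∘ g_{t,s}) - Dᵏ(ψ ∘ e_{t,s})‖ < ε` on `K`, where `ψ` is the chart at `p`. -/
def basicNhd {T : Type} (e : SphereEmbedding d M T) (t : T) (s : ℤˣ) (K : Set (Euc d)) (p : M)
    (k : ℕ) (ε : ℝ) : Set (SphereEmbedding d M T) :=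
  {g | (∀ x ∈ K, diskExtend (g.toFun t s) x ∈ (extChartAt (𝓡∂ d) p).source) ∧
    ∀ x ∈ K,
      ‖iteratedFDerivWithin ℝ k (extChartAt (𝓡∂ d) p ∘ diskExtend (g.toFun t s)) (Disk d) x
        - iteratedFDerivWithin ℝ k (extChartAt (𝓡∂ d) p ∘ diskExtend (e.toFun t s)) (Disk d) x‖
        < ε}

/-- The `C^∞` topology (uniform convergence of all derivatives on compact sets in charts). -/
instance (T : Type) : TopologicalSpace (SphereEmbedding d M T) :=
  TopologicalSpace.generateFrom
    {W | ∃ (e : SphereEmbedding d M T) (t : T) (s : ℤˣ) (K : Set (Euc d)) (p : M) (k : ℕ) (ε : ℝ),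
      IsCompact K ∧ K ⊆ Disk d ∧ 0 < ε ∧
      (∀ x ∈ K, diskExtend (e.toFun t s) x ∈ (extChartAt (𝓡∂ d) p).source) ∧
      W = e.basicNhd t s K p k ε}

lemma frame_bijective {T : Type} (e : SphereEmbedding d M T) (t : T) (s : ℤˣ) (x : Disk d)
    (f : Euc d ≃L[ℝ] Euc d) : Function.Bijective
      (((show Euc d →L[ℝ] Euc d from
        mfderivWithin 𝓘(ℝ, Euc d) (𝓡∂ d) (diskExtend (e.toFun t s)) (Disk d) x)).comp
        (f : Euc d →L[ℝ] Euc d)) := by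
  have hinj : Function.Injective (((show Euc d →L[ℝ] Euc d from
        mfderivWithin 𝓘(ℝ, Euc d) (𝓡∂ d) (diskExtend (e.toFun t s)) (Disk d) x)).comp
        (f : Euc d →L[ℝ] Euc d)) :=
    (e.immersive t s x x.2).comp f.injective
  exact ⟨hinj, (LinearMap.injective_iff_surjective
    (f := (((show Euc d →L[ℝ] Euc d from
        mfderivWithin 𝓘(ℝ, Euc d) (𝓡∂ d) (diskExtend (e.toFun t s)) (Disk d) x)).comp
        (f : Euc d →L[ℝ] Euc d) : Euc d →ₗ[ℝ] Euc d))).1 hinj⟩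

/-- The image under the differential of `e` of a frame of `T D^d` at `x`. -/
def frame [IsManifold (𝓡∂ d) ∞ M] {T : Type} (e : SphereEmbedding d M T) (t : T) (s : ℤˣ)
    (x : Disk d) (f : Euc d ≃L[ℝ] Euc d) :
    FrameBundle d (Euc d) (fun p : M => TangentSpace (𝓡∂ d) p) :=
  FrameBundle.mk (V := fun p : M => TangentSpace (𝓡∂ d) p)
    (diskExtend (e.toFun t s) x) _ (e.frame_bijective t s x f)

/-- `e` respects the `Θ`-orientations: for the `Θ`-orientation of the tangent bundle of
`D^d × S^0 × T` which is induced from the given one of `T(ℝ^{d+1} × T)` through the normal field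
`ν`, and the given `Θ`-orientation of `TM`. -/
def RespectsOrientation [IsManifold (𝓡∂ d) ∞ M] {Θ : Type u} [TopologicalSpace Θ]
    [StableGLAction Θ] (oM : TangentThetaOrientation d M Θ) {T : Type}
    (e : SphereEmbedding d M T) (o : T → EucThetaOrientation (d + 1) Θ) : Prop :=
  ∀ (t : T) (s : ℤˣ) (x : Disk d) (f : Euc d ≃L[ℝ] Euc d),
    oM.toMap (e.frame t s x f) = (o t).toMap (saddleFrame s (x : Euc d) f)

/-- The complement in `M` of the image of (open disk) `× S^0 × T`. -/
def Remainder {T : Type} (e : SphereEmbedding d M T) : Type w :=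
  {p : M // ∀ (t : T) (s : ℤˣ) (x : Disk d), ‖(x : Euc d)‖ < 1 → e.toFun t s x ≠ p}

instance {T : Type} (e : SphereEmbedding d M T) : TopologicalSpace e.Remainder :=
  inferInstanceAs (TopologicalSpace {p : M // ∀ (t : T) (s : ℤˣ) (x : Disk d),
    ‖(x : Euc d)‖ < 1 → e.toFun t s x ≠ p})

/-- The identification of `(x, s, t) ∈ S^{d-1} × S^0 × T ⊆ S^{d-1} × D^1 × T` with the point
`e(x, s, t)` of the boundary of the removed part. -/
inductive SurgeryRel {T : Type} (e : SphereEmbedding d M T) :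
    e.Remainder ⊕ (Σ _ : T, Metric.sphere (0 : Euc d) 1 × Icc (-1 : ℝ) 1) →
    e.Remainder ⊕ (Σ _ : T, Metric.sphere (0 : Euc d) 1 × Icc (-1 : ℝ) 1) → Prop
  | glue (p : e.Remainder) (t : T) (s : ℤˣ) (x : Metric.sphere (0 : Euc d) 1)
      (y : Icc (-1 : ℝ) 1) (hy : (y : ℝ) = ((s : ℤ) : ℝ))
      (hp : p.1 = e.toFun t s ⟨x, Metric.sphere_subset_closedBall x.2⟩) :
      SurgeryRel e (Sum.inl p) (Sum.inr ⟨t, (x, y)⟩)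

/-- The (underlying space of the) `d`-manifold obtained from `M` by surgery on `e`: remove the
interior of the image of `D^d × S^0 × T` and glue in `S^{d-1} × D^1 × T` instead. -/
def Surgered {T : Type} (e : SphereEmbedding d M T) : Type w := Quot e.SurgeryRel

instance {T : Type} (e : SphereEmbedding d M T) : TopologicalSpace e.Surgered :=
  inferInstanceAs (TopologicalSpace (Quot e.SurgeryRel))

end SphereEmbedding

/-! ## The category of multiple surgeries -/

variable [IsManifold (𝓡∂ d) ∞ M] {Θ : Type u} [TopologicalSpace Θ] [StableGLAction Θ]

/-- Finite sets. -/
abbrev FiniteSet : Type 1 := {T : Type // Finite T}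

/-- The space of objects with a fixed finite set `T`, as a subspace of the product of the space of
smooth embeddings and the space of `Θ`-orientations of `T(ℝ^{d+1} × T)`. -/
def SurgeryDatum (oM : TangentThetaOrientation d M Θ) (T : Type) : Type (max u w) :=
  {p : SphereEmbedding d M T × (T → EucThetaOrientation (d + 1) Θ) //
    p.1.RespectsOrientation oM p.2 ∧ ConnectedSpace p.1.Surgered}

instance (oM : TangentThetaOrientation d M Θ) (T : Type) : TopologicalSpace (SurgeryDatum oM T) :=
  inferInstanceAs (TopologicalSpace {p : SphereEmbedding d M T ×
    (T → EucThetaOrientation (d + 1) Θ) //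
      p.1.RespectsOrientation oM p.2 ∧ ConnectedSpace p.1.Surgered})

/-- The objects of the category of multiple surgeries on `M`. -/
def SurgeryCat (oM : TangentThetaOrientation d M Θ) : Type (max 1 u w) :=
  Σ T : FiniteSet, SurgeryDatum oM T.1

namespace SurgeryCat

variable {oM : TangentThetaOrientation d M Θ}

/-- The space of objects is a disjoint union over all finite sets `T`. -/
instance : TopologicalSpace (SurgeryCat oM) :=
  inferInstanceAs (TopologicalSpace (Σ T : FiniteSet, SurgeryDatum oM T.1))

/-- A morphism from `(S, e_S)` to `(T, e_T)`: an injective map `k : S → T` which pulls back `e_T`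
(and the `Θ`-orientation on `ℝ^{d+1} × T`) to `e_S` (and the one on `ℝ^{d+1} × S`). -/
@[ext] structure Hom (X Y : SurgeryCat oM) where
  map : X.1.1 → Y.1.1
  injective : Function.Injective map
  embedding : ∀ t, Y.2.1.1.toFun (map t) = X.2.1.1.toFun t
  orientation : ∀ t, Y.2.1.2 (map t) = X.2.1.2 t

instance : Category (SurgeryCat oM) where
  Hom := Hom
  id X := ⟨id, Function.injective_id, fun _ => rfl, fun _ => rfl⟩
  comp f g := ⟨g.map ∘ f.map, g.injective.comp f.injective,
    fun t => (g.embedding _).trans (f.embedding t),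
    fun t => (g.orientation _).trans (f.orientation t)⟩

/-- A morphism is determined by its source and its target. -/
instance (X Y : SurgeryCat oM) : Subsingleton (X ⟶ Y) := by
  refine ⟨fun (f g : Hom X Y) => Hom.ext (funext fun t => ?_)⟩
  have h : Y.2.1.1.toFun (f.map t) = Y.2.1.1.toFun (g.map t) :=
    (f.embedding t).trans (g.embedding t).symm
  have h' := congrFun (congrFun h 1) ⟨0, by simp⟩
  exact congrArg Prod.fst
    (Y.2.1.1.injective (a₁ := (f.map t, 1, ⟨0, by simp⟩)) (a₂ := (g.map t, 1, ⟨0, by simp⟩)) h')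

/-- The morphism set is topologized through (source, target). -/
@[reducible] def morTop : TopologicalSpace (Arrow (SurgeryCat oM)) :=
  TopologicalSpace.induced (fun f => (f.left, f.right)) inferInstance

lemma continuous_source_target : @Continuous _ _ (morTop (oM := oM)) _
    (fun f : Arrow (SurgeryCat oM) => (f.left, f.right)) :=
  continuous_induced_dom

instance : TopologicalCategory (SurgeryCat oM) :=
  letI := morTop (oM := oM)
  { morTopology := morTop
    continuous_source := continuous_fst.comp continuous_source_target
    continuous_target := continuous_snd.comp continuous_source_target
    continuous_id := continuous_induced_rng.2 (continuous_id.prodMk continuous_id)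
    continuous_comp := continuous_induced_rng.2
      ((continuous_fst.comp (continuous_source_target.comp
          (continuous_fst.comp continuous_subtype_val))).prodMk
        (continuous_snd.comp (continuous_source_target.comp
          (continuous_snd.comp continuous_subtype_val)))) }

end SurgeryCat

end Surgery

end

/-! The category is a preorder: an object is a finite set of disjoint oriented thickened 0-spheres,
and a morphism exists exactly when one set of (embedding, orientation) pairs is contained in another
(`SurgeryCat.nonempty_hom_iff`). The surgered manifold is connected if and only if `M` becomes
connected on joining the two disks of every sphere
(`SphereEmbedding.isConnecting_of_connectedSpace`, `SphereEmbedding.IsConnecting.connectedSpace`).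
This depends only on the centres of the disks, so it survives concentric shrinking and the addition
of further spheres.

Choose infinitely many disjoint finite data `y i`, each of which alone makes `M` connected
(`nonempty_standardSystem`). They exist because `M` has finitely many components, and because
transitivity on path components allows the values of the `Θ`-orientation at two disks to be joined
after reflecting one disk. The finitely many centres of an object `x` meet the neighbourhoods of
only finitely many `y i`, so `x`, sufficiently shrunk, is disjoint from some `y i` with `i ≠ 0`.
After shrinking there is a zigzag `x ≤ x ∪ y i ≥ y i ≤ y i ∪ y 0 ≥ y 0`, ending at a fixed object.
The structure `JoinSystem` records what is needed to run this over all simplices at once.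

A point of a simplex is read as a monotone step function on `[0, 1)` with value `x j` on an interval
of length `t j`. A label `(j, S)` stands for the shrunk `x j` together with all `y i`, `i ∈ S`; `⊥`
in place of `j` means that no `x j` is present. Moving the jumps of the step function changes the
weights of the labels continuously (`continuous_volume_thresholds`). A large `x j` may be too close
to a `y i` that is to be added, so weight is first moved to vertices far from it. Some weight always
remains, because distances decrease along inclusions and the first vertex of positive weight is at
least as far away as the average (`JoinSystem.sum_keep_pos`). The factors `2⁻ⁱ` leave only finitely
many `y i` in use near a given point. Vertices of weight zero have no influence, so the construction
descends to the fat realization (`JoinSystem.contraction_face`); continuity comes from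
`ClassifyingSpace.continuousAt_of_isRep`.

For surgery data, shrinking has to be continuous in the `C^∞` topology
(`SphereEmbedding.eventually_shrink_mem_diskNhd`) and has to lift to `Θ`-orientations of `ℝ^{d+1}`.
The lift is pullback along bundle maps which realize the shrinking of `D^d × S^0` in `ℝ^{d+1}`
(`shrinkFrame_saddleFrame`). -/

noncomputable section

/-! ## Chains in thin topological categories -/

section Chains

universe v u

variable {C : Type u} [Category.{v} C]

/-- The objects of a chain. -/
def NerveSpace.vertex {k : ℕ} (x : NerveSpace C k) (i : Fin (k + 1)) : C :=
  CategoryTheory.Functor.obj x i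

lemma NerveSpace.nonempty_hom {k : ℕ} (x : NerveSpace C k) {i j : Fin (k + 1)} (h : i ≤ j) :
    Nonempty (x.vertex i ⟶ x.vertex j) :=
  ⟨CategoryTheory.Functor.map x (homOfLE h)⟩

lemma NerveSpace.continuous_vertex [TopologicalSpace C] [TopologicalCategory C] {k : ℕ}
    (i : Fin (k + 1)) : Continuous (fun x : NerveSpace C k => x.vertex i) :=
  (continuous_apply i).comp (continuous_fst.comp
    (continuous_induced_dom (f := NerveSpace.spine (C := C) (k := k))))

/-- When the topology on morphisms is induced by source and target, the morphism coordinates of the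
spine impose no condition beyond continuity of the vertices. -/
lemma NerveSpace.continuousAt_iff [TopologicalSpace C] [TopologicalCategory C]
    (hind : IsInducing (fun f : Arrow C => ((f.left, f.right) : C × C)))
    {Z : Type*} [TopologicalSpace Z] {k : ℕ} {F : Z → NerveSpace C k} {z : Z}
    (hF : ∀ i, ContinuousAt (fun z => (F z).vertex i) z) : ContinuousAt F z := by
  have hs : IsInducing (NerveSpace.spine (C := C) (k := k)) := ⟨rfl⟩
  rw [hs.continuousAt_iff]
  refine ContinuousAt.prodMk ?_ ?_
  · exact continuousAt_pi.2 hF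
  · refine continuousAt_pi.2 fun i => ?_
    rw [hind.continuousAt_iff]
    exact (hF i.castSucc).prodMk (hF i.succ)

/-- The point of the classifying space with given barycentric coordinates in a simplex. -/
def ClassifyingSpace.mk [TopologicalSpace C] [TopologicalCategory C] {k : ℕ} (x : NerveSpace C k) (t : stdSimplex ℝ (Fin (k + 1))) :
    ClassifyingSpace C :=
  Quot.mk _ ⟨k, (x, t)⟩

lemma ClassifyingSpace.continuous_mk [TopologicalSpace C] [TopologicalCategory C] (k : ℕ) :
    Continuous (fun p : NerveSpace C k × stdSimplex ℝ (Fin (k + 1)) =>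
      (ClassifyingSpace.mk p.1 p.2 : ClassifyingSpace C)) :=
  continuous_quot_mk.comp (continuous_sigmaMk (ι := ℕ)
    (σ := fun k => NerveSpace C k × stdSimplex ℝ (Fin (k + 1))))

lemma ClassifyingSpace.mk_face [TopologicalSpace C] [TopologicalCategory C] {k : ℕ} (i : Fin (k + 2)) (x : NerveSpace C (k + 1))
    (t : stdSimplex ℝ (Fin (k + 1))) :
    (ClassifyingSpace.mk (NerveSpace.face i x) t : ClassifyingSpace C) =
      ClassifyingSpace.mk x (stdSimplex.map i.succAbove t) :=
  Quot.sound (FatRel.face i x t)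

lemma stdSimplex_map_succAbove_apply {k : ℕ} (i : Fin (k + 2)) (t : stdSimplex ℝ (Fin (k + 1)))
    (j : Fin (k + 1)) : stdSimplex.map i.succAbove t (i.succAbove j) = t j := by
  rw [stdSimplex.map_coe, FunOnFinite.linearMap_apply_apply, Finset.sum_eq_single j]
  · intro b hb hbj
    simp only [Finset.mem_filter] at hb
    exact absurd (Fin.succAbove_right_injective hb.2) hbj
  · simp

lemma stdSimplex_map_succAbove_self {k : ℕ} (i : Fin (k + 2)) (t : stdSimplex ℝ (Fin (k + 1))) :
    stdSimplex.map i.succAbove t i = 0 := by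
  rw [stdSimplex.map_coe, FunOnFinite.linearMap_apply_apply]
  refine Finset.sum_eq_zero fun j hj => ?_
  simp only [Finset.mem_filter] at hj
  exact absurd hj.2 (Fin.succAbove_ne i j)

/-- A point of a simplex with a vanishing coordinate comes from the corresponding face. -/
lemma stdSimplex_exists_map_succAbove {k : ℕ} (i : Fin (k + 2)) (t : stdSimplex ℝ (Fin (k + 2)))
    (h : t i = 0) : ∃ t' : stdSimplex ℝ (Fin (k + 1)), t = stdSimplex.map i.succAbove t' := by
  refine ⟨⟨fun j => t (i.succAbove j), fun j => stdSimplex.zero_le _ _, ?_⟩, ?_⟩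
  · have := stdSimplex.sum_eq_one t
    rwa [Fin.sum_univ_succAbove _ i, h, zero_add] at this
  · ext j
    rcases Fin.eq_self_or_eq_succAbove i j with rfl | ⟨j, rfl⟩
    · rw [stdSimplex_map_succAbove_self, h]
    · rw [stdSimplex_map_succAbove_apply]; rfl

variable [Quiver.IsThin C]

/-- The chain with given objects in a thin category. -/
def NerveSpace.ofChain {k : ℕ} (f : Fin (k + 1) → C)
    (h : ∀ i j, i ≤ j → Nonempty (f i ⟶ f j)) : NerveSpace C k :=
  show Fin (k + 1) ⥤ C from
    { obj := f
      map := fun g => (h _ _ (leOfHom g)).some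
      map_id := fun _ => Subsingleton.elim _ _
      map_comp := fun _ _ => Subsingleton.elim _ _ }

lemma NerveSpace.ext_vertex {k : ℕ} {x y : NerveSpace C k} (h : ∀ i, x.vertex i = y.vertex i) :
    x = y :=
  CategoryTheory.Functor.ext (F := (show Fin (k + 1) ⥤ C from x))
    (G := (show Fin (k + 1) ⥤ C from y)) h (fun _ _ _ => Subsingleton.elim _ _)

@[simp] lemma NerveSpace.vertex_ofChain {k : ℕ} (f : Fin (k + 1) → C)
    (h : ∀ i j, i ≤ j → Nonempty (f i ⟶ f j)) (i : Fin (k + 1)) :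
    (NerveSpace.ofChain f h).vertex i = f i := rfl

variable [TopologicalSpace C] [TopologicalCategory C]

/-! ### Points given by weights on a partially ordered set of labels -/

variable {ι : Type*} [PartialOrder ι]

/-- The point `b` of the classifying space is represented by the weights `w` on the labels `ι`,
each label `a` standing for the object `X a`. -/
def ClassifyingSpace.IsRep (X : ι → C) (w : ι → ℝ) (b : ClassifyingSpace C) : Prop :=
  ∃ (k : ℕ) (c : Fin (k + 1) → ι) (_ : StrictMono c)
    (hX : ∀ i j, i ≤ j → Nonempty (X (c i) ⟶ X (c j))) (t : stdSimplex ℝ (Fin (k + 1))),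
    (∀ i, t i = w (c i)) ∧ (∀ a, a ∉ range c → w a = 0) ∧
      b = ClassifyingSpace.mk (NerveSpace.ofChain (fun i => X (c i)) hX) t

namespace ClassifyingSpace

/-- Vertices of weight zero are discarded one at a time by the face identification. The process
stops at the latest at a 0-simplex, whose single coordinate is 1. -/
lemma IsRep.exists_pos {X : ι → C} {w : ι → ℝ} {b : ClassifyingSpace C} (h : IsRep X w b) :
    ∃ (k : ℕ) (c : Fin (k + 1) → ι) (_ : StrictMono c)
      (hX : ∀ i j, i ≤ j → Nonempty (X (c i) ⟶ X (c j))) (t : stdSimplex ℝ (Fin (k + 1))),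
      (∀ i, t i = w (c i)) ∧ (∀ a, a ∉ range c → w a = 0) ∧ (∀ i, t i ≠ 0) ∧
        b = ClassifyingSpace.mk (NerveSpace.ofChain (fun i => X (c i)) hX) t := by
  obtain ⟨k, c, hc, hX, t, ht, hw, hb⟩ := h
  induction k with
  | zero =>
    refine ⟨0, c, hc, hX, t, ht, hw, fun i hi => ?_, hb⟩
    have := stdSimplex.sum_eq_one t
    rw [Fin.sum_univ_one, ← Fin.eq_zero i, hi] at this
    exact zero_ne_one this
  | succ k ih =>
    by_cases h0 : ∀ i, t i ≠ 0
    · exact ⟨k + 1, c, hc, hX, t, ht, hw, h0, hb⟩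
    · push Not at h0
      obtain ⟨i, hi⟩ := h0
      obtain ⟨t', rfl⟩ := stdSimplex_exists_map_succAbove i t hi
      refine ih (c ∘ i.succAbove) (hc.comp (Fin.strictMono_succAbove i))
        (fun a b hab => hX _ _ ((Fin.strictMono_succAbove i).monotone hab)) t'
        (fun j => ?_) (fun a ha => ?_) ?_
      · rw [← stdSimplex_map_succAbove_apply i t' j, ht]; rfl
      · by_cases ha' : a ∈ range c
        · obtain ⟨j, rfl⟩ := ha'
          rcases Fin.eq_self_or_eq_succAbove i j with rfl | ⟨j, rfl⟩
          · rw [← ht, hi]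
          · exact absurd ⟨j, rfl⟩ ha
        · exact hw a ha'
      · rw [hb, ← mk_face]; rfl

/-- The represented point is unique. -/
lemma IsRep.unique {X : ι → C} {w : ι → ℝ} {b b' : ClassifyingSpace C} (h : IsRep X w b)
    (h' : IsRep X w b') : b = b' := by
  obtain ⟨k, c, hc, hX, t, ht, hw, h0, rfl⟩ := h.exists_pos
  obtain ⟨k', c', hc', hX', t', ht', hw', h0', rfl⟩ := h'.exists_pos
  -- With all coordinates nonzero the range of the chain is exactly the support of `w`, and a
  -- strictly monotone chain is determined by its range.
  have hr : range c = range c' := by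
    ext a
    constructor
    · rintro ⟨i, rfl⟩
      by_contra hh
      exact h0 i ((ht i).trans (hw' _ hh))
    · rintro ⟨i, rfl⟩
      by_contra hh
      exact h0' i ((ht' i).trans (hw _ hh))
  have hk : k = k' := by
    have h1 : (range c).ncard = k + 1 := by
      rw [← image_univ, ncard_image_of_injective _ hc.injective, ncard_univ, Nat.card_fin]
    have h2 : (range c').ncard = k' + 1 := by
      rw [← image_univ, ncard_image_of_injective _ hc'.injective, ncard_univ, Nat.card_fin]
    rw [hr] at h1
    omega
  subst hk
  have hcc : c = c' := by
    exact (StrictMono.range_inj hc hc').1 hr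
  subst hcc
  have : t = t' := by
    ext i
    rw [ht, ht']
  rw [this]

/-- Representations are natural in the set of labels. -/
lemma IsRep.map {ι' : Type*} [PartialOrder ι'] {X : ι → C} {w : ι → ℝ} {b : ClassifyingSpace C}
    (h : IsRep X w b) {X' : ι' → C} {w' : ι' → ℝ} (g : ι → ι') (hg : StrictMono g)
    (hX : ∀ a, X' (g a) = X a) (hw : ∀ a, w' (g a) = w a) (hw' : ∀ a, a ∉ range g → w' a = 0) :
    IsRep X' w' b := by
  obtain ⟨k, c, hc, hXc, t, ht, hwc, rfl⟩ := h
  refine ⟨k, g ∘ c, hg.comp hc, fun i j hij => ?_, t, fun i => ?_, fun a ha => ?_, ?_⟩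
  · simpa only [Function.comp_apply, hX] using hXc i j hij
  · rw [ht, ← hw]; rfl
  · by_cases hag : a ∈ range g
    · obtain ⟨a, rfl⟩ := hag
      rw [hw]
      exact hwc a fun ⟨i, hi⟩ => ha ⟨i, congrArg g hi⟩
    · exact hw' a hag
  · congr 1
    exact NerveSpace.ext_vertex fun i => (hX _).symm

/-- Weights whose support is a finite chain represent a point. -/
lemma exists_isRep {X : ι → C} {w : ι → ℝ} (V : Finset ι) (hV : ∀ a, w a ≠ 0 → a ∈ V)
    (h0 : ∀ a, 0 ≤ w a) (h1 : ∑ a ∈ V, w a = 1)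
    (hc : ∀ a b, w a ≠ 0 → w b ≠ 0 → a ≤ b ∨ b ≤ a)
    (hX : ∀ a b, w a ≠ 0 → w b ≠ 0 → a ≤ b → Nonempty (X a ⟶ X b)) :
    ∃ b, IsRep X w b := by
  classical
  set s : Set ι := {a | w a ≠ 0} with hs
  have hchain : IsChain (· ≤ ·) s := fun a ha b hb _ => hc a b ha hb
  -- The support is totally ordered, so its increasing enumeration is the required chain.
  let : LinearOrder s := hchain.linearOrder
  have hfin : s.Finite := V.finite_toSet.subset hV
  have : Fintype s := hfin.fintype
  have hsum : ∑ a : s, w a = 1 := by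
    rw [← h1, ← Finset.sum_filter_ne_zero V]
    refine (Finset.sum_subtype _ (fun a => ?_) w).symm
    simp only [Finset.mem_filter]
    exact ⟨fun h => h.2, fun h => ⟨hV a h, h⟩⟩
  have hne : Nonempty s := by
    by_contra hh
    rw [not_nonempty_iff] at hh
    simp at hsum
  obtain ⟨k, hk⟩ : ∃ k, Fintype.card s = k + 1 :=
    Nat.exists_eq_succ_of_ne_zero Fintype.card_ne_zero
  let e : Fin (k + 1) ≃o s := Fintype.orderIsoFinOfCardEq s hk
  have hmono : StrictMono (fun i => (e i : ι)) := fun i j hij => by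
    have := e.strictMono hij
    refine lt_of_le_of_ne (this.le) fun h => this.ne (Subtype.ext h)
  refine ⟨_, k, fun i => (e i : ι), hmono,
    fun i j hij => hX _ _ (e i).2 (e j).2 (hmono.monotone hij),
    ⟨fun i => w (e i), fun i => h0 _, ?_⟩, fun i => rfl, fun a ha => ?_, rfl⟩
  · rw [← hsum]
    exact Fintype.sum_equiv e.toEquiv _ _ (fun _ => rfl)
  · by_contra hh
    exact ha ⟨e.symm ⟨a, hh⟩, by simp⟩

/-- Points represented by continuously varying weights and objects vary continuously. -/
lemma continuousAt_of_isRep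
    (hind : IsInducing (fun f : Arrow C => ((f.left, f.right) : C × C)))
    {Z : Type*} [TopologicalSpace Z] {z₀ : Z} (X : Z → ι → C) (w : Z → ι → ℝ)
    (b : Z → ClassifyingSpace C) (V : Finset ι)
    (hrep : ∀ᶠ z in 𝓝 z₀, IsRep (X z) (w z) (b z))
    (hsupp : ∀ᶠ z in 𝓝 z₀, ∀ a, w z a ≠ 0 → a ∈ V)
    (hhom : ∀ᶠ z in 𝓝 z₀, ∀ a ∈ V, ∀ a' ∈ V, a ≤ a' → Nonempty (X z a ⟶ X z a'))
    (hw : ∀ a ∈ V, ContinuousAt (fun z => w z a) z₀)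
    (hX : ∀ a ∈ V, ContinuousAt (fun z => X z a) z₀) : ContinuousAt b z₀ := by
  classical
  -- the part of `Z` where the support lies in the chain `s`
  let A : Finset ι → Set Z := fun s => {z | ∀ a ∈ V, a ∉ s → w z a = 0}
  let G : Set Z := {z | IsRep (X z) (w z) (b z) ∧ (∀ a, w z a ≠ 0 → a ∈ V) ∧
    ∀ a ∈ V, ∀ a' ∈ V, a ≤ a' → Nonempty (X z a ⟶ X z a')}
  have hG : G ∈ 𝓝 z₀ := by
    filter_upwards [hrep, hsupp, hhom] with z h1 h2 h3 using ⟨h1, h2, h3⟩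
  have hz₀ : z₀ ∈ G := mem_of_mem_nhds hG
  let S : Finset (Finset ι) := V.powerset.filter fun s => ∃ (k : ℕ) (c : Fin (k + 1) → ι),
    StrictMono c ∧ (s : Set ι) = range c
  have hcover : G ⊆ ⋃ s ∈ S, A s := by
    rintro z ⟨h1, h2, h3⟩
    obtain ⟨k, c, hc, hXc, t, ht, hwc, h0, -⟩ := h1.exists_pos
    have hcV : ∀ i, c i ∈ V := fun i => h2 _ (by rw [← ht]; exact h0 i)
    refine mem_iUnion₂.2 ⟨Finset.univ.image c, ?_, fun a _ ha => hwc a ?_⟩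
    · refine Finset.mem_filter.2 ⟨Finset.mem_powerset.2 ?_, k, c, hc, by simp⟩
      intro a ha
      obtain ⟨i, -, rfl⟩ := Finset.mem_image.1 ha
      exact hcV i
    · simpa using ha
  -- The support may grow near `z₀` in several incompatible ways, so no single simplex contains all
  -- nearby values. Only finitely many chains of labels occur, and convergence can be tested on each
  -- of the corresponding pieces.
  have hle : 𝓝 z₀ ≤ ⨆ s ∈ S, 𝓝 z₀ ⊓ Filter.principal (G ∩ A s) := by
    have h1 : 𝓝 z₀ ≤ 𝓝 z₀ ⊓ Filter.principal (⋃ s ∈ S, (G ∩ A s)) := by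
      refine le_inf le_rfl (Filter.le_principal_iff.2 (Filter.mem_of_superset hG fun z hz => ?_))
      obtain ⟨s, hs, hzs⟩ := mem_iUnion₂.1 (hcover hz)
      exact mem_iUnion₂.2 ⟨s, hs, hz, hzs⟩
    refine h1.trans ?_
    rw [← Finset.set_biUnion_coe]
    clear h1
    intro U hU
    simp only [Filter.mem_iSup] at hU
    rw [Filter.mem_inf_principal]
    have : ∀ s ∈ S, ∀ᶠ z in 𝓝 z₀, z ∈ G ∩ A s → z ∈ U := fun s hs =>
      Filter.mem_inf_principal.1 (hU s hs)
    rw [← Filter.eventually_all_finset] at this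
    filter_upwards [this] with z hz hzS
    obtain ⟨s, hs, hzs⟩ := mem_iUnion₂.1 hzS
    exact hz s hs hzs
  refine Filter.Tendsto.mono_left ?_ hle
  rw [Filter.tendsto_iSup]; intro s
  rw [Filter.tendsto_iSup]; intro hs
  obtain ⟨hsV, k, c, hc, hsc⟩ := Finset.mem_filter.1 hs
  rw [Finset.mem_powerset] at hsV
  have hcs : ∀ i, c i ∈ s := fun i => by
    rw [← Finset.mem_coe, hsc]; exact ⟨i, rfl⟩
  by_cases hz₀s : z₀ ∈ A s
  · -- on this part, `b` is given by a fixed chain of labels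
    have key : ∀ z : ↥(G ∩ A s), ∃ hXc : ∀ i j, i ≤ j → Nonempty (X z (c i) ⟶ X z (c j)),
        ∃ t : stdSimplex ℝ (Fin (k + 1)), (∀ i, t i = w z (c i)) ∧
        b z = ClassifyingSpace.mk (NerveSpace.ofChain (fun i => X z (c i)) hXc) t := by
      rintro ⟨z, ⟨h1, h2, h3⟩, h4⟩
      have hXc : ∀ i j, i ≤ j → Nonempty (X z (c i) ⟶ X z (c j)) := fun i j hij =>
        h3 _ (hsV (hcs i)) _ (hsV (hcs j)) (hc.monotone hij)
      have hz0 : ∀ a, a ∉ range c → w z a = 0 := fun a ha => by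
        by_contra hh
        refine hh (h4 a (h2 a hh) fun has => ha ?_)
        rw [← hsc]; exact has
      -- This second chain only serves to show that the weights are nonnegative with sum 1; the
      -- identification of `b z` on the chain `c` follows from uniqueness.
      obtain ⟨m, c', hc', hX', t', ht', hw', h0', hb⟩ := h1.exists_pos
      have hle' : ∀ a, 0 ≤ w z a := fun a => by
        by_cases ha : a ∈ range c'
        · obtain ⟨i, rfl⟩ := ha
          rw [← ht']; exact stdSimplex.zero_le _ _
        · rw [hw' a ha]
      have hsum : ∑ i, w z (c i) = 1 := by
        have h5 := stdSimplex.sum_eq_one t'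
        simp only [ht'] at h5
        rw [← h5]
        have e1 : ∑ i, w z (c i) = ∑ a ∈ Finset.univ.image c, w z a :=
          (Finset.sum_image hc.injective.injOn).symm
        have e2 : ∑ i, w z (c' i) = ∑ a ∈ Finset.univ.image c', w z a :=
          (Finset.sum_image hc'.injective.injOn).symm
        rw [e1, e2]
        symm
        refine Finset.sum_subset ?_ ?_
        · intro a ha
          obtain ⟨i, -, rfl⟩ := Finset.mem_image.1 ha
          by_contra hh
          refine h0' i ((ht' i).trans (hz0 _ fun ⟨j, hj⟩ => hh ?_))
          exact Finset.mem_image.2 ⟨j, Finset.mem_univ _, hj⟩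
        · intro a _ ha
          refine hw' a fun ⟨j, hj⟩ => ha ?_
          exact Finset.mem_image.2 ⟨j, Finset.mem_univ _, hj⟩
      let t : stdSimplex ℝ (Fin (k + 1)) := ⟨fun i => w z (c i), fun i => hle' _, hsum⟩
      exact ⟨hXc, t, fun i => rfl, h1.unique ⟨k, c, hc, hXc, t, fun i => rfl, hz0, rfl⟩⟩
    choose hXc t ht hb using key
    have hmap : 𝓝 z₀ ⊓ Filter.principal (G ∩ A s) =
        Filter.map ((↑) : ↥(G ∩ A s) → Z) (𝓝 ⟨z₀, hz₀, hz₀s⟩) := by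
      rw [map_nhds_subtype_val]; rfl
    rw [hmap, Filter.tendsto_map'_iff]
    have hval : ContinuousAt ((↑) : ↥(G ∩ A s) → Z) ⟨z₀, hz₀, hz₀s⟩ :=
      continuous_subtype_val.continuousAt
    have h1 : ContinuousAt (fun z : ↥(G ∩ A s) =>
        (NerveSpace.ofChain (fun i => X z (c i)) (hXc z), t z)) ⟨z₀, hz₀, hz₀s⟩ := by
      refine ContinuousAt.prodMk (NerveSpace.continuousAt_iff hind fun i => ?_) ?_
      · simp only [NerveSpace.vertex_ofChain]
        exact ContinuousAt.comp (f := ((↑) : ↥(G ∩ A s) → Z)) (g := fun z => X z (c i))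
          (hX _ (hsV (hcs i))) hval
      · rw [IsInducing.subtypeVal.continuousAt_iff]
        refine continuousAt_pi.2 fun i => ?_
        have : (fun z : ↥(G ∩ A s) => (Subtype.val ∘ t) z i) =
            fun z : ↥(G ∩ A s) => w z (c i) := funext fun z => ht z i
        rw [this]
        exact ContinuousAt.comp (f := ((↑) : ↥(G ∩ A s) → Z)) (g := fun z => w z (c i))
          (hw _ (hsV (hcs i))) hval
    have h2 := (continuous_mk (C := C) k).continuousAt.comp h1
    have h3 : (b ∘ ((↑) : ↥(G ∩ A s) → Z)) = (fun p : NerveSpace C k × stdSimplex ℝ (Fin (k + 1)) =>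
      (ClassifyingSpace.mk p.1 p.2 : ClassifyingSpace C)) ∘ fun z : ↥(G ∩ A s) =>
        (NerveSpace.ofChain (fun i => X z (c i)) (hXc z), t z) := funext fun z => hb z
    have h4 : b z₀ = ((fun p : NerveSpace C k × stdSimplex ℝ (Fin (k + 1)) =>
      (ClassifyingSpace.mk p.1 p.2 : ClassifyingSpace C)) ∘ fun z : ↥(G ∩ A s) =>
        (NerveSpace.ofChain (fun i => X z (c i)) (hXc z), t z)) ⟨z₀, hz₀, hz₀s⟩ :=
      hb ⟨z₀, hz₀, hz₀s⟩
    rw [h3, h4]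
    exact h2
  · -- `z₀` is not in the closure of this part
    have : 𝓝 z₀ ⊓ Filter.principal (G ∩ A s) = ⊥ := by
      rw [Filter.inf_principal_eq_bot]
      simp only [A, mem_ofPred_eq, not_forall] at hz₀s
      obtain ⟨a, haV, has, hne⟩ := hz₀s
      filter_upwards [(hw a haV).eventually_ne hne] with z hz hzA
      exact hz (hzA.2 a haV has)
    rw [this]
    exact Filter.tendsto_bot

end ClassifyingSpace

end Chains

end

noncomputable section

/-! ## Weights of step functions -/

section StepFunctions

open MeasureTheory

/-- The length of the part of `[0, 1)` on which the step function `f` has the value `a`. -/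
def stepWeight {ι : Type*} (f : ℝ → ι) (a : ι) : ℝ :=
  (volume : Measure ℝ).real {v | v ∈ Ico (0 : ℝ) 1 ∧ f v = a}

variable {ι : Type*}

lemma stepWeight_nonneg (f : ℝ → ι) (a : ι) : 0 ≤ stepWeight f a := measureReal_nonneg

lemma exists_eq_of_stepWeight_ne_zero {f : ℝ → ι} {a : ι} (h : stepWeight f a ≠ 0) :
    ∃ v ∈ Ico (0 : ℝ) 1, f v = a := by
  by_contra hh
  push Not at hh
  refine h ?_
  have : {v | v ∈ Ico (0 : ℝ) 1 ∧ f v = a} = ∅ := by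
    ext v
    simp only [mem_ofPred_eq, mem_empty_iff_false, iff_false, not_and]
    exact hh v
  rw [stepWeight, this, measureReal_empty]

/-- The fibres of a monotone function on `[0, 1)` are order-connected, hence measurable, and they
partition an interval of length 1. -/
lemma sum_stepWeight [PartialOrder ι] {f : ℝ → ι} (hf : MonotoneOn f (Ico 0 1)) (V : Finset ι)
    (hV : ∀ v ∈ Ico (0 : ℝ) 1, f v ∈ V) : ∑ a ∈ V, stepWeight f a = 1 := by
  have hmeas : ∀ a, MeasurableSet {v | v ∈ Ico (0 : ℝ) 1 ∧ f v = a} := fun a => by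
    refine OrdConnected.measurableSet ⟨fun x hx y hy z hz => ?_⟩
    have hz' : z ∈ Ico (0 : ℝ) 1 := ⟨hx.1.1.trans hz.1, hz.2.trans_lt hy.1.2⟩
    refine ⟨hz', le_antisymm ?_ ?_⟩
    · rw [← hy.2]; exact hf hz' hy.1 hz.2
    · rw [← hx.2]; exact hf hx.1 hz' hz.1
  have hfin : ∀ a ∈ V, volume {v | v ∈ Ico (0 : ℝ) 1 ∧ f v = a} ≠ ⊤ := fun a _ =>
    ne_of_lt ((measure_mono fun v hv => hv.1).trans_lt (measure_Ico_lt_top (a := 0) (b := 1)))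
  have h1 := measureReal_biUnion_finset (μ := (volume : Measure ℝ)) (s := V)
    (f := fun a => {v | v ∈ Ico (0 : ℝ) 1 ∧ f v = a})
    (fun a _ b _ hab => Set.disjoint_left.2 fun v hv hv' => hab (hv.2.symm.trans hv'.2))
    (fun a _ => hmeas a) hfin
  have h2 : ⋃ a ∈ V, {v | v ∈ Ico (0 : ℝ) 1 ∧ f v = a} = Ico 0 1 := by
    ext v
    simp only [mem_iUnion, mem_ofPred_eq, exists_prop]
    exact ⟨fun ⟨a, _, h, _⟩ => h, fun h => ⟨f v, hV v h, h, rfl⟩⟩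
  rw [h2] at h1
  simp only [stepWeight]
  rw [← h1]
  simp

/-- For fixed `v` different from all thresholds, the set of thresholds already passed is locally
constant in `θ`. Dominated convergence then gives continuity of the measure, for an arbitrary
condition `E` on that set. -/
lemma continuous_volume_thresholds {A : Type*} [Finite A] (E : Set A → Prop) :
    Continuous fun θ : A → ℝ =>
      (volume : Measure ℝ).real {v | v ∈ Ico (0 : ℝ) 1 ∧ E {x | θ x ≤ v}} := by
  classical
  cases nonempty_fintype A
  have hmeas : ∀ θ : A → ℝ, MeasurableSet {v : ℝ | v ∈ Ico (0 : ℝ) 1 ∧ E {x | θ x ≤ v}} := by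
    intro θ
    have h1 : {v : ℝ | E {x | θ x ≤ v}} =
        -- Splitting according to which thresholds have been passed gives a countable union of
        -- finite intersections of half-lines.
        ⋃ B ∈ {B : Set A | E B}, ⋂ x : A, {v : ℝ | x ∈ B ↔ θ x ≤ v} := by
      ext v
      simp only [mem_iUnion, mem_iInter, mem_ofPred_eq, exists_prop]
      constructor
      · intro h
        exact ⟨_, h, fun x => Iff.rfl⟩
      · rintro ⟨B, hB, h⟩
        have : {x | θ x ≤ v} = B := by ext x; exact (h x).symm
        rwa [this]
    have h2 : MeasurableSet {v : ℝ | E {x | θ x ≤ v}} := by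
      rw [h1]
      refine MeasurableSet.biUnion (Set.to_countable _) fun B _ => MeasurableSet.iInter fun x => ?_
      by_cases hx : x ∈ B
      · simp only [hx, true_iff]; exact measurableSet_Ici
      · simp only [hx, false_iff, not_le]; exact measurableSet_Iio
    exact measurableSet_Ico.inter h2
  have heq : (fun θ : A → ℝ =>
      (volume : Measure ℝ).real {v | v ∈ Ico (0 : ℝ) 1 ∧ E {x | θ x ≤ v}}) =
      fun θ => ∫ v, indicator {v | v ∈ Ico (0 : ℝ) 1 ∧ E {x | θ x ≤ v}} (fun _ => (1 : ℝ)) v := by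
    funext θ
    rw [integral_indicator_const _ (hmeas θ)]
    simp
  rw [heq, continuous_iff_continuousAt]
  intro θ₀
  refine continuousAt_of_dominated (bound := indicator (Ico (0 : ℝ) 1) (fun _ => (1 : ℝ)))
    ?_ ?_ ?_ ?_
  · exact Filter.Eventually.of_forall fun θ =>
      (measurable_const.indicator (hmeas θ)).aestronglyMeasurable
  · refine Filter.Eventually.of_forall fun θ => Filter.Eventually.of_forall fun v => ?_
    by_cases hv : v ∈ Ico (0 : ℝ) 1
    · rw [indicator_of_mem hv]
      refine (norm_indicator_le_norm_self _ _).trans ?_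
      simp
    · rw [indicator_of_notMem hv, indicator_of_notMem (fun h => hv h.1)]
      simp
  · exact (integrable_indicator_iff measurableSet_Ico).2 (integrableOn_const (by simp))
  · have hae : ∀ᵐ v : ℝ, ∀ x, θ₀ x ≠ v := by
      rw [ae_all_iff]
      intro x
      have := Measure.ae_ne (μ := (volume : Measure ℝ)) (θ₀ x)
      filter_upwards [this] with v hv using hv.symm
    filter_upwards [hae] with v hv
    have : ∀ᶠ θ in 𝓝 θ₀, {x : A | θ x ≤ v} = {x | θ₀ x ≤ v} := by
      have h : ∀ x, ∀ᶠ θ in 𝓝 θ₀, (θ x ≤ v ↔ θ₀ x ≤ v) := by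
        intro x
        have hc : ContinuousAt (fun θ : A → ℝ => θ x) θ₀ := (continuous_apply x).continuousAt
        rcases lt_or_gt_of_ne (hv x) with h | h
        · filter_upwards [hc.eventually_lt_const h] with θ hθ
          exact ⟨fun _ => h.le, fun _ => hθ.le⟩
        · filter_upwards [hc.eventually_const_lt h] with θ hθ
          exact ⟨fun h' => absurd hθ h'.not_gt, fun h' => absurd h h'.not_gt⟩
      filter_upwards [Filter.eventually_all.2 h] with θ hθ
      ext x
      exact hθ x
    refine (continuousAt_const (y := indicator {v | v ∈ Ico (0 : ℝ) 1 ∧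
      E {x | θ₀ x ≤ v}} (fun _ => (1 : ℝ)) v)).congr ?_
    filter_upwards [this] with θ hθ
    simp only [indicator, mem_ofPred_eq, hθ]

/-- The weights of a step function with finitely many thresholds depend continuously on the
thresholds. -/
lemma continuousAt_stepWeight {Z A : Type*} [TopologicalSpace Z] [Finite A] {z₀ : Z}
    (f : Z → ℝ → ι) (θ : Z → A → ℝ) (g : Set A → ι)
    (hf : ∀ᶠ z in 𝓝 z₀, ∀ v ∈ Ico (0 : ℝ) 1, f z v = g {x | θ z x ≤ v})
    (hθ : ∀ x, ContinuousAt (fun z => θ z x) z₀) (a : ι) :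
    ContinuousAt (fun z => stepWeight (f z) a) z₀ := by
  have h1 : ContinuousAt (fun z => (volume : Measure ℝ).real
      {v | v ∈ Ico (0 : ℝ) 1 ∧ g {x | θ z x ≤ v} = a}) z₀ :=
    (continuous_volume_thresholds (fun B => g B = a)).continuousAt.comp (continuousAt_pi.2 hθ)
  refine h1.congr ?_
  filter_upwards [hf] with z hz
  rw [stepWeight]
  congr 1
  ext v
  simp only [mem_ofPred_eq]
  constructor
  · rintro ⟨h, h'⟩
    exact ⟨h, (hz v h).trans h'⟩
  · rintro ⟨h, h'⟩
    exact ⟨h, (hz v h).symm.trans h'⟩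

/-- The set of indices whose threshold has been reached (if it is finite). -/
def levelSet (τ : ℕ → ℝ) (v : ℝ) : Finset ℕ :=
  haveI := Classical.dec {i | τ i ≤ v}.Finite
  if h : {i | τ i ≤ v}.Finite then h.toFinset else ∅

/-- The step function with values in `WithBot (Fin n) × Finset ℕ` given by thresholds. -/
def stepLabel {n : ℕ} (T : Fin n → ℝ) (τ : ℕ → ℝ) (v : ℝ) : WithBot (Fin n) × Finset ℕ :=
  ((Finset.univ.filter fun l => T l ≤ v).max, levelSet τ v)

lemma mem_levelSet {τ : ℕ → ℝ} {N : ℕ} (hN : ∀ i, N ≤ i → 1 ≤ τ i) {v : ℝ} (hv : v < 1) {i : ℕ} :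
    i ∈ levelSet τ v ↔ τ i ≤ v := by
  have h : {i | τ i ≤ v}.Finite := (Set.finite_lt_nat N).subset fun j hj => by
    by_contra hh
    exact absurd ((hN j (not_lt.1 hh)).trans hj) hv.not_ge
  rw [levelSet, dif_pos h]
  simp

lemma lt_of_mem_levelSet {τ : ℕ → ℝ} {N : ℕ} (hN : ∀ i, N ≤ i → 1 ≤ τ i) {v : ℝ} (hv : v < 1)
    {i : ℕ} (hi : i ∈ levelSet τ v) : i < N := by
  by_contra hh
  exact absurd ((hN i (not_lt.1 hh)).trans ((mem_levelSet hN hv).1 hi)) hv.not_ge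

lemma stepLabel_monotoneOn {n : ℕ} (T : Fin n → ℝ) {τ : ℕ → ℝ} {N : ℕ}
    (hN : ∀ i, N ≤ i → 1 ≤ τ i) : MonotoneOn (stepLabel T τ) (Ico 0 1) := by
  intro v hv v' hv' hvv'
  refine Prod.mk_le_mk.2 ⟨Finset.max_mono fun l hl => ?_, fun i hi => ?_⟩
  · simp only [Finset.mem_filter, Finset.mem_univ, true_and] at hl ⊢
    exact hl.trans hvv'
  · rw [mem_levelSet hN hv'.2]
    exact ((mem_levelSet hN hv.2).1 hi).trans hvv'

/-- Near `z₀` the thresholds with index at least `N` are never reached on `[0, 1)`, so finitely many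
thresholds determine the label. -/
lemma continuousAt_stepWeight_stepLabel {Z : Type*} [TopologicalSpace Z] {z₀ : Z} {n N : ℕ}
    (T : Z → Fin n → ℝ) (τ : Z → ℕ → ℝ) (hN : ∀ᶠ z in 𝓝 z₀, ∀ i, N ≤ i → 1 ≤ τ z i)
    (hT : ∀ l, ContinuousAt (fun z => T z l) z₀) (hτ : ∀ i, ContinuousAt (fun z => τ z i) z₀)
    (a : WithBot (Fin n) × Finset ℕ) :
    ContinuousAt (fun z => stepWeight (stepLabel (T z) (τ z)) a) z₀ := by
  classical
  refine continuousAt_stepWeight (A := Fin n ⊕ Fin N) _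
    (fun z => Sum.elim (T z) (fun i => τ z i))
    (fun B => ((Finset.univ.filter fun l => Sum.inl l ∈ B).max,
      (Finset.univ.filter fun i : Fin N => Sum.inr i ∈ B).map Fin.valEmbedding)) ?_ ?_ a
  · filter_upwards [hN] with z hz v hv
    refine Prod.ext ?_ ?_
    · simp only [stepLabel]
      congr 1
    · ext i
      simp only [stepLabel, mem_levelSet hz hv.2, Finset.mem_map, Fin.valEmbedding_apply]
      constructor
      · intro h
        exact ⟨⟨i, lt_of_mem_levelSet hz hv.2 ((mem_levelSet hz hv.2).2 h)⟩,
          Finset.mem_filter.2 ⟨Finset.mem_univ _, h⟩, rfl⟩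
      · rintro ⟨j, hj, rfl⟩
        exact (Finset.mem_filter.1 hj).2
  · rintro (l | i)
    · exact hT l
    · exact hτ i

/-- Geometric decay makes the tail uniformly small, so only finitely many terms need to be
controlled by their own continuity. -/
lemma continuousAt_iSup_of_decay {Z : Type*} [TopologicalSpace Z] {z₀ : Z} {g : ℕ → Z → ℝ}
    {K : ℝ} (hg : ∀ i, ContinuousAt (g i) z₀) (hK : ∀ i z, |g i z| ≤ K * (1 / 2) ^ i) :
    ContinuousAt (fun z => ⨆ i, g i z) z₀ := by
  have hK0 : 0 ≤ K := by simpa using (abs_nonneg _).trans (hK 0 z₀)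
  have hbdd : ∀ z, BddAbove (range fun i => g i z) := fun z => by
    refine ⟨K, ?_⟩
    rintro _ ⟨i, rfl⟩
    refine (le_abs_self _).trans ((hK i z).trans ?_)
    exact mul_le_of_le_one_right hK0 (pow_le_one₀ (by norm_num) (by norm_num))
  rw [Metric.continuousAt_iff']
  intro ε hε
  obtain ⟨N, hN⟩ : ∃ N : ℕ, K * (1 / 2 : ℝ) ^ N < ε / 4 := by
    -- Dividing by `K + 1` avoids the case `K = 0`. Tail terms are at most `ε / 4` in absolute
    -- value, so any two values of such a term differ by at most `ε / 2`.
    obtain ⟨N, hN⟩ := exists_pow_lt_of_lt_one (show (0 : ℝ) < ε / 4 / (K + 1) by positivity)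
      (show (1 / 2 : ℝ) < 1 by norm_num)
    refine ⟨N, ?_⟩
    rw [lt_div_iff₀ (by positivity)] at hN
    nlinarith [pow_pos (show (0 : ℝ) < 1 / 2 by norm_num) N]
  have h1 : ∀ᶠ z in 𝓝 z₀, ∀ i ∈ Finset.range N, |g i z - g i z₀| < ε / 2 := by
    rw [Filter.eventually_all_finset]
    intro i _
    have := (Metric.continuousAt_iff'.1 (hg i)) (ε / 2) (by positivity)
    simpa [Real.dist_eq] using this
  filter_upwards [h1] with z hz
  have h2 : ∀ i, |g i z - g i z₀| ≤ ε / 2 := by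
    intro i
    by_cases hi : i < N
    · exact (hz i (Finset.mem_range.2 hi)).le
    · have h3 : ∀ z, |g i z| ≤ ε / 4 := fun z => by
        refine (hK i z).trans (le_trans ?_ hN.le)
        exact mul_le_mul_of_nonneg_left
          (pow_le_pow_of_le_one (by norm_num) (by norm_num) (not_lt.1 hi)) hK0
      calc |g i z - g i z₀| ≤ |g i z| + |g i z₀| := abs_sub _ _
        _ ≤ ε / 2 := by linarith [h3 z, h3 z₀]
  have h4 : ∀ z z', (∀ i, |g i z - g i z'| ≤ ε / 2) → (⨆ i, g i z) ≤ (⨆ i, g i z') + ε / 2 := by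
    intro z z' h
    refine ciSup_le fun i => ?_
    have := le_ciSup (hbdd z') i
    have h5 := (abs_le.1 (h i)).2
    linarith
  have h5 := h4 z z₀ h2
  have h6 := h4 z₀ z (fun i => by rw [abs_sub_comm]; exact h2 i)
  rw [Real.dist_eq]
  exact lt_of_le_of_lt (abs_le.2 ⟨by linarith, by linarith⟩) (half_lt_self hε)

end StepFunctions

end

noncomputable section

/-! ## Contracting the classifying space of a thin category -/

section JoinSystems

universe v u

/-- A system of objects `y S` together with partially defined joins `obj s x S` of the object `x`,
shrunk by the factor `s`, with `y S`. The join is defined where `D i x s > 0` for all `i ∈ S`. -/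
structure JoinSystem (C : Type u) [Category.{v} C] [TopologicalSpace C] where
  D : ℕ → C → ℝ → ℝ
  obj : ℝ → C → Finset ℕ → C
  y : Finset ℕ → C
  continuous_D : ∀ i, Continuous fun p : C × ℝ => D i p.1 p.2
  D_nonneg : ∀ i x s, 0 ≤ D i x s
  D_le_one : ∀ i x s, D i x s ≤ 1
  -- Index 0 is never joined with an object; it is reserved for the end point of the contraction.
  D_zero : ∀ x s, D 0 x s = 0
  D_hom : ∀ i x x' s, Nonempty (x ⟶ x') → D i x' s ≤ D i x s
  D_antitone : ∀ i x s s', s ≤ s' → D i x s' ≤ D i x s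
  D_pos : ∀ x, ∃ i, 0 < D i x 0
  obj_one : ∀ x, obj 1 x ∅ = x
  obj_hom : ∀ s x x' S S', 0 < s → Nonempty (x ⟶ x') → S ⊆ S' → (∀ i ∈ S', 0 < D i x' s) →
    Nonempty (obj s x S ⟶ obj s x' S')
  y_hom : ∀ S S', S.Nonempty → S ⊆ S' → Nonempty (y S ⟶ y S')
  y_obj : ∀ s x S S', 0 < s → S.Nonempty → S ⊆ S' → (∀ i ∈ S', 0 < D i x s) →
    Nonempty (y S ⟶ obj s x S')
  continuousAt_obj : ∀ s x S, 0 < s → (∀ i ∈ S, 0 < D i x s) →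
    ContinuousAt (fun p : C × ℝ => obj p.2 p.1 S) (x, s)

/-- The piecewise linear function which is `0` up to `n` and `1` from `n + 1` on. -/
def clamp (n : ℕ) (r : ℝ) : ℝ := max 0 (min 1 (r - n))

lemma clamp_nonneg (n : ℕ) (r : ℝ) : 0 ≤ clamp n r := le_max_left _ _

lemma clamp_le_one (n : ℕ) (r : ℝ) : clamp n r ≤ 1 := max_le zero_le_one (min_le_left _ _)

lemma clamp_eq_zero {n : ℕ} {r : ℝ} (h : r ≤ n) : clamp n r = 0 :=
  max_eq_left ((min_le_right _ _).trans (by linarith))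

lemma clamp_eq_one {n : ℕ} {r : ℝ} (h : (n : ℝ) + 1 ≤ r) : clamp n r = 1 := by
  rw [clamp, min_eq_left (by linarith), max_eq_right zero_le_one]

lemma continuous_clamp (n : ℕ) : Continuous (clamp n) := by unfold clamp; fun_prop

lemma lt_of_clamp_pos {n : ℕ} {r : ℝ} (h : 0 < clamp n r) : (n : ℝ) < r := by
  by_contra hh
  rw [clamp_eq_zero (not_lt.1 hh)] at h
  exact lt_irrefl _ h

lemma lt_of_clamp_lt_one {n : ℕ} {r : ℝ} (h : clamp n r < 1) : r < (n : ℝ) + 1 := by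
  by_contra hh
  rw [clamp_eq_one (not_lt.1 hh)] at h
  exact lt_irrefl _ h

lemma stdSimplex_sum_map_succAbove {k : ℕ} (i : Fin (k + 2)) (t : stdSimplex ℝ (Fin (k + 1)))
    (g : Fin (k + 2) → ℝ) :
    ∑ j, stdSimplex.map i.succAbove t j * g j = ∑ j, t j * g (i.succAbove j) := by
  rw [Fin.sum_univ_succAbove _ i, stdSimplex_map_succAbove_self]
  simp [stdSimplex_map_succAbove_apply]

lemma stdSimplex_continuous_coe {k : ℕ} (j : Fin (k + 1)) :
    Continuous fun t : stdSimplex ℝ (Fin (k + 1)) => t j :=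
  (continuous_apply j).comp continuous_subtype_val

namespace JoinSystem

variable {C : Type u} [Category.{v} C] [TopologicalSpace C] (J : JoinSystem C)

/-- The supremum of the weighted distances `2⁻ⁱ D i x s`. -/
def gap (x : C) (s : ℝ) : ℝ := ⨆ i, (1 / 2 : ℝ) ^ i * J.D i x s

lemma weighted_nonneg (i : ℕ) (x : C) (s : ℝ) : 0 ≤ (1 / 2 : ℝ) ^ i * J.D i x s :=
  mul_nonneg (by positivity) (J.D_nonneg i x s)

lemma weighted_le (i : ℕ) (x : C) (s : ℝ) : (1 / 2 : ℝ) ^ i * J.D i x s ≤ (1 / 2 : ℝ) ^ i :=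
  mul_le_of_le_one_right (by positivity) (J.D_le_one i x s)

lemma half_pow_le_one (i : ℕ) : (1 / 2 : ℝ) ^ i ≤ 1 := pow_le_one₀ (by norm_num) (by norm_num)

lemma bddAbove_weighted (x : C) (s : ℝ) :
    BddAbove (range fun i => (1 / 2 : ℝ) ^ i * J.D i x s) := by
  refine ⟨1, ?_⟩
  rintro _ ⟨i, rfl⟩
  exact (J.weighted_le i x s).trans (half_pow_le_one i)

lemma continuous_weighted (i : ℕ) :
    Continuous fun p : C × ℝ => (1 / 2 : ℝ) ^ i * J.D i p.1 p.2 :=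
  continuous_const.mul (J.continuous_D i)

lemma continuous_gap : Continuous fun p : C × ℝ => J.gap p.1 p.2 :=
  continuous_iff_continuousAt.2 fun _ => continuousAt_iSup_of_decay (K := 1)
    (fun i => (J.continuous_weighted i).continuousAt) fun i p => by
      rw [abs_of_nonneg (J.weighted_nonneg i _ _), one_mul]
      exact J.weighted_le i _ _

lemma gap_antitone {x : C} {s s' : ℝ} (h : s ≤ s') : J.gap x s' ≤ J.gap x s :=
  ciSup_mono (J.bddAbove_weighted x s) fun i =>
    mul_le_mul_of_nonneg_left (J.D_antitone i x s s' h) (by positivity)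

lemma gap_zero_pos (x : C) : 0 < J.gap x 0 := by
  obtain ⟨i, hi⟩ := J.D_pos x
  exact (mul_pos (by positivity) hi).trans_le (le_ciSup (J.bddAbove_weighted x 0) i)

/-- A factor by which `x` can be shrunk so as to be disjoint from one of the `y`. -/
def radius (x : C) : ℝ := sSup ((fun s => min s (J.gap x s)) '' Icc 0 1)

lemma continuous_min_gap : Continuous fun p : C × ℝ => min p.2 (J.gap p.1 p.2) :=
  continuous_snd.min J.continuous_gap

/-- A maximum over the compact interval of a jointly continuous function is continuous; a pointwise
choice of a shrinking factor would not be. -/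
lemma continuous_radius : Continuous J.radius :=
  isCompact_Icc.continuous_sSup (f := fun x s => min s (J.gap x s)) J.continuous_min_gap

lemma exists_radius_eq (x : C) : ∃ s ∈ Icc (0 : ℝ) 1, J.radius x = min s (J.gap x s) ∧
    ∀ s' ∈ Icc (0 : ℝ) 1, min s' (J.gap x s') ≤ min s (J.gap x s) :=
  isCompact_Icc.exists_sSup_image_eq_and_ge ⟨0, by simp⟩
    (f := fun s => min s (J.gap x s))
    (J.continuous_min_gap.comp (Continuous.prodMk_right x)).continuousOn

lemma radius_le_one (x : C) : J.radius x ≤ 1 := by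
  obtain ⟨s, hs, h, -⟩ := J.exists_radius_eq x
  rw [h]
  exact (min_le_left _ _).trans hs.2

/-- The gap is positive at `s = 0`, hence at some small positive `s`, where the minimum of `s` and
the gap is positive. -/
lemma radius_pos (x : C) : 0 < J.radius x := by
  obtain ⟨s, hs, h, h'⟩ := J.exists_radius_eq x
  rw [h]
  have hc : ContinuousAt (fun s => J.gap x s) 0 :=
    (J.continuous_gap.comp (Continuous.prodMk_right x)).continuousAt
  have h1 : ∀ᶠ s in 𝓝 (0 : ℝ), 0 < J.gap x s := hc.eventually_const_lt (J.gap_zero_pos x)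
  obtain ⟨ε, hε, h2⟩ := Metric.eventually_nhds_iff.1 h1
  have h3 : 0 < min (ε / 2) 1 := by positivity
  have h4 : min (ε / 2) 1 < ε := (min_le_left _ _).trans_lt (half_lt_self hε)
  refine lt_of_lt_of_le (lt_min h3 (h2 ?_)) (h' (min (ε / 2) 1) ⟨h3.le, min_le_right _ _⟩)
  rw [Real.dist_eq, sub_zero, abs_of_pos h3]
  exact h4

/-- At a maximizing `s'` both `s'` and the gap are at least the radius. Since the gap only increases
under further shrinking, it is positive for all factors up to the radius. -/
lemma gap_pos {x : C} {s : ℝ} (h : s ≤ J.radius x) : 0 < J.gap x s := by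
  obtain ⟨s', hs, h1, -⟩ := J.exists_radius_eq x
  have h2 := J.radius_pos x
  rw [h1] at h2 h
  exact (h2.trans_le (min_le_right _ _)).trans_le (J.gap_antitone (h.trans (min_le_left _ _)))

/-! ### Shrinking factors, average distances and thresholds on one simplex -/

section Simplex

variable {k : ℕ} (x : Fin (k + 1) → C) (t : stdSimplex ℝ (Fin (k + 1)))

/-- The factor by which the objects of a simplex are shrunk at the point `t`. -/
def scale : ℝ := ∑ j, t j * J.radius (x j)

/-- The weighted distance of the `j`-th object, shrunk by the factor `scale`, from `y i`. -/
def dist (i : ℕ) (j : Fin (k + 1)) : ℝ := (1 / 2 : ℝ) ^ i * J.D i (x j) (J.scale x t)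

/-- The average of the distances from `y i`. -/
def avg (i : ℕ) : ℝ := ∑ j, t j * J.dist x t i j

/-- The maximum of the average distances. -/
def maxAvg : ℝ := ⨆ i, J.avg x t i

/-- A function which is positive only for those `j` which are distant from all relevant `y i`. -/
def keep (j : Fin (k + 1)) : ℝ :=
  max 0 (J.maxAvg x t - ⨆ i, (2 * min (J.avg x t i) (3 / 4 * J.maxAvg x t) - J.dist x t i j))

/-- The barycentric coordinates after moving towards the relevant vertices. -/
def moved (j : Fin (k + 1)) : ℝ := t j * J.keep x t j / ∑ l, t l * J.keep x t l

/-- The threshold from which on `y i` is used. -/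
def level (i : ℕ) : ℝ := 1 - max 0 (4 * J.avg x t i / J.maxAvg x t - 3)

lemma scale_pos : 0 < J.scale x t := by
  have h0 : ∀ j, 0 ≤ t j * J.radius (x j) := fun j =>
    mul_nonneg (stdSimplex.zero_le t j) (J.radius_pos _).le
  refine lt_of_le_of_ne (Finset.sum_nonneg fun j _ => h0 j) fun h => ?_
  have h1 := (Finset.sum_eq_zero_iff_of_nonneg fun j _ => h0 j).1 h.symm
  have h2 : ∀ j, t j = 0 := fun j =>
    (mul_eq_zero.1 (h1 j (Finset.mem_univ _))).resolve_right (J.radius_pos _).ne'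
  have h3 := stdSimplex.sum_eq_one t
  simp [h2] at h3

lemma scale_le_one : J.scale x t ≤ 1 := by
  rw [← stdSimplex.sum_eq_one t]
  exact Finset.sum_le_sum fun j _ => mul_le_of_le_one_right (stdSimplex.zero_le t j)
    (J.radius_le_one _)

lemma dist_nonneg (i : ℕ) (j : Fin (k + 1)) : 0 ≤ J.dist x t i j := J.weighted_nonneg _ _ _

lemma dist_le (i : ℕ) (j : Fin (k + 1)) : J.dist x t i j ≤ (1 / 2 : ℝ) ^ i := J.weighted_le _ _ _

lemma avg_nonneg (i : ℕ) : 0 ≤ J.avg x t i :=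
  Finset.sum_nonneg fun j _ => mul_nonneg (stdSimplex.zero_le t j) (J.dist_nonneg x t i j)

lemma avg_le (i : ℕ) : J.avg x t i ≤ (1 / 2 : ℝ) ^ i := by
  have : ∑ j, t j * (1 / 2 : ℝ) ^ i = (1 / 2 : ℝ) ^ i := by
    rw [← Finset.sum_mul, stdSimplex.sum_eq_one, one_mul]
  rw [← this]
  exact Finset.sum_le_sum fun j _ =>
    mul_le_mul_of_nonneg_left (J.dist_le x t i j) (stdSimplex.zero_le t j)

lemma avg_zero : J.avg x t 0 = 0 := by
  simp [avg, dist, J.D_zero]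

lemma bddAbove_avg : BddAbove (range fun i => J.avg x t i) := by
  refine ⟨1, ?_⟩
  rintro _ ⟨i, rfl⟩
  exact (J.avg_le x t i).trans (half_pow_le_one i)

lemma avg_le_maxAvg (i : ℕ) : J.avg x t i ≤ J.maxAvg x t := le_ciSup (J.bddAbove_avg x t) i

/-- The factor `scale` is a weighted mean of the radii, so some vertex of positive weight has radius
at least `scale`. That vertex, after shrinking, is distant from some `y i`. -/
lemma maxAvg_pos : 0 < J.maxAvg x t := by
  obtain ⟨j, hj0, hj⟩ : ∃ j, 0 < t j ∧ J.scale x t ≤ J.radius (x j) := by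
    by_contra hh
    push Not at hh
    have h1 : J.scale x t < ∑ j, t j * J.scale x t := by
      refine Finset.sum_lt_sum (fun j _ => ?_) ?_
      · rcases (stdSimplex.zero_le t j).eq_or_lt with h | h
        · rw [← h]; simp
        · exact mul_le_mul_of_nonneg_left (hh j h).le h.le
      · obtain ⟨j, hj⟩ : ∃ j, t j ≠ 0 := by
          by_contra h
          push Not at h
          have h3 := stdSimplex.sum_eq_one t
          simp [h] at h3
        have hj' := lt_of_le_of_ne (stdSimplex.zero_le t j) hj.symm
        exact ⟨j, Finset.mem_univ _, mul_lt_mul_of_pos_left (hh j hj') hj'⟩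
    rw [← Finset.sum_mul, stdSimplex.sum_eq_one, one_mul] at h1
    exact lt_irrefl _ h1
  obtain ⟨i, hi⟩ := exists_lt_of_lt_ciSup (J.gap_pos hj)
  refine lt_of_lt_of_le (mul_pos hj0 hi) (le_trans ?_ (J.avg_le_maxAvg x t i))
  exact Finset.single_le_sum (f := fun j => t j * J.dist x t i j)
    (fun j _ => mul_nonneg (stdSimplex.zero_le t j) (J.dist_nonneg x t i j)) (Finset.mem_univ j)

/-- The averages decay like `2⁻ⁱ` and the supremum is positive, so it is a maximum over finitely
many indices. -/
lemma exists_avg_eq_maxAvg : ∃ i, J.avg x t i = J.maxAvg x t := by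
  have h0 := J.maxAvg_pos x t
  obtain ⟨N, hN⟩ := exists_pow_lt_of_lt_one (half_pos h0) (show (1 / 2 : ℝ) < 1 by norm_num)
  have hne : (Finset.range (N + 1)).Nonempty := ⟨0, by simp⟩
  obtain ⟨i, -, hi⟩ := Finset.exists_max_image (Finset.range (N + 1)) (J.avg x t) hne
  have hle : ∀ l, J.avg x t l ≤ max (J.avg x t i) (J.maxAvg x t / 2) := fun l => by
    by_cases hl : l < N + 1
    · exact le_max_of_le_left (hi l (Finset.mem_range.2 hl))
    · refine le_max_of_le_right ((J.avg_le x t l).trans (le_trans ?_ hN.le))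
      exact pow_le_pow_of_le_one (by norm_num) (by norm_num) (by omega)
  have h1 : J.maxAvg x t ≤ max (J.avg x t i) (J.maxAvg x t / 2) := ciSup_le hle
  refine ⟨i, le_antisymm (J.avg_le_maxAvg x t i) ?_⟩
  rcases le_max_iff.1 h1 with h | h
  · exact h
  · linarith

lemma bddAbove_keep (j : Fin (k + 1)) : BddAbove (range fun i =>
    2 * min (J.avg x t i) (3 / 4 * J.maxAvg x t) - J.dist x t i j) := by
  refine ⟨2, ?_⟩
  rintro _ ⟨i, rfl⟩
  have h1 := min_le_left (J.avg x t i) (3 / 4 * J.maxAvg x t)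
  have h2 := (J.avg_le x t i).trans (half_pow_le_one i)
  have h3 := J.dist_nonneg x t i j
  simp only
  linarith

lemma keep_nonneg (j : Fin (k + 1)) : 0 ≤ J.keep x t j := le_max_left _ _

/-- Where the `j`-th object is kept, it is distant from those `y i` which are used. -/
lemma lt_dist_of_keep_pos {j : Fin (k + 1)} (hj : 0 < J.keep x t j) {i : ℕ}
    (hi : J.level x t i < 1) : J.maxAvg x t / 2 < J.dist x t i j := by
  have h0 := J.maxAvg_pos x t
  have h1 : 3 / 4 * J.maxAvg x t < J.avg x t i := by
    have h2 : 0 < 4 * J.avg x t i / J.maxAvg x t - 3 := by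
      by_contra hh
      rw [level, max_eq_left (not_lt.1 hh), sub_zero] at hi
      exact lt_irrefl _ hi
    have h3 : 3 < 4 * J.avg x t i / J.maxAvg x t := by linarith
    rw [lt_div_iff₀ h0] at h3
    linarith
  have h2 : 0 < J.maxAvg x t -
      ⨆ i, (2 * min (J.avg x t i) (3 / 4 * J.maxAvg x t) - J.dist x t i j) := by
    by_contra hh
    rw [keep, max_eq_left (not_lt.1 hh)] at hj
    exact lt_irrefl _ hj
  have h3 := le_ciSup (J.bddAbove_keep x t j) i
  -- The truncated term equals `3/2` of the maximum; being kept requires `3/2 * maxAvg - dist <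
  -- maxAvg`.
  rw [min_eq_right h1.le] at h3
  linarith

/-- The first vertex of nonzero weight maps to all others of nonzero weight, so its distances are
the largest and at least the averages. For it each expression in the supremum is at most `min (avg)
(3/4 * maxAvg) ≤ 3/4 * maxAvg`, and a quarter of `maxAvg` is left over. -/
lemma sum_keep_pos (hx : ∀ i j, i ≤ j → Nonempty (x i ⟶ x j)) :
    0 < ∑ l, t l * J.keep x t l := by
  have h0 := J.maxAvg_pos x t
  have hne : (Finset.univ.filter fun j => t j ≠ 0).Nonempty := by
    by_contra h
    rw [Finset.not_nonempty_iff_eq_empty, Finset.filter_eq_empty_iff] at h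
    have h3 := stdSimplex.sum_eq_one t
    have : ∀ j, t j = 0 := fun j => not_not.1 (h (Finset.mem_univ j))
    simp [this] at h3
  set j₀ := (Finset.univ.filter fun j => t j ≠ 0).min' hne with hj₀
  have hj : t j₀ ≠ 0 := (Finset.mem_filter.1 (Finset.min'_mem _ hne)).2
  have hle : ∀ i, J.avg x t i ≤ J.dist x t i j₀ := fun i => by
    have : ∑ j, t j * J.dist x t i j₀ = J.dist x t i j₀ := by
      rw [← Finset.sum_mul, stdSimplex.sum_eq_one, one_mul]
    rw [← this]
    refine Finset.sum_le_sum fun j _ => ?_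
    by_cases h : t j = 0
    · simp [h]
    · refine mul_le_mul_of_nonneg_left ?_ (stdSimplex.zero_le t j)
      have hjj : j₀ ≤ j := Finset.min'_le _ j (by simpa using h)
      exact mul_le_mul_of_nonneg_left (J.D_hom i _ _ _ (hx _ _ hjj)) (by positivity)
  have hsup : (⨆ i, (2 * min (J.avg x t i) (3 / 4 * J.maxAvg x t) - J.dist x t i j₀)) ≤
      3 / 4 * J.maxAvg x t := by
    refine ciSup_le fun i => ?_
    have h1 := min_le_left (J.avg x t i) (3 / 4 * J.maxAvg x t)
    have h2 := min_le_right (J.avg x t i) (3 / 4 * J.maxAvg x t)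
    linarith [hle i]
  have hkeep : 0 < J.keep x t j₀ := lt_max_of_lt_right (by linarith)
  refine lt_of_lt_of_le (mul_pos (lt_of_le_of_ne (stdSimplex.zero_le t j₀) hj.symm) hkeep) ?_
  exact Finset.single_le_sum (f := fun j => t j * J.keep x t j)
    (fun j _ => mul_nonneg (stdSimplex.zero_le t j) (J.keep_nonneg x t j)) (Finset.mem_univ j₀)

lemma moved_nonneg (j : Fin (k + 1)) : 0 ≤ J.moved x t j :=
  div_nonneg (mul_nonneg (stdSimplex.zero_le t j) (J.keep_nonneg x t j))
    (Finset.sum_nonneg fun l _ => mul_nonneg (stdSimplex.zero_le t l) (J.keep_nonneg x t l))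

lemma sum_moved (hx : ∀ i j, i ≤ j → Nonempty (x i ⟶ x j)) : ∑ j, J.moved x t j = 1 := by
  simp only [moved]
  rw [← Finset.sum_div, div_self (J.sum_keep_pos x t hx).ne']

lemma keep_pos_of_moved_pos {j : Fin (k + 1)} (h : 0 < J.moved x t j) : 0 < J.keep x t j := by
  refine lt_of_le_of_ne (J.keep_nonneg x t j) fun hh => ?_
  rw [moved, ← hh] at h
  simp at h

/-- At an index of maximal average the term in `level` is `4 - 3 = 1`. This index is not 0, since
the average there vanishes. -/
lemma exists_level_eq_zero : ∃ i, i ≠ 0 ∧ J.level x t i = 0 := by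
  obtain ⟨i, hi⟩ := J.exists_avg_eq_maxAvg x t
  have h0 := J.maxAvg_pos x t
  refine ⟨i, ?_, ?_⟩
  · rintro rfl
    rw [J.avg_zero] at hi
    exact h0.ne hi
  · rw [level, hi, mul_div_assoc, div_self h0.ne']
    norm_num

/-- By decay of the averages, all but finitely many `y i` remain unused. -/
lemma level_eq_one {i : ℕ} (h : (1 / 2 : ℝ) ^ i ≤ 3 / 4 * J.maxAvg x t) : J.level x t i = 1 := by
  have h0 := J.maxAvg_pos x t
  have h1 := (J.avg_le x t i).trans h
  rw [level, max_eq_left, sub_zero]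
  rw [sub_nonpos, div_le_iff₀ h0]
  linarith

end Simplex

/-! ### Continuity in the vertices and the barycentric coordinates -/

section Continuity

variable {k : ℕ}

lemma continuous_scale :
    Continuous fun p : (Fin (k + 1) → C) × stdSimplex ℝ (Fin (k + 1)) => J.scale p.1 p.2 :=
  continuous_finsetSum _ fun j _ => ((stdSimplex_continuous_coe j).comp continuous_snd).mul
    (J.continuous_radius.comp ((continuous_apply j).comp continuous_fst))

lemma continuous_dist (i : ℕ) (j : Fin (k + 1)) :
    Continuous fun p : (Fin (k + 1) → C) × stdSimplex ℝ (Fin (k + 1)) => J.dist p.1 p.2 i j :=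
  (J.continuous_weighted i).comp
    (((continuous_apply j).comp continuous_fst).prodMk J.continuous_scale)

lemma continuous_avg (i : ℕ) :
    Continuous fun p : (Fin (k + 1) → C) × stdSimplex ℝ (Fin (k + 1)) => J.avg p.1 p.2 i :=
  continuous_finsetSum _ fun j _ => ((stdSimplex_continuous_coe j).comp continuous_snd).mul
    (J.continuous_dist i j)

lemma continuous_maxAvg :
    Continuous fun p : (Fin (k + 1) → C) × stdSimplex ℝ (Fin (k + 1)) => J.maxAvg p.1 p.2 :=
  continuous_iff_continuousAt.2 fun _ => continuousAt_iSup_of_decay (K := 1)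
    (fun i => (J.continuous_avg i).continuousAt) fun i p => by
      rw [abs_of_nonneg (J.avg_nonneg _ _ i), one_mul]
      exact J.avg_le _ _ i

lemma continuous_keep (j : Fin (k + 1)) :
    Continuous fun p : (Fin (k + 1) → C) × stdSimplex ℝ (Fin (k + 1)) => J.keep p.1 p.2 j := by
  refine continuous_const.max (J.continuous_maxAvg.sub ?_)
  refine continuous_iff_continuousAt.2 fun _ => continuousAt_iSup_of_decay (K := 3)
    (fun i => (((continuous_const.mul ((J.continuous_avg i).min
      (continuous_const.mul J.continuous_maxAvg))).sub
        (J.continuous_dist i j))).continuousAt) fun i p => ?_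
  have h1 := min_le_left (J.avg p.1 p.2 i) (3 / 4 * J.maxAvg p.1 p.2)
  have h2 := J.avg_le p.1 p.2 i
  have h3 := J.dist_nonneg p.1 p.2 i j
  have h4 := J.dist_le p.1 p.2 i j
  have h5 : 0 ≤ min (J.avg p.1 p.2 i) (3 / 4 * J.maxAvg p.1 p.2) :=
    le_min (J.avg_nonneg _ _ i) (by linarith [J.maxAvg_pos p.1 p.2])
  rw [abs_le]
  constructor <;> linarith

/-- The denominator is known to be positive only when the vertices form a chain, hence continuity at
such points rather than everywhere. The nearby tuples of vertices need not be chains. -/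
lemma continuousAt_moved (j : Fin (k + 1)) (p : (Fin (k + 1) → C) × stdSimplex ℝ (Fin (k + 1)))
    (hx : ∀ i j, i ≤ j → Nonempty (p.1 i ⟶ p.1 j)) :
    ContinuousAt
      (fun p : (Fin (k + 1) → C) × stdSimplex ℝ (Fin (k + 1)) => J.moved p.1 p.2 j) p := by
  refine ContinuousAt.div ?_ ?_ (J.sum_keep_pos p.1 p.2 hx).ne'
  · exact (((stdSimplex_continuous_coe j).comp continuous_snd).mul
      (J.continuous_keep j)).continuousAt
  · exact (continuous_finsetSum _ fun l _ =>
      ((stdSimplex_continuous_coe l).comp continuous_snd).mul (J.continuous_keep l)).continuousAt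

lemma continuous_level (i : ℕ) :
    Continuous fun p : (Fin (k + 1) → C) × stdSimplex ℝ (Fin (k + 1)) => J.level p.1 p.2 i :=
  continuous_const.sub (continuous_const.max (((continuous_const.mul (J.continuous_avg i)).div
    J.continuous_maxAvg fun p => (J.maxAvg_pos p.1 p.2).ne').sub continuous_const))

end Continuity

/-! ### Compatibility with faces -/

section Face

variable {k : ℕ} (x : Fin (k + 2) → C) (t : stdSimplex ℝ (Fin (k + 1))) (i : Fin (k + 2))

/-- A vertex of weight zero contributes nothing to a `t`-weighted sum. The averages, and everything
derived from them, are insensitive to it for the same reason. -/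
lemma scale_face : J.scale x (stdSimplex.map i.succAbove t) = J.scale (x ∘ i.succAbove) t :=
  stdSimplex_sum_map_succAbove i t _

lemma dist_face (l : ℕ) (j : Fin (k + 1)) :
    J.dist x (stdSimplex.map i.succAbove t) l (i.succAbove j) =
      J.dist (x ∘ i.succAbove) t l j := by
  rw [dist, scale_face]; rfl

lemma avg_face (l : ℕ) :
    J.avg x (stdSimplex.map i.succAbove t) l = J.avg (x ∘ i.succAbove) t l := by
  rw [avg, stdSimplex_sum_map_succAbove]
  simp only [dist_face]
  rfl

lemma maxAvg_face :
    J.maxAvg x (stdSimplex.map i.succAbove t) = J.maxAvg (x ∘ i.succAbove) t := by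
  simp only [maxAvg, avg_face]

lemma keep_face (j : Fin (k + 1)) :
    J.keep x (stdSimplex.map i.succAbove t) (i.succAbove j) = J.keep (x ∘ i.succAbove) t j := by
  simp only [keep, avg_face, maxAvg_face, dist_face]

lemma moved_face (j : Fin (k + 1)) :
    J.moved x (stdSimplex.map i.succAbove t) (i.succAbove j) = J.moved (x ∘ i.succAbove) t j := by
  rw [moved, moved, stdSimplex_sum_map_succAbove, keep_face, stdSimplex_map_succAbove_apply]
  simp only [keep_face]

lemma moved_face_self : J.moved x (stdSimplex.map i.succAbove t) i = 0 := by
  rw [moved, stdSimplex_map_succAbove_self, zero_mul, zero_div]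

lemma level_face (l : ℕ) :
    J.level x (stdSimplex.map i.succAbove t) l = J.level (x ∘ i.succAbove) t l := by
  simp only [level, avg_face, maxAvg_face]

end Face

end JoinSystem

end JoinSystems

end

noncomputable section

/-! ### Intervals of the step function belonging to barycentric weights -/

section PartialSums

/-- The thresholds belonging to the weights `w`, after the part `[0, a)` of the unit interval has
been taken away. -/
def threshold {n : ℕ} (a : ℝ) (w : Fin n → ℝ) (l : Fin n) : ℝ :=
  a + (1 - a) * ∑ m, if m < l then w m else 0

variable {n : ℕ} {a : ℝ} {w : Fin n → ℝ}

lemma le_threshold (ha : a ≤ 1) (hw : ∀ m, 0 ≤ w m) (l : Fin n) : a ≤ threshold a w l := by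
  have h1 : 0 ≤ ∑ m, if m < l then w m else 0 :=
    Finset.sum_nonneg fun m _ => by split_ifs <;> simp [hw]
  have := mul_nonneg (sub_nonneg.2 ha) h1
  rw [threshold]; linarith

/-- Vertex `l` occupies an interval of length `(1 - a) * w l` starting at its threshold; its right
end is the partial sum that includes `l`. -/
lemma threshold_add_eq (l : Fin n) :
    threshold a w l + (1 - a) * w l = a + (1 - a) * ∑ m, if m ≤ l then w m else 0 := by
  have : (∑ m, if m ≤ l then w m else 0) = (∑ m, if m < l then w m else 0) + w l := by
    rw [show w l = ∑ m, if m = l then w m else 0 by simp, ← Finset.sum_add_distrib]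
    refine Finset.sum_congr rfl fun m _ => ?_
    rcases lt_trichotomy m l with h | h | h
    · simp [h, h.le, h.ne]
    · simp [h]
    · simp [h.not_gt, h.not_ge, h.ne']
  rw [threshold, this]; ring

lemma threshold_add_le_of_lt (ha : a ≤ 1) (hw : ∀ m, 0 ≤ w m) {l l' : Fin n} (h : l < l') :
    threshold a w l + (1 - a) * w l ≤ threshold a w l' := by
  rw [threshold_add_eq, threshold]
  refine add_le_add le_rfl (mul_le_mul_of_nonneg_left (Finset.sum_le_sum fun m _ => ?_)
    (sub_nonneg.2 ha))
  by_cases hm : m ≤ l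
  · simp [hm, hm.trans_lt h]
  · rw [if_neg hm]
    split_ifs <;> simp [hw]

lemma threshold_add_le_one (ha : a ≤ 1) (hw : ∀ m, 0 ≤ w m) (h1 : ∑ m, w m = 1) (l : Fin n) :
    threshold a w l + (1 - a) * w l ≤ 1 := by
  rw [threshold_add_eq]
  have : (∑ m, if m ≤ l then w m else 0) ≤ 1 := by
    rw [← h1]
    exact Finset.sum_le_sum fun m _ => by split_ifs <;> simp [hw]
  nlinarith [sub_nonneg.2 ha]

/-- The right end of the interval of `j` is the next threshold, which has not been reached; for the
last vertex it is 1. -/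
lemma lt_threshold_add {v : ℝ} (hv : v < 1) (h1 : ∑ m, w m = 1) {j : Fin n}
    (hj : (Finset.univ.filter fun l => threshold a w l ≤ v).max = j) :
    threshold a w j ≤ v ∧ v < threshold a w j + (1 - a) * w j := by
  refine ⟨(Finset.mem_filter.1 (Finset.mem_of_max hj)).2, ?_⟩
  by_cases h : ∃ j' : Fin n, (j' : ℕ) = j + 1
  · obtain ⟨j', hj'⟩ := h
    have h2 : threshold a w j + (1 - a) * w j = threshold a w j' := by
      rw [threshold_add_eq, threshold]
      congr 3
      funext m
      have : m ≤ j ↔ m < j' := by rw [Fin.le_def, Fin.lt_def]; omega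
      simp [this]
    rw [h2]
    by_contra hh
    have hmem : j' ∈ Finset.univ.filter fun l => threshold a w l ≤ v :=
      Finset.mem_filter.2 ⟨Finset.mem_univ j', not_lt.1 hh⟩
    have h3 := Finset.le_max_of_eq hmem hj
    rw [Fin.le_def] at h3
    omega
  · rw [threshold_add_eq]
    have h2 : (∑ m, if m ≤ j then w m else 0) = 1 := by
      rw [← h1]
      refine Finset.sum_congr rfl fun m _ => if_pos ?_
      by_contra hh
      refine h ⟨⟨j + 1, ?_⟩, rfl⟩
      rw [not_le, Fin.lt_def] at hh
      have := m.2
      omega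
    rw [h2]; linarith

lemma max_filter_threshold_iff (ha : a ≤ 1) (hw : ∀ m, 0 ≤ w m) {v : ℝ} (hv : v < 1)
    (h1 : ∑ m, w m = 1) (j : Fin n) :
    (Finset.univ.filter fun l => threshold a w l ≤ v).max = j ↔
      threshold a w j ≤ v ∧ v < threshold a w j + (1 - a) * w j := by
  refine ⟨lt_threshold_add hv h1, fun ⟨h2, h3⟩ => le_antisymm (Finset.max_le fun l hl => ?_)
    (Finset.le_max (Finset.mem_filter.2 ⟨Finset.mem_univ j, h2⟩))⟩
  rw [WithBot.coe_le_coe]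
  by_contra hh
  have := threshold_add_le_of_lt ha hw (not_le.1 hh)
  linarith [(Finset.mem_filter.1 hl).2]

lemma threshold_succAbove {w : Fin (n + 1) → ℝ} {i : Fin (n + 1)} (hi : w i = 0) (l : Fin n) :
    threshold a w (i.succAbove l) = threshold a (fun m => w (i.succAbove m)) l := by
  rw [threshold, threshold, Fin.sum_univ_succAbove _ i, hi, ite_self, zero_add]
  simp [Fin.succAbove_lt_succAbove_iff]

/-- A vertex of weight zero has an empty interval and is never the last one reached, so omitting it
only relabels the others. -/
lemma max_filter_threshold_succAbove {w : Fin (n + 1) → ℝ} (h1 : ∑ m, w m = 1)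
    {i : Fin (n + 1)} (hi : w i = 0) {v : ℝ} (hv : v < 1) :
    (Finset.univ.filter fun l => threshold a w l ≤ v).max = WithBot.map i.succAbove
      (Finset.univ.filter fun l => threshold a (fun m => w (i.succAbove m)) l ≤ v).max := by
  by_cases hb : (Finset.univ.filter fun l => threshold a w l ≤ v).max = ⊥
  · rw [hb]
    rw [Finset.max_eq_bot, Finset.filter_eq_empty_iff] at hb
    have : (Finset.univ.filter fun l => threshold a (fun m => w (i.succAbove m)) l ≤ v) = ∅ := by
      rw [Finset.filter_eq_empty_iff]
      intro l _
      rw [← threshold_succAbove hi]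
      exact hb (Finset.mem_univ _)
    rw [this]; rfl
  · obtain ⟨j, hj⟩ := WithBot.ne_bot_iff_exists.1 hb
    have h2 := lt_threshold_add hv h1 hj.symm
    have hji : j ≠ i := by
      rintro rfl
      rw [hi, mul_zero, add_zero] at h2
      exact absurd h2.1 h2.2.not_ge
    obtain ⟨l, rfl⟩ := Fin.exists_succAbove_eq hji
    have h3 : (Finset.univ.filter fun l => threshold a (fun m => w (i.succAbove m)) l ≤ v).max
        = (l : WithBot (Fin n)) := by
      refine le_antisymm (Finset.max_le fun l' hl' => ?_)
        (Finset.le_max (Finset.mem_filter.2 ⟨Finset.mem_univ l, ?_⟩))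
      · have h4 : threshold a w (i.succAbove l') ≤ v := by
          rw [threshold_succAbove hi]; exact (Finset.mem_filter.1 hl').2
        have h5 := Finset.le_max_of_eq
          (Finset.mem_filter.2 ⟨Finset.mem_univ (i.succAbove l'), h4⟩) hj.symm
        rw [WithBot.coe_le_coe]
        exact (Fin.succAbove_le_succAbove_iff).1 h5
      · rw [← threshold_succAbove hi]; exact h2.1
    rw [← hj, h3]; rfl

end PartialSums

/-! ### The contraction in six stages -/

section JoinSystems

universe v u

namespace JoinSystem

open ClassifyingSpace

variable {C : Type u} [Category.{v} C] [TopologicalSpace C] (J : JoinSystem C)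

section Stages

variable {k : ℕ} (x : Fin (k + 1) → C) (t : stdSimplex ℝ (Fin (k + 1))) (r : ℝ)

/-- First stage: the objects are shrunk. -/
def stageScale : ℝ := 1 + clamp 0 r * (J.scale x t - 1)

/-- Second stage: move towards the vertices which are distant from the relevant `y i`. -/
def stageWeight (j : Fin (k + 1)) : ℝ := (1 - clamp 1 r) * t j + clamp 1 r * J.moved x t j

/-- Third, fifth and sixth stage: take the union with some `y i`, then with `y 0`, then remove
the `y i` with `i ≠ 0`. -/
def stageLevel (i : ℕ) : ℝ :=
  if i = 0 then 1 - clamp 4 r else 1 - clamp 2 r * (1 - clamp 5 r) * (1 - J.level x t i)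

/-- The step function of labels. In the fourth stage, the objects of the simplex are removed. -/
def stageLabel : ℝ → WithBot (Fin (k + 1)) × Finset ℕ :=
  stepLabel (threshold (clamp 3 r) (J.stageWeight x t r)) (J.stageLevel x t r)

/-- The object belonging to a label. -/
def labelObj (a : WithBot (Fin (k + 1)) × Finset ℕ) : C :=
  WithBot.recBotCoe (J.y a.2) (fun j => J.obj (J.stageScale x t r) (x j) a.2) a.1

lemma stageScale_pos : 0 < J.stageScale x t r := by
  have h1 := J.scale_pos x t
  have h2 := J.scale_le_one x t
  have h3 := clamp_nonneg 0 r
  have h4 := clamp_le_one 0 r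
  rw [stageScale]
  nlinarith

lemma stageWeight_nonneg (j : Fin (k + 1)) : 0 ≤ J.stageWeight x t r j :=
  add_nonneg (mul_nonneg (sub_nonneg.2 (clamp_le_one 1 r)) (stdSimplex.zero_le t j))
    (mul_nonneg (clamp_nonneg 1 r) (J.moved_nonneg x t j))

lemma sum_stageWeight (hx : ∀ i j, i ≤ j → Nonempty (x i ⟶ x j)) :
    ∑ j, J.stageWeight x t r j = 1 := by
  simp only [stageWeight]
  rw [Finset.sum_add_distrib, ← Finset.mul_sum, ← Finset.mul_sum, J.sum_moved x t hx,
    stdSimplex.sum_eq_one]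
  ring

lemma one_le_stageLevel {i : ℕ} (hi : i ≠ 0) (h : (1 / 2 : ℝ) ^ i ≤ 3 / 4 * J.maxAvg x t) :
    1 ≤ J.stageLevel x t r i := by
  rw [stageLevel, if_neg hi, J.level_eq_one x t h]
  simp

lemma exists_one_le_stageLevel : ∃ N, ∀ i, N ≤ i → 1 ≤ J.stageLevel x t r i := by
  have h0 : 0 < 3 / 4 * J.maxAvg x t := by linarith [J.maxAvg_pos x t]
  obtain ⟨N, hN⟩ := exists_pow_lt_of_lt_one h0 (show (1 / 2 : ℝ) < 1 by norm_num)
  refine ⟨N + 1, fun i hi => J.one_le_stageLevel x t r (by omega) (le_trans ?_ hN.le)⟩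
  exact pow_le_pow_of_le_one (by norm_num) (by norm_num) (by omega)

/-- The labels which are used belong to well defined objects. -/
lemma nonempty_of_stageLabel {v : ℝ} (hv : v ∈ Ico (0 : ℝ) 1)
    {S : Finset ℕ} (h : J.stageLabel x t r v = (⊥, S)) : S.Nonempty := by
  obtain ⟨N, hN⟩ := J.exists_one_le_stageLevel x t r
  have h1 : (Finset.univ.filter fun l =>
      threshold (clamp 3 r) (J.stageWeight x t r) l ≤ v).max = ⊥ := congrArg Prod.fst h
  have h2 : levelSet (J.stageLevel x t r) v = S := congrArg Prod.snd h
  rw [Finset.max_eq_bot, Finset.filter_eq_empty_iff] at h1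
  -- The first vertex has threshold `clamp 3 r`, so `⊥` occurs only to the left of it, and only
  -- after time 3.
  have h3 : v < clamp 3 r := by
    have := not_le.1 (h1 (Finset.mem_univ (0 : Fin (k + 1))))
    simpa [threshold] using this
  have h4 : (3 : ℝ) < r := by simpa using lt_of_clamp_pos (hv.1.trans_lt h3)
  rw [← h2]
  -- Up to time 5 some `y i` with `i ≠ 0` has threshold 0; from time 5 on `y 0` has.
  by_cases hr : r ≤ 5
  · obtain ⟨i, hi0, hi⟩ := J.exists_level_eq_zero x t
    refine ⟨i, (mem_levelSet hN hv.2).2 ?_⟩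
    rw [stageLevel, if_neg hi0, hi, clamp_eq_one (by norm_num; linarith),
      clamp_eq_zero (by norm_num; linarith)]
    simpa using hv.1
  · refine ⟨0, (mem_levelSet hN hv.2).2 ?_⟩
    rw [stageLevel, if_pos rfl, clamp_eq_one (by norm_num; linarith)]
    simpa using hv.1

/-- An object and a `y i` occur together only between times 2 and 4, when the shrinking is complete
and only kept vertices carry weight. The quantitative bound, rather than mere positivity, is what
excludes in a whole neighbourhood the labels that are undefined at its centre. -/
lemma lt_dist_of_stageLabel (hx : ∀ i j, i ≤ j → Nonempty (x i ⟶ x j)) {v : ℝ}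
    (hv : v ∈ Ico (0 : ℝ) 1) {j : Fin (k + 1)} {S : Finset ℕ}
    (h : J.stageLabel x t r v = ((j : WithBot (Fin (k + 1))), S)) {i : ℕ} (hi : i ∈ S) :
    J.maxAvg x t / 2 < (1 / 2 : ℝ) ^ i * J.D i (x j) (J.stageScale x t r) := by
  obtain ⟨N, hN⟩ := J.exists_one_le_stageLevel x t r
  have h1 : (Finset.univ.filter fun l =>
      threshold (clamp 3 r) (J.stageWeight x t r) l ≤ v).max = j := congrArg Prod.fst h
  have h2 : levelSet (J.stageLevel x t r) v = S := congrArg Prod.snd h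
  rw [← h2, mem_levelSet hN hv.2] at hi
  obtain ⟨h3, h4⟩ := lt_threshold_add hv.2 (J.sum_stageWeight x t r hx) h1
  have h5 : clamp 3 r < 1 :=
    ((le_threshold (clamp_le_one 3 r) (J.stageWeight_nonneg x t r) j).trans h3).trans_lt hv.2
  have h6 : r < 4 := by
    have := lt_of_clamp_lt_one h5
    norm_num at this
    exact this
  -- `y 0` enters after time 4, when no object of the simplex is left.
  have hi0 : i ≠ 0 := by
    rintro rfl
    rw [stageLevel, if_pos rfl, clamp_eq_zero (by norm_num; linarith)] at hi
    linarith [hv.2]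
  rw [stageLevel, if_neg hi0, clamp_eq_zero (n := 5) (by norm_num; linarith), sub_zero,
    mul_one] at hi
  have h7 : 0 < clamp 2 r * (1 - J.level x t i) := by linarith [hv.2]
  have h8 : 0 < clamp 2 r := lt_of_le_of_ne (clamp_nonneg 2 r) fun hh => by
    rw [← hh, zero_mul] at h7
    exact lt_irrefl _ h7
  have h9 : J.level x t i < 1 := by
    by_contra hh
    nlinarith
  have h10 : (2 : ℝ) < r := by simpa using lt_of_clamp_pos h8
  have h11 : 0 < J.stageWeight x t r j := by
    by_contra hh
    have : (1 - clamp 3 r) * J.stageWeight x t r j ≤ 0 :=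
      mul_nonpos_of_nonneg_of_nonpos (by linarith) (not_lt.1 hh)
    linarith
  rw [stageWeight, clamp_eq_one (by norm_num; linarith), sub_self, zero_mul, zero_add,
    one_mul] at h11
  have h12 := J.lt_dist_of_keep_pos x t (J.keep_pos_of_moved_pos x t h11) h9
  have h13 : J.stageScale x t r = J.scale x t := by
    rw [stageScale, clamp_eq_one (by norm_num; linarith)]; ring
  rw [h13]
  exact h12

/-- The order on labels mirrors inclusion of surgery data: `⊥`, for an absent object, lies below
every `j`. Distances are needed at the larger label only, since they decrease along morphisms. -/
lemma nonempty_hom_labelObj (hx : ∀ i j, i ≤ j → Nonempty (x i ⟶ x j))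
    {a b : WithBot (Fin (k + 1)) × Finset ℕ} (hab : a ≤ b)
    (ha : a.1 = ⊥ → a.2.Nonempty)
    (hb : ∀ j : Fin (k + 1), b.1 = j → ∀ i ∈ b.2, 0 < J.D i (x j) (J.stageScale x t r)) :
    Nonempty (J.labelObj x t r a ⟶ J.labelObj x t r b) := by
  obtain ⟨j, S⟩ := a
  obtain ⟨j', S'⟩ := b
  obtain ⟨h1, h2⟩ := Prod.mk_le_mk.1 hab
  have hs := J.stageScale_pos x t r
  induction j using WithBot.recBotCoe with
  | bot =>
    induction j' using WithBot.recBotCoe with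
    | bot => exact J.y_hom _ _ (ha rfl) h2
    | coe j' => exact J.y_obj _ _ _ _ hs (ha rfl) h2 (hb j' rfl)
  | coe j =>
    induction j' using WithBot.recBotCoe with
    | bot => simp at h1
    | coe j' =>
      exact J.obj_hom _ _ _ _ _ hs (hx _ _ (WithBot.coe_le_coe.1 h1)) h2 (hb j' rfl)

variable [Quiver.IsThin C] [TopologicalCategory C]

/-- The label is monotone in `v`, so the labels that occur form a finite chain; each of them stands
for a well-defined object. -/
lemma exists_isRep_stage (hx : ∀ i j, i ≤ j → Nonempty (x i ⟶ x j)) :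
    ∃ b : ClassifyingSpace C, IsRep (J.labelObj x t r) (stepWeight (J.stageLabel x t r)) b := by
  classical
  obtain ⟨N, hN⟩ := J.exists_one_le_stageLevel x t r
  have hmono : MonotoneOn (J.stageLabel x t r) (Ico 0 1) := stepLabel_monotoneOn _ hN
  have hV : ∀ v ∈ Ico (0 : ℝ) 1, J.stageLabel x t r v ∈
      (Finset.univ ×ˢ (Finset.range N).powerset : Finset (WithBot (Fin (k + 1)) × Finset ℕ)) := by
    intro v hv
    refine Finset.mem_product.2 ⟨Finset.mem_univ _, Finset.mem_powerset.2 fun i hi => ?_⟩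
    exact Finset.mem_range.2 (lt_of_mem_levelSet hN hv.2 hi)
  refine exists_isRep (Finset.univ ×ˢ (Finset.range N).powerset) (fun a ha => ?_)
    (fun a => stepWeight_nonneg _ a) (sum_stepWeight hmono _ hV) (fun a b ha hb => ?_)
    (fun a b ha hb hab => ?_)
  · obtain ⟨v, hv, rfl⟩ := exists_eq_of_stepWeight_ne_zero ha
    exact hV v hv
  · obtain ⟨v, hv, rfl⟩ := exists_eq_of_stepWeight_ne_zero ha
    obtain ⟨v', hv', rfl⟩ := exists_eq_of_stepWeight_ne_zero hb
    rcases le_total v v' with h | h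
    · exact Or.inl (hmono hv hv' h)
    · exact Or.inr (hmono hv' hv h)
  · obtain ⟨v, hv, hva⟩ := exists_eq_of_stepWeight_ne_zero ha
    obtain ⟨v', hv', hvb⟩ := exists_eq_of_stepWeight_ne_zero hb
    refine J.nonempty_hom_labelObj x t r hx hab (fun h => ?_) (fun j hj i hi => ?_)
    · exact J.nonempty_of_stageLabel x t r hv (hva.trans (Prod.ext h rfl))
    · have h1 := J.lt_dist_of_stageLabel x t r hx hv' (hvb.trans (Prod.ext hj rfl)) hi
      have h2 := J.maxAvg_pos x t
      exact pos_of_mul_pos_right (show 0 < (1 / 2 : ℝ) ^ i * J.D i (x j) (J.stageScale x t r) by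
        linarith) (by positivity)

end Stages

/-! ### Continuity of the data at each stage -/

section StageContinuity

variable {k : ℕ} {Z : Type*} [TopologicalSpace Z] {X : Z → Fin (k + 1) → C}
  {t : Z → stdSimplex ℝ (Fin (k + 1))} {r : Z → ℝ}

lemma continuous_stageScale (hX : Continuous X) (ht : Continuous t) (hr : Continuous r) :
    Continuous fun z => J.stageScale (X z) (t z) (r z) :=
  continuous_const.add (((continuous_clamp 0).comp hr).mul
    ((J.continuous_scale.comp (hX.prodMk ht)).sub continuous_const))

lemma continuous_stage_weighted (hX : Continuous X) (ht : Continuous t) (hr : Continuous r)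
    (i : ℕ) (j : Fin (k + 1)) :
    Continuous fun z => (1 / 2 : ℝ) ^ i * J.D i (X z j) (J.stageScale (X z) (t z) (r z)) :=
  (J.continuous_weighted i).comp
    (((continuous_apply j).comp hX).prodMk (J.continuous_stageScale hX ht hr))

lemma continuousAt_stageWeight (hX : Continuous X) (ht : Continuous t) (hr : Continuous r) (z₀ : Z)
    (hx : ∀ i j, i ≤ j → Nonempty (X z₀ i ⟶ X z₀ j)) (m : Fin (k + 1)) :
    ContinuousAt (fun z => J.stageWeight (X z) (t z) (r z) m) z₀ := by
  have h1 : Continuous fun z => clamp 1 (r z) := (continuous_clamp 1).comp hr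
  have h2 : Continuous fun z => t z m := (stdSimplex_continuous_coe m).comp ht
  have h3 : ContinuousAt (fun z => J.moved (X z) (t z) m) z₀ :=
    ContinuousAt.comp
      (g := fun q : (Fin (k + 1) → C) × stdSimplex ℝ (Fin (k + 1)) => J.moved q.1 q.2 m)
      (f := fun z => (X z, t z)) (J.continuousAt_moved m _ hx) (hX.prodMk ht).continuousAt
  exact (((continuous_const.sub h1).mul h2).continuousAt).add (h1.continuousAt.mul h3)

lemma continuousAt_stageThreshold (hX : Continuous X) (ht : Continuous t) (hr : Continuous r)
    (z₀ : Z) (hx : ∀ i j, i ≤ j → Nonempty (X z₀ i ⟶ X z₀ j)) (l : Fin (k + 1)) :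
    ContinuousAt (fun z => threshold (clamp 3 (r z)) (J.stageWeight (X z) (t z) (r z)) l) z₀ := by
  have h1 : Continuous fun z => clamp 3 (r z) := (continuous_clamp 3).comp hr
  have h2 : ContinuousAt (fun z => ∑ m, if m < l then J.stageWeight (X z) (t z) (r z) m else 0)
      z₀ := by
    refine tendsto_finsetSum _ fun m _ => ?_
    by_cases h : m < l
    · simp only [h, if_true]
      exact J.continuousAt_stageWeight hX ht hr z₀ hx m
    · simp only [h, if_false]
      exact tendsto_const_nhds
  exact h1.continuousAt.add ((continuous_const.sub h1).continuousAt.mul h2)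

lemma continuous_stageLevel (hX : Continuous X) (ht : Continuous t) (hr : Continuous r) (i : ℕ) :
    Continuous fun z => J.stageLevel (X z) (t z) (r z) i := by
  have h : ∀ n, Continuous fun z => clamp n (r z) := fun n => (continuous_clamp n).comp hr
  have h' : Continuous fun z => J.level (X z) (t z) i :=
    Continuous.comp
      (g := fun q : (Fin (k + 1) → C) × stdSimplex ℝ (Fin (k + 1)) => J.level q.1 q.2 i)
      (f := fun z => (X z, t z)) (J.continuous_level i) (hX.prodMk ht)
  by_cases hi : i = 0
  · simp only [stageLevel, hi, if_true]
    exact continuous_const.sub (h 4)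
  · simp only [stageLevel, hi, if_false]
    exact continuous_const.sub (((h 2).mul (continuous_const.sub (h 5))).mul
      (continuous_const.sub h'))

lemma exists_eventually_one_le_stageLevel (hX : Continuous X) (ht : Continuous t) (z₀ : Z) :
    ∃ N, ∀ᶠ z in 𝓝 z₀, ∀ i, N ≤ i → 1 ≤ J.stageLevel (X z) (t z) (r z) i := by
  have h0 := J.maxAvg_pos (X z₀) (t z₀)
  have hmax : Continuous fun z => J.maxAvg (X z) (t z) := J.continuous_maxAvg.comp (hX.prodMk ht)
  -- `3/8` is half of `3/4`: near `z₀` the maximal average exceeds half its value at `z₀`.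
  obtain ⟨N, hN⟩ := exists_pow_lt_of_lt_one
    (show 0 < 3 / 8 * J.maxAvg (X z₀) (t z₀) by positivity) (show (1 / 2 : ℝ) < 1 by norm_num)
  refine ⟨N + 1, ?_⟩
  filter_upwards [hmax.continuousAt.eventually_const_lt (half_lt_self h0)] with z hz i hi
  refine J.one_le_stageLevel _ _ _ (by omega) (le_trans (b := (1 / 2 : ℝ) ^ N) ?_ ?_)
  · exact pow_le_pow_of_le_one (by norm_num) (by norm_num) (by omega)
  · linarith

/-- Positivity is an open condition, and a distance vanishing at `z₀` stays small nearby. With `ε`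
below the bound of `lt_dist_of_stageLabel`, labels using such a distance cannot occur nearby. -/
lemma eventually_D_pos (hX : Continuous X) (ht : Continuous t) (hr : Continuous r) (z₀ : Z) (N : ℕ)
    {ε : ℝ} (hε : 0 < ε) : ∀ᶠ z in 𝓝 z₀, ∀ i ∈ Finset.range N, ∀ j : Fin (k + 1),
      (0 < J.D i (X z₀ j) (J.stageScale (X z₀) (t z₀) (r z₀)) →
        0 < J.D i (X z j) (J.stageScale (X z) (t z) (r z))) ∧
      (¬ 0 < J.D i (X z₀ j) (J.stageScale (X z₀) (t z₀) (r z₀)) →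
        (1 / 2 : ℝ) ^ i * J.D i (X z j) (J.stageScale (X z) (t z) (r z)) < ε) := by
  rw [Filter.eventually_all_finset]
  intro i _
  rw [Filter.eventually_all]
  intro j
  have hc := (J.continuous_stage_weighted hX ht hr i j).continuousAt (x := z₀)
  by_cases h : 0 < J.D i (X z₀ j) (J.stageScale (X z₀) (t z₀) (r z₀))
  · filter_upwards [hc.eventually_const_lt (mul_pos (by positivity) h)] with z hz
    exact ⟨fun _ => pos_of_mul_pos_right hz (by positivity), fun h' => absurd h h'⟩
  · filter_upwards [hc.eventually_lt_const (u := ε) (lt_of_le_of_lt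
      (mul_nonpos_of_nonneg_of_nonpos (by positivity) (not_lt.1 h)) hε)] with z hz
    exact ⟨fun h' => absurd h' h, fun _ => hz⟩

end StageContinuity

variable [Quiver.IsThin C] [TopologicalCategory C]

/-- The contraction on a simplex, at the time `r`. -/
def contraction {k : ℕ} (x : NerveSpace C k) (t : stdSimplex ℝ (Fin (k + 1))) (r : ℝ) :
    ClassifyingSpace C :=
  (J.exists_isRep_stage x.vertex t r fun _ _ h => x.nonempty_hom h).choose

lemma isRep_contraction {k : ℕ} (x : NerveSpace C k) (t : stdSimplex ℝ (Fin (k + 1))) (r : ℝ) :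
    IsRep (J.labelObj x.vertex t r) (stepWeight (J.stageLabel x.vertex t r))
      (J.contraction x t r) :=
  (J.exists_isRep_stage x.vertex t r fun _ _ h => x.nonempty_hom h).choose_spec

/-- The omitted vertex has weight zero at every stage, so both points carry the same weights up to
relabelling by `succAbove`; represented points are unique. -/
lemma contraction_face {k : ℕ} (i : Fin (k + 2)) (x : NerveSpace C (k + 1))
    (t : stdSimplex ℝ (Fin (k + 1))) (r : ℝ) :
    J.contraction (NerveSpace.face i x) t r = J.contraction x (stdSimplex.map i.succAbove t) r := by
  set t' := stdSimplex.map i.succAbove t with ht'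
  have hvert : (NerveSpace.face i x).vertex = x.vertex ∘ i.succAbove := rfl
  have hw : ∀ m, J.stageWeight x.vertex t' r (i.succAbove m) =
      J.stageWeight (x.vertex ∘ i.succAbove) t r m := fun m => by
    rw [stageWeight, moved_face, stdSimplex_map_succAbove_apply]; rfl
  have hwi : J.stageWeight x.vertex t' r i = 0 := by
    rw [stageWeight, moved_face_self, stdSimplex_map_succAbove_self]; simp
  have hsum := J.sum_stageWeight x.vertex t' r fun _ _ h => x.nonempty_hom h
  have hlev : J.stageLevel x.vertex t' r = J.stageLevel (x.vertex ∘ i.succAbove) t r := by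
    funext l
    simp only [stageLevel, ht', level_face]
  have hscale : J.stageScale x.vertex t' r = J.stageScale (x.vertex ∘ i.succAbove) t r := by
    simp only [stageScale, ht', scale_face]
  have hlabel : ∀ v ∈ Ico (0 : ℝ) 1, J.stageLabel x.vertex t' r v =
      Prod.map (WithBot.map i.succAbove) id (J.stageLabel (x.vertex ∘ i.succAbove) t r v) := by
    intro v hv
    refine Prod.ext ?_ ?_
    · have h1 := max_filter_threshold_succAbove (a := clamp 3 r) hsum hwi hv.2
      simp only [hw] at h1
      exact h1
    · simp only [stageLabel, stepLabel, hlev]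
      rfl
  set g : WithBot (Fin (k + 1)) × Finset ℕ → WithBot (Fin (k + 2)) × Finset ℕ :=
    Prod.map (WithBot.map i.succAbove) id with hg
  have hmono : StrictMono (WithBot.map i.succAbove) :=
    WithBot.strictMono_map_iff.2 (Fin.strictMono_succAbove i)
  have hginj : Function.Injective g := hmono.injective.prodMap Function.injective_id
  have hgm : StrictMono g :=
    Monotone.strictMono_of_injective (fun a b hab => ⟨hmono.monotone hab.1, hab.2⟩) hginj
  refine IsRep.unique (X := J.labelObj x.vertex t' r)
    (IsRep.map (J.isRep_contraction (NerveSpace.face i x) t r) g hgm ?_ ?_ ?_)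
    (J.isRep_contraction x t' r)
  · rintro ⟨j, S⟩
    induction j using WithBot.recBotCoe with
    | bot => rfl
    | coe j =>
      change J.obj (J.stageScale x.vertex t' r) _ S = J.obj (J.stageScale _ t r) _ S
      rw [hscale]; rfl
  · intro a
    rw [stepWeight, stepWeight]
    congr 1
    ext v
    simp only [mem_ofPred_eq, hvert]
    refine and_congr_right fun hv => ?_
    rw [hlabel v hv]
    exact hginj.eq_iff
  · intro a ha
    by_contra hh
    obtain ⟨v, hv, rfl⟩ := exists_eq_of_stepWeight_ne_zero hh
    exact ha ⟨_, (hlabel v hv).symm⟩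

/-- At time 0 nothing is shrunk and no `y i` is present, so the label `(j, ∅)` occupies an interval
of length `t j`. -/
lemma contraction_zero {k : ℕ} (x : NerveSpace C k) (t : stdSimplex ℝ (Fin (k + 1))) :
    J.contraction x t 0 = ClassifyingSpace.mk x t := by
  have hx : ∀ i j, i ≤ j → Nonempty (x.vertex i ⟶ x.vertex j) := fun _ _ h => x.nonempty_hom h
  have hc : ∀ n, clamp n 0 = 0 := fun n => clamp_eq_zero (by positivity)
  have hw : J.stageWeight x.vertex t 0 = t := by
    funext j; simp [stageWeight, hc]
  have hscale : J.stageScale x.vertex t 0 = 1 := by simp [stageScale, hc]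
  have hlev : ∀ i, J.stageLevel x.vertex t 0 i = 1 := fun i => by simp [stageLevel, hc]
  have hset : ∀ v < (1 : ℝ), levelSet (J.stageLevel x.vertex t 0) v = ∅ := fun v hv => by
    ext i
    rw [mem_levelSet (N := 0) (fun i _ => (hlev i).ge) hv, hlev]
    simpa using hv
  have hX : ∀ j : Fin (k + 1), J.labelObj x.vertex t 0 (j, ∅) = x.vertex j := fun j => by
    change J.obj (J.stageScale x.vertex t 0) _ ∅ = _
    rw [hscale, J.obj_one]
  have ht0 : ∀ m, 0 ≤ t m := stdSimplex.zero_le t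
  have ht1 : ∑ m, t m = 1 := stdSimplex.sum_eq_one t
  refine IsRep.unique (J.isRep_contraction x t 0) ⟨k, fun j => (j, ∅), fun i j hij => ?_,
    fun i j hij => ?_, t, fun j => ?_, fun a ha => ?_, ?_⟩
  · exact Prod.mk_lt_mk.2 (Or.inl ⟨WithBot.coe_lt_coe.2 hij, le_rfl⟩)
  · rw [hX, hX]; exact hx i j hij
  · have hS : {v | v ∈ Ico (0 : ℝ) 1 ∧ J.stageLabel x.vertex t 0 v = ((j : WithBot _), ∅)} =
        Ico (threshold 0 t j) (threshold 0 t j + t j) := by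
      ext v
      have key : v < 1 → (J.stageLabel x.vertex t 0 v = ((j : WithBot _), ∅) ↔
          threshold 0 t j ≤ v ∧ v < threshold 0 t j + t j) := fun hv => by
        have h1 := max_filter_threshold_iff (a := 0) zero_le_one ht0 hv ht1 j
        rw [sub_zero, one_mul] at h1
        rw [← h1, stageLabel, stepLabel, hset v hv, hw, hc, Prod.mk.injEq]
        simp
      have h2 := threshold_add_le_one (a := 0) zero_le_one ht0 ht1 j
      have h3 := le_threshold (a := 0) zero_le_one ht0 j
      rw [sub_zero, one_mul] at h2
      constructor
      · rintro ⟨hv, h⟩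
        exact (key hv.2).1 h
      · rintro ⟨h4, h5⟩
        have hv : v < 1 := h5.trans_le h2
        exact ⟨⟨h3.trans h4, hv⟩, (key hv).2 ⟨h4, h5⟩⟩
    rw [stepWeight, hS, Real.volume_real_Ico]
    simp [ht0]
  · by_contra hh
    obtain ⟨v, hv, rfl⟩ := exists_eq_of_stepWeight_ne_zero hh
    have h0 : ((Finset.univ.filter fun l =>
        threshold (clamp 3 0) (J.stageWeight x.vertex t 0) l ≤ v)).max ≠ ⊥ := by
      rw [Ne, Finset.max_eq_bot, Finset.filter_eq_empty_iff]
      intro h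
      refine h (Finset.mem_univ (0 : Fin (k + 1))) ?_
      simp [threshold, hc, hv.1]
    obtain ⟨j, hj⟩ := WithBot.ne_bot_iff_exists.1 h0
    exact ha ⟨j, Prod.ext hj (hset v hv.2).symm⟩
  · congr 1
    exact NerveSpace.ext_vertex fun j => (hX j).symm

/-- At time 6 the only label on `[0, 1)` is `(⊥, {0})`, whatever the simplex. -/
lemma contraction_six {k k' : ℕ} (x : NerveSpace C k) (t : stdSimplex ℝ (Fin (k + 1)))
    (x' : NerveSpace C k') (t' : stdSimplex ℝ (Fin (k' + 1))) :
    J.contraction x t 6 = J.contraction x' t' 6 := by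
  have hhom : ∀ i j : Fin 1, i ≤ j → Nonempty (J.y {0} ⟶ J.y {0}) := fun _ _ _ => ⟨𝟙 _⟩
  let s : stdSimplex ℝ (Fin 1) := ⟨fun _ => 1, fun _ => zero_le_one, by simp⟩
  have key : ∀ {k : ℕ} (x : NerveSpace C k) (t : stdSimplex ℝ (Fin (k + 1))),
      J.contraction x t 6 = ClassifyingSpace.mk (NerveSpace.ofChain (fun _ => J.y {0}) hhom) s := by
    intro k x t
    have h3 : clamp 3 6 = 1 := clamp_eq_one (by norm_num)
    have h4 : clamp 4 6 = 1 := clamp_eq_one (by norm_num)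
    have h5 : clamp 5 6 = 1 := clamp_eq_one (by norm_num)
    have hlev : ∀ i, J.stageLevel x.vertex t 6 i = if i = 0 then 0 else 1 := fun i => by
      simp [stageLevel, h4, h5]
    have hlabel : ∀ v ∈ Ico (0 : ℝ) 1, J.stageLabel x.vertex t 6 v = (⊥, {0}) := by
      intro v hv
      refine Prod.ext ?_ ?_
      · simp only [stageLabel, stepLabel]
        rw [Finset.max_eq_bot, Finset.filter_eq_empty_iff]
        intro l _
        simp only [threshold, h3, sub_self, zero_mul, add_zero, not_le]
        exact hv.2
      · ext i
        change i ∈ levelSet _ v ↔ i ∈ ({0} : Finset ℕ)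
        rw [mem_levelSet (N := 1) (fun i hi => ?_) hv.2, hlev, Finset.mem_singleton]
        · split_ifs with h
          · simpa [h] using hv.1
          · simpa [h] using hv.2
        · rw [hlev, if_neg (by omega)]
    refine IsRep.unique (J.isRep_contraction x t 6)
      ⟨0, fun _ => (⊥, {0}), fun i j hij => absurd hij (by omega), fun _ _ _ => ⟨𝟙 _⟩, s, fun i => ?_,
        fun a ha => ?_, rfl⟩
    · have hS : {v | v ∈ Ico (0 : ℝ) 1 ∧ J.stageLabel x.vertex t 6 v = (⊥, {0})} = Ico 0 1 := by
        ext v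
        exact ⟨fun h => h.1, fun h => ⟨h, hlabel v h⟩⟩
      rw [stepWeight, hS, Real.volume_real_Ico]
      simp only [sub_zero, zero_le_one, sup_of_le_left]
      rfl
    · by_contra hh
      obtain ⟨v, hv, rfl⟩ := exists_eq_of_stepWeight_ne_zero hh
      exact ha ⟨0, (hlabel v hv).symm⟩
  rw [key x t, key x' t']

/-! ### Joint continuity of the contraction -/

section StageContinuity

variable {k : ℕ} {Z : Type*} [TopologicalSpace Z] {X : Z → Fin (k + 1) → C}
  {t : Z → stdSimplex ℝ (Fin (k + 1))} {r : Z → ℝ}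

lemma continuousAt_of_isRep_stage
    (hind : IsInducing (fun f : Arrow C => ((f.left, f.right) : C × C)))
    (hX : Continuous X) (ht : Continuous t) (hr : Continuous r)
    (hx : ∀ z i j, i ≤ j → Nonempty (X z i ⟶ X z j)) (b : Z → ClassifyingSpace C)
    (hb : ∀ z, IsRep (J.labelObj (X z) (t z) (r z)) (stepWeight (J.stageLabel (X z) (t z) (r z)))
      (b z)) (z₀ : Z) : ContinuousAt b z₀ := by
  classical
  have hc₀ := J.maxAvg_pos (X z₀) (t z₀)
  have hmax : Continuous fun z => J.maxAvg (X z) (t z) := J.continuous_maxAvg.comp (hX.prodMk ht)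
  have hcnear := hmax.continuousAt.eventually_const_lt (half_lt_self hc₀)
  obtain ⟨N, hN⟩ := J.exists_eventually_one_le_stageLevel (r := r) hX ht z₀
  -- Nearby `maxAvg` exceeds half its value at `z₀`, so a distance in use exceeds a quarter of that
  -- value; this gives the `ε`.
  have hVpos := J.eventually_D_pos hX ht hr z₀ N (ε := J.maxAvg (X z₀) (t z₀) / 4) (by positivity)
  -- The finitely many labels that stand for well-defined objects at `z₀`; they remain well-defined
  -- nearby, and no others carry weight there.
  let V : Finset (WithBot (Fin (k + 1)) × Finset ℕ) :=
    (Finset.univ ×ˢ (Finset.range N).powerset).filter fun a => (a.1 = ⊥ → a.2.Nonempty) ∧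
      ∀ j : Fin (k + 1), a.1 = j → ∀ i ∈ a.2,
        0 < J.D i (X z₀ j) (J.stageScale (X z₀) (t z₀) (r z₀))
  refine continuousAt_of_isRep hind (fun z => J.labelObj (X z) (t z) (r z))
    (fun z => stepWeight (J.stageLabel (X z) (t z) (r z))) _ V
    (Filter.Eventually.of_forall hb) ?_ ?_ ?_ ?_
  · filter_upwards [hcnear, hN, hVpos] with z hz hzN hzV a ha
    obtain ⟨v, hv, rfl⟩ := exists_eq_of_stepWeight_ne_zero ha
    have hmem : ∀ i ∈ (J.stageLabel (X z) (t z) (r z) v).2, i ∈ Finset.range N :=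
      fun i hi => Finset.mem_range.2 (lt_of_mem_levelSet hzN hv.2 hi)
    refine Finset.mem_filter.2 ⟨Finset.mem_product.2 ⟨Finset.mem_univ _,
      Finset.mem_powerset.2 hmem⟩, fun h => ?_, fun j hj i hi => ?_⟩
    · exact J.nonempty_of_stageLabel _ _ _ hv (Prod.ext h rfl)
    · by_contra hh
      have h1 := J.lt_dist_of_stageLabel _ _ _ (hx z) hv (Prod.ext hj rfl) hi
      have h2 := (hzV i (hmem i hi) j).2 hh
      linarith
  · filter_upwards [hVpos] with z hzV a ha a' ha' haa'
    obtain ⟨h1, h2, h3⟩ := Finset.mem_filter.1 ha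
    obtain ⟨h1', h2', h3'⟩ := Finset.mem_filter.1 ha'
    refine J.nonempty_hom_labelObj _ _ _ (hx z) haa' h2 fun j hj i hi => ?_
    exact (hzV i (Finset.mem_powerset.1 (Finset.mem_product.1 h1').2 hi) j).1 (h3' j hj i hi)
  · intro a _
    exact continuousAt_stepWeight_stepLabel _ _ hN
      (fun l => J.continuousAt_stageThreshold hX ht hr z₀ (hx z₀) l)
      (fun i => (J.continuous_stageLevel hX ht hr i).continuousAt) a
  · rintro ⟨j, S⟩ ha
    obtain ⟨h1, h2, h3⟩ := Finset.mem_filter.1 ha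
    induction j using WithBot.recBotCoe with
    | bot => exact continuousAt_const
    | coe j =>
      exact ContinuousAt.comp (g := fun q : C × ℝ => J.obj q.2 q.1 S)
        (f := fun z => (X z j, J.stageScale (X z) (t z) (r z)))
        (J.continuousAt_obj _ _ S (J.stageScale_pos _ _ _) (h3 j rfl))
        (((continuous_apply j).comp hX).prodMk (J.continuous_stageScale hX ht hr)).continuousAt

end StageContinuity

lemma continuous_contraction
    (hind : IsInducing (fun f : Arrow C => ((f.left, f.right) : C × C))) (k : ℕ) :
    Continuous fun p : (NerveSpace C k × stdSimplex ℝ (Fin (k + 1))) × ℝ =>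
      J.contraction p.1.1 p.1.2 p.2 := by
  have hX : Continuous fun p : (NerveSpace C k × stdSimplex ℝ (Fin (k + 1))) × ℝ =>
      p.1.1.vertex := by
    refine continuous_pi fun i => ?_
    have h1 : Continuous fun p : (NerveSpace C k × stdSimplex ℝ (Fin (k + 1))) × ℝ => p.1.1 :=
      continuous_fst.comp continuous_fst
    exact (NerveSpace.continuous_vertex i).comp h1
  have ht : Continuous fun p : (NerveSpace C k × stdSimplex ℝ (Fin (k + 1))) × ℝ => p.1.2 :=
    continuous_snd.comp continuous_fst
  have hr : Continuous fun p : (NerveSpace C k × stdSimplex ℝ (Fin (k + 1))) × ℝ => p.2 :=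
    continuous_snd
  rw [continuous_iff_continuousAt]
  intro p₀
  have hx : ∀ (p : (NerveSpace C k × stdSimplex ℝ (Fin (k + 1))) × ℝ) i j, i ≤ j →
      Nonempty (p.1.1.vertex i ⟶ p.1.1.vertex j) := fun p _ _ h => p.1.1.nonempty_hom h
  have hb : ∀ p : (NerveSpace C k × stdSimplex ℝ (Fin (k + 1))) × ℝ,
      IsRep (J.labelObj p.1.1.vertex p.1.2 p.2) (stepWeight (J.stageLabel p.1.1.vertex p.1.2 p.2))
        (J.contraction p.1.1 p.1.2 p.2) := fun p => J.isRep_contraction p.1.1 p.1.2 p.2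
  exact J.continuousAt_of_isRep_stage hind hX ht hr hx _ hb p₀

/-- The classifying space of a thin category with a join system is contractible. -/
theorem contractibleSpace (J : JoinSystem C)
    (hind : IsInducing (fun f : Arrow C => ((f.left, f.right) : C × C))) [Nonempty C] :
    ContractibleSpace (ClassifyingSpace C) := by
  let H : ClassifyingSpace C → ℝ → ClassifyingSpace C := fun b r =>
    Quot.lift (fun p : Σ k : ℕ, NerveSpace C k × stdSimplex ℝ (Fin (k + 1)) =>
      J.contraction p.2.1 p.2.2 r) (by
        rintro _ _ ⟨i, x, t⟩
        exact J.contraction_face i x t r) b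
  have hH : Continuous fun p : ClassifyingSpace C × ℝ => H p.1 p.2 := by
    -- Since `ℝ` is locally compact, the product of the quotient map with `ℝ` is again a quotient
    -- map, and continuity can be checked on each `Nₖ × Δᵏ × ℝ`.
    have hq : IsQuotientMap (Quot.mk (FatRel C)) := isQuotientMap_quot_mk
    refine hq.continuous_lift_prod_left (X := ClassifyingSpace C) ?_
    rw [continuous_iff_continuousAt]
    rintro ⟨⟨k, p⟩, r⟩
    have hemb := (IsOpenEmbedding.sigmaMk (σ := fun k : ℕ =>
        NerveSpace C k × stdSimplex ℝ (Fin (k + 1))) (i := k)).prodMap (IsOpenEmbedding.id (X := ℝ))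
    have h1 := hemb.continuousAt_iff (g := fun q :
      (Σ k : ℕ, NerveSpace C k × stdSimplex ℝ (Fin (k + 1))) × ℝ =>
        H (Quot.mk (FatRel C) q.1) q.2) (x := (p, r))
    exact h1.1 (J.continuous_contraction hind k).continuousAt
  let x₀ : NerveSpace C 0 := NerveSpace.ofChain (fun _ => Classical.arbitrary C) fun _ _ _ => ⟨𝟙 _⟩
  let t₀ : stdSimplex ℝ (Fin 1) := ⟨fun _ => 1, fun _ => zero_le_one, by simp⟩
  rw [contractible_iff_id_nullhomotopic]
  refine ⟨J.contraction x₀ t₀ 6, ⟨{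
    toFun := fun p => H p.2 (6 * p.1)
    continuous_toFun := hH.comp (continuous_snd.prodMk
      (continuous_const.mul (continuous_subtype_val.comp continuous_fst)))
    map_zero_left := fun b => ?_
    map_one_left := fun b => ?_ }⟩⟩
  · induction b using Quot.ind with
    | mk p =>
      change J.contraction p.2.1 p.2.2 (6 * 0) = _
      rw [mul_zero]
      exact J.contraction_zero p.2.1 p.2.2
  · induction b using Quot.ind with
    | mk p =>
      change J.contraction p.2.1 p.2.2 (6 * 1) = _
      rw [mul_one]
      exact J.contraction_six _ _ _ _

end JoinSystem

end JoinSystems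

end

noncomputable section

/-! ## Connectedness of the surgered manifold -/

section Connectedness

universe w

variable {d : ℕ} [NeZero d] {M : Type w} [TopologicalSpace M]
  [ChartedSpace (EuclideanHalfSpace d) M]

lemma diskExtend_of_mem {d : ℕ} {M : Type*} (f : Disk d → M) {x : Euc d} (h : x ∈ Disk d) :
    diskExtend f x = f ⟨x, h⟩ := by
  rw [diskExtend, dif_pos h]

@[simp] lemma diskExtend_coe {d : ℕ} {M : Type*} (f : Disk d → M) (x : Disk d) :
    diskExtend f (x : Euc d) = f x := diskExtend_of_mem f x.2

/-- The center of the disk. -/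
def diskCenter (d : ℕ) : Disk d := ⟨0, by simp⟩

lemma disk_mem_nhds {d : ℕ} {x : Euc d} (hx : ‖x‖ < 1) : Disk d ∈ 𝓝 x :=
  Filter.mem_of_superset (Metric.isOpen_ball.mem_nhds (by simpa using hx))
    Metric.ball_subset_closedBall

lemma sphere_nonempty (d : ℕ) [NeZero d] : (Metric.sphere (0 : Euc d) 1).Nonempty := by
  have : Nonempty (Fin d) := ⟨0⟩
  have : Nontrivial (Euc d) := inferInstance
  exact NormedSpace.sphere_nonempty.2 zero_le_one

namespace SphereEmbedding

variable {T : Type} (e : SphereEmbedding d M T)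

lemma continuous_toFun (t : T) (s : ℤˣ) : Continuous (e.toFun t s) := by
  have h := (e.smooth t s).continuousOn
  rw [continuousOn_iff_continuous_domRestrict] at h
  convert h using 1
  funext x
  simp

/-- An embedded thickened sphere is a local homeomorphism at interior points of the disk. -/
lemma map_nhds_diskExtend (t : T) (s : ℤˣ) {x : Euc d} (hx : ‖x‖ < 1) :
    Filter.map (diskExtend (e.toFun t s)) (𝓝 x) = 𝓝 (diskExtend (e.toFun t s) x) := by
  set f := diskExtend (e.toFun t s) with hf
  have hxD : x ∈ Disk d := by simpa using hx.le
  have hsm : ContMDiffAt 𝓘(ℝ, Euc d) (𝓡∂ d) ∞ f x := (e.smooth t s).contMDiffAt (disk_mem_nhds hx)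
  have hmd : MDifferentiableAt 𝓘(ℝ, Euc d) (𝓡∂ d) f x := hsm.mdifferentiableAt (by simp)
  set φ := extChartAt (𝓡∂ d) (f x) with hφ
  have hg : ContDiffAt ℝ ∞ (φ ∘ f) x := by
    have := (contMDiffAt_iff.1 hsm).2
    rw [modelWithCornersSelf_coe, range_id, contDiffWithinAt_univ] at this
    exact this
  have hder : mfderivWithin 𝓘(ℝ, Euc d) (𝓡∂ d) f (Disk d) x = fderiv ℝ (φ ∘ f) x := by
    rw [mfderivWithin_of_mem_nhds (disk_mem_nhds hx), hmd.mfderiv]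
    simp [writtenInExtChartAt, hφ, fderivWithin_univ]
    rfl
  have hinj : Function.Injective (fderiv ℝ (φ ∘ f) x) := by
    have := e.immersive t s x hxD
    rwa [hder] at this
  -- The derivative in charts is an injective endomorphism, hence invertible, and the inverse
  -- function theorem applies.
  let L : Euc d ≃L[ℝ] Euc d :=
    (LinearEquiv.ofInjectiveEndo (fderiv ℝ (φ ∘ f) x : Euc d →ₗ[ℝ] Euc d)
      hinj).toContinuousLinearEquiv
  have hL : (L : Euc d →L[ℝ] Euc d) = fderiv ℝ (φ ∘ f) x := by
    ext v; rfl
  have hstrict : HasStrictFDerivAt (φ ∘ f) (L : Euc d →L[ℝ] Euc d) x := by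
    rw [hL]
    exact hg.hasStrictFDerivAt (by simp)
  have h1 : Filter.map (φ ∘ f) (𝓝 x) = 𝓝 (φ (f x)) := hstrict.map_nhds_eq_of_equiv
  -- The image avoids the boundary, so the inverse chart takes full neighbourhoods to neighbourhoods
  -- in `M`.
  have hint : range (𝓡∂ d) ∈ 𝓝 (φ (f x)) := by
    have h2 := e.mem_interior t s ⟨x, hxD⟩
    rw [← diskExtend_of_mem (e.toFun t s)] at h2
    exact mem_interior_iff_mem_nhds.1 h2
  have h2 : Filter.map φ.symm (𝓝 (φ (f x))) = 𝓝 (f x) := by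
    have h3 := map_extChartAt_symm_nhdsWithin_range (I := 𝓡∂ d) (f x)
    rwa [nhdsWithin_eq_nhds.2 hint] at h3
  rw [← h2, ← h1, Filter.map_map]
  refine Filter.map_congr ?_
  have h4 : ∀ᶠ y in 𝓝 x, f y ∈ φ.source :=
    hsm.continuousAt.eventually_mem (extChartAt_source_mem_nhds (I := 𝓡∂ d) (f x))
  filter_upwards [h4] with y hy
  exact (φ.left_inv hy).symm

lemma isOpen_image_ball (t : T) (s : ℤˣ) :
    IsOpen {p : M | ∃ x : Disk d, ‖(x : Euc d)‖ < 1 ∧ e.toFun t s x = p} := by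
  rw [isOpen_iff_mem_nhds]
  rintro p ⟨x, hx, rfl⟩
  rw [← diskExtend_coe (e.toFun t s), ← e.map_nhds_diskExtend t s hx]
  have hball : Metric.ball (0 : Euc d) 1 ∈ 𝓝 (x : Euc d) :=
    Metric.isOpen_ball.mem_nhds (by simpa using hx)
  refine Filter.mem_map.2 (Filter.mem_of_superset hball fun y hy => ?_)
  have hy1 : ‖y‖ < 1 := by simpa using hy
  have hyD : y ∈ Disk d := by simpa using hy1.le
  exact ⟨⟨y, hyD⟩, hy1, (diskExtend_of_mem _ hyD).symm⟩

/-- The center of an embedded disk. -/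
def center (t : T) (s : ℤˣ) : M := e.toFun t s (diskCenter d)

/-- The disk is connected, so a clopen set contains all of its image or none of it. -/
lemma mem_iff_center_mem {U : Set M} (hU : IsClopen U) (t : T) (s : ℤˣ) (x : Disk d) :
    e.toFun t s x ∈ U ↔ e.center t s ∈ U := by
  have hpc : PreconnectedSpace (Disk d) := isPreconnected_iff_preconnectedSpace.1
    (convex_closedBall (0 : Euc d) 1).isPreconnected
  have h := isClopen_iff.1 (hU.preimage (e.continuous_toFun t s))
  rcases h with h | h
  · have h1 : ∀ y, e.toFun t s y ∉ U := fun y hy => by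
      have : y ∈ e.toFun t s ⁻¹' U := hy
      rw [h] at this; exact this
    simp [center, h1]
  · have h1 : ∀ y, e.toFun t s y ∈ U := fun y => by
      have : y ∈ e.toFun t s ⁻¹' U := by rw [h]; trivial
      exact this
    simp [center, h1]

/-- `M` becomes connected when the two disks of each embedded thickened sphere are joined. -/
def IsConnecting : Prop :=
  ∀ U : Set M, IsClopen U → (∀ t, e.center t 1 ∈ U ↔ e.center t (-1) ∈ U) → U = ∅ ∨ U = univ

variable {e}

lemma center_mem_iff {U : Set M} (hU : ∀ t, e.center t 1 ∈ U ↔ e.center t (-1) ∈ U) (t : T)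
    (s : ℤˣ) : e.center t s ∈ U ↔ e.center t 1 ∈ U := by
  rcases Int.units_eq_one_or s with rfl | rfl
  · rfl
  · exact (hU t).symm

lemma mem_remainder_or (p : M) : (∃ q : e.Remainder, q.1 = p) ∨ ∃ t s x, e.toFun t s x = p := by
  by_cases h : ∀ (t : T) (s : ℤˣ) (x : Disk d), ‖(x : Euc d)‖ < 1 → e.toFun t s x ≠ p
  · exact Or.inl ⟨⟨p, h⟩, rfl⟩
  · push Not at h
    obtain ⟨t, s, x, -, hp⟩ := h
    exact Or.inr ⟨t, s, x, hp⟩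

/-- A clopen `U` that does not separate the two disks of any pair defines a clopen set in the
surgered manifold: `U` on the remainder, and each tube entirely in or out according to the centres
of its disks. -/
lemma isConnecting_of_connectedSpace (h : ConnectedSpace e.Surgered) : e.IsConnecting := by
  intro U hU hc
  let P : e.Remainder ⊕ (Σ _ : T, Metric.sphere (0 : Euc d) 1 × Icc (-1 : ℝ) 1) → Prop :=
    Sum.elim (fun p => p.1 ∈ U) (fun q => e.center q.1 1 ∈ U)
  have hP : ∀ a b, e.SurgeryRel a b → P a = P b := by
    rintro _ _ ⟨p, t, s, x, y, hy, hp⟩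
    refine propext ?_
    change p.1 ∈ U ↔ e.center t 1 ∈ U
    rw [hp, e.mem_iff_center_mem hU, center_mem_iff hc]
  let W : Set e.Surgered := {q | Quot.lift P hP q}
  have hval : Continuous fun p : e.Remainder => p.1 := continuous_subtype_val
  have hclopen : IsClopen (Quot.mk e.SurgeryRel ⁻¹' W) := by
    have h1 : (Sum.inl ⁻¹' (Quot.mk e.SurgeryRel ⁻¹' W) : Set e.Remainder) = {p | p.1 ∈ U} := rfl
    refine ⟨isClosed_sum_iff.2 ⟨?_, isClosed_sigma_iff.2 fun t => ?_⟩,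
      isOpen_sum_iff.2 ⟨?_, isOpen_sigma_iff.2 fun t => ?_⟩⟩
    · rw [h1]; exact hU.isClosed.preimage hval
    · exact isClosed_const (p := e.center t 1 ∈ U)
    · rw [h1]; exact hU.isOpen.preimage hval
    · exact isOpen_const (p := e.center t 1 ∈ U)
  have hW : IsClopen W := by
    have hq : IsQuotientMap (Quot.mk e.SurgeryRel) := isQuotientMap_quot_mk
    exact (hq.isClopen_preimage (s := W)).1 hclopen
  -- Points of the removed disks have no counterpart in the remainder; any point of the
  -- corresponding tube serves instead.
  have key : ∀ p : M, ∃ q : e.Surgered, q ∈ W ↔ p ∈ U := fun p => by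
    rcases mem_remainder_or (e := e) p with ⟨q, rfl⟩ | ⟨t, s, x, rfl⟩
    · exact ⟨Quot.mk _ (Sum.inl q), Iff.rfl⟩
    · rw [e.mem_iff_center_mem hU, center_mem_iff hc]
      obtain ⟨x₀⟩ := (sphere_nonempty d).to_subtype
      exact ⟨Quot.mk _ (Sum.inr ⟨t, (x₀, ⟨1, by simp⟩)⟩), Iff.rfl⟩
  rcases isClopen_iff.1 hW with hW | hW
  · refine Or.inl (eq_empty_of_forall_notMem fun p hp => ?_)
    obtain ⟨q, hq⟩ := key p
    rw [hW] at hq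
    exact hq.2 hp
  · refine Or.inr (eq_univ_of_forall fun p => ?_)
    obtain ⟨q, hq⟩ := key p
    rw [hW] at hq
    exact hq.1 trivial

/-- The points of `M` which correspond to points of the part `W` of the surgered manifold. -/
def fill (W : Set e.Surgered) (x₀ : Metric.sphere (0 : Euc d) 1) : Set M :=
  ((fun p : e.Remainder => p.1) '' {p | (Quot.mk _ (Sum.inl p) : e.Surgered) ∈ W}) ∪
    ⋃ t ∈ {t : T | (Quot.mk _ (Sum.inr ⟨t, (x₀, ⟨1, by simp⟩)⟩) : e.Surgered) ∈ W},
      ⋃ s : ℤˣ, range (e.toFun t s)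

/-- The open disks have open image, so the remainder is closed in `M`; the finitely many closed
disks have compact image in a Hausdorff space. -/
lemma isClosed_fill [Finite T] [T2Space M] {W : Set e.Surgered} (hW : IsClosed W)
    (x₀ : Metric.sphere (0 : Euc d) 1) : IsClosed (fill W x₀) := by
  have hR : IsClosed {p : M | ∀ (t : T) (s : ℤˣ) (x : Disk d), ‖(x : Euc d)‖ < 1 →
      e.toFun t s x ≠ p} := by
    have : {p : M | ∀ (t : T) (s : ℤˣ) (x : Disk d), ‖(x : Euc d)‖ < 1 → e.toFun t s x ≠ p} =
        (⋃ (t : T) (s : ℤˣ), {p : M | ∃ x : Disk d, ‖(x : Euc d)‖ < 1 ∧ e.toFun t s x = p})ᶜ := by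
      ext p
      simp only [mem_ofPred_eq, mem_compl_iff, mem_iUnion, not_exists, not_and]
    rw [this, isClosed_compl_iff]
    exact isOpen_iUnion fun t => isOpen_iUnion fun s => e.isOpen_image_ball t s
  have hemb : IsClosedEmbedding (fun p : e.Remainder => p.1) := hR.isClosedEmbedding_subtypeVal
  have hcont : Continuous fun p : e.Remainder => (Quot.mk _ (Sum.inl p) : e.Surgered) :=
    continuous_quot_mk.comp continuous_inl
  refine (hemb.isClosedMap _ (hW.preimage hcont)).union ?_
  refine (Set.toFinite _).isClosed_biUnion fun t _ => isClosed_iUnion_of_finite fun s => ?_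
  exact (isCompact_range (e.continuous_toFun t s)).isClosed

/-- `S^{d-1} × [-1, 1]` is connected because `d ≥ 2`; this is where the dimension enters. -/
lemma tube_mem_iff (hd : 2 ≤ d) {W : Set e.Surgered} (hW : IsClopen W) (t : T)
    (q q' : Metric.sphere (0 : Euc d) 1 × Icc (-1 : ℝ) 1) :
    (Quot.mk _ (Sum.inr ⟨t, q⟩) : e.Surgered) ∈ W ↔
      (Quot.mk _ (Sum.inr ⟨t, q'⟩) : e.Surgered) ∈ W := by
  have h1 : PreconnectedSpace (Metric.sphere (0 : Euc d) 1) :=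
    isPreconnected_iff_preconnectedSpace.1 (isPreconnected_sphere (by
      rw [rank_eq_card_basis (EuclideanSpace.basisFun (Fin d) ℝ).toBasis]
      simpa using (show 1 < d by omega)) _ _)
  have h2 : PreconnectedSpace (Icc (-1 : ℝ) 1) :=
    isPreconnected_iff_preconnectedSpace.1 isPreconnected_Icc
  have hcont : Continuous fun q : Metric.sphere (0 : Euc d) 1 × Icc (-1 : ℝ) 1 =>
      (Quot.mk _ (Sum.inr ⟨t, q⟩) : e.Surgered) :=
    continuous_quot_mk.comp (continuous_inr.comp continuous_sigmaMk)
  rcases isClopen_iff.1 (hW.preimage hcont) with h | h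
  · have h3 : ∀ q, ¬ (Quot.mk _ (Sum.inr ⟨t, q⟩) : e.Surgered) ∈ W := fun q hq => by
      have : q ∈ (∅ : Set (Metric.sphere (0 : Euc d) 1 × Icc (-1 : ℝ) 1)) := h ▸ hq
      exact this
    simp [h3]
  · have h3 : ∀ q, (Quot.mk _ (Sum.inr ⟨t, q⟩) : e.Surgered) ∈ W := fun q => by
      have : q ∈ (univ : Set (Metric.sphere (0 : Euc d) 1 × Icc (-1 : ℝ) 1)) := trivial
      rw [← h] at this
      exact this
    simp [h3]

/-- A point of the remainder lying in an embedded disk is on the boundary sphere, where it is glued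
to the tube of that disk. -/
lemma mk_mem_of_mem_fill (hd : 2 ≤ d) {W : Set e.Surgered} (hW : IsClopen W)
    {x₀ : Metric.sphere (0 : Euc d) 1} {p : e.Remainder} (hp : p.1 ∈ fill W x₀) :
    (Quot.mk _ (Sum.inl p) : e.Surgered) ∈ W := by
  rcases hp with ⟨q, hq, hqp⟩ | hp
  · have : q = p := Subtype.ext hqp
    rwa [this] at hq
  · simp only [mem_iUnion] at hp
    obtain ⟨t, ht, s, x, hx⟩ := hp
    have hx1 : ‖(x : Euc d)‖ = 1 := by
      have h1 : ‖(x : Euc d)‖ ≤ 1 := mem_closedBall_zero_iff.1 x.2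
      refine le_antisymm h1 (not_lt.1 fun h => p.2 t s x h hx)
    have hglue : (Quot.mk _ (Sum.inl p) : e.Surgered) = Quot.mk _ (Sum.inr ⟨t,
        (⟨(x : Euc d), by simpa using hx1⟩, ⟨((s : ℤ) : ℝ), by
          rcases Int.units_eq_one_or s with rfl | rfl <;> simp⟩)⟩) :=
      Quot.sound (SurgeryRel.glue p t s _ _ rfl hx.symm)
    rw [hglue, tube_mem_iff hd hW t _ (x₀, ⟨1, by simp⟩)]
    exact ht

/-- Each point of `M` comes from the remainder or lies in a disk whose tube is wholly in `W` or in
its complement, and the two descriptions agree where they overlap. Closedness of both fillings then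
makes them clopen. -/
lemma fill_compl (hd : 2 ≤ d) {W : Set e.Surgered} (hW : IsClopen W)
    (x₀ : Metric.sphere (0 : Euc d) 1) : fill Wᶜ x₀ = (fill W x₀)ᶜ := by
  have h1 : ∀ (W : Set e.Surgered) (t : T) (s : ℤˣ) (x : Disk d), IsClopen W →
      e.toFun t s x ∈ fill W x₀ →
      (Quot.mk _ (Sum.inr ⟨t, (x₀, ⟨1, by simp⟩)⟩) : e.Surgered) ∈ W := by
    intro W t s x hW h
    rcases h with ⟨q, hq, hqp⟩ | h
    · by_contra hh
      have h2 : q.1 ∈ fill Wᶜ x₀ := by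
        refine Or.inr ?_
        simp only [mem_iUnion]
        exact ⟨t, hh, s, x, hqp.symm⟩
      exact mk_mem_of_mem_fill hd hW.compl h2 hq
    · simp only [mem_iUnion] at h
      obtain ⟨t', ht', s', x', hx'⟩ := h
      have := e.injective (a₁ := (t', s', x')) (a₂ := (t, s, x)) hx'
      obtain rfl : t' = t := congrArg Prod.fst this
      exact ht'
  ext p
  rw [mem_compl_iff]
  rcases mem_remainder_or (e := e) p with ⟨q, rfl⟩ | ⟨t, s, x, rfl⟩
  · constructor
    · exact fun h h' => mk_mem_of_mem_fill hd hW.compl h (mk_mem_of_mem_fill hd hW h')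
    · intro h
      by_contra hh
      by_cases hq : (Quot.mk _ (Sum.inl q) : e.Surgered) ∈ W
      · exact h (Or.inl ⟨q, hq, rfl⟩)
      · exact hh (Or.inl ⟨q, hq, rfl⟩)
  · constructor
    · exact fun h h' => h1 _ t s x hW.compl h (h1 _ t s x hW h')
    · intro h
      by_contra hh
      have h2 : ∀ W : Set e.Surgered,
          (Quot.mk _ (Sum.inr ⟨t, (x₀, ⟨1, by simp⟩)⟩) : e.Surgered) ∈ W →
          e.toFun t s x ∈ fill W x₀ := fun W hW => by
        refine Or.inr ?_
        simp only [mem_iUnion]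
        exact ⟨t, hW, s, x, rfl⟩
      by_cases hq : (Quot.mk _ (Sum.inr ⟨t, (x₀, ⟨1, by simp⟩)⟩) : e.Surgered) ∈ W
      · exact h (h2 _ hq)
      · exact hh (h2 _ hq)

/-- A clopen set in the surgered manifold fills up to a clopen set of `M` that does not separate any
pair of disks, hence to `∅` or all of `M`. -/
lemma IsConnecting.connectedSpace [Finite T] [T2Space M] [Nonempty M] (hd : 2 ≤ d)
    (h : e.IsConnecting) : ConnectedSpace e.Surgered := by
  obtain ⟨x₀⟩ := (sphere_nonempty d).to_subtype
  have hne : Nonempty e.Surgered := by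
    rcases mem_remainder_or (e := e) (Classical.arbitrary M) with ⟨q, -⟩ | ⟨t, -⟩
    · exact ⟨Quot.mk _ (Sum.inl q)⟩
    · exact ⟨Quot.mk _ (Sum.inr ⟨t, (x₀, ⟨1, by simp⟩)⟩)⟩
  have hfill : ∀ W : Set e.Surgered, IsClopen W → fill W x₀ = ∅ → W = ∅ := by
    intro W hW h0
    refine eq_empty_of_forall_notMem fun q hq => ?_
    induction q using Quot.ind with
    | mk q =>
      rcases q with p | ⟨t, q⟩
      · have : p.1 ∈ fill W x₀ := Or.inl ⟨p, hq, rfl⟩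
        rw [h0] at this; exact this
      · have : e.center t 1 ∈ fill W x₀ := by
          refine Or.inr ?_
          simp only [mem_iUnion]
          exact ⟨t, (tube_mem_iff hd hW t _ _).1 hq, 1, diskCenter d, rfl⟩
        rw [h0] at this; exact this
  have hpre : PreconnectedSpace e.Surgered := by
    rw [preconnectedSpace_iff_clopen]
    intro W hW
    have hclopen : IsClopen (fill W x₀) := by
      refine ⟨isClosed_fill hW.isClosed x₀, ?_⟩
      rw [← isClosed_compl_iff, ← fill_compl hd hW]
      exact isClosed_fill hW.compl.isClosed x₀
    have hc : ∀ (W : Set e.Surgered) t s s',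
        IsClopen W → e.center t s ∈ fill W x₀ → e.center t s' ∈ fill W x₀ := by
      intro W t s s' hW hs
      by_contra hh
      rw [← mem_compl_iff, ← fill_compl hd hW] at hh
      by_cases hq : (Quot.mk _ (Sum.inr ⟨t, (x₀, ⟨1, by simp⟩)⟩) : e.Surgered) ∈ W
      · have : e.center t s' ∈ fill W x₀ := by
          refine Or.inr ?_
          simp only [mem_iUnion]
          exact ⟨t, hq, s', diskCenter d, rfl⟩
        rw [fill_compl hd hW] at hh
        exact hh this
      · have : e.center t s ∈ fill Wᶜ x₀ := by
          refine Or.inr ?_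
          simp only [mem_iUnion]
          exact ⟨t, hq, s, diskCenter d, rfl⟩
        rw [fill_compl hd hW] at this
        exact this hs
    rcases h _ hclopen fun t => ⟨hc W t _ _ hW, hc W t _ _ hW⟩ with h0 | h0
    · exact Or.inl (hfill W hW h0)
    · refine Or.inr ?_
      have : fill Wᶜ x₀ = ∅ := by rw [fill_compl hd hW, h0, compl_univ]
      exact compl_empty_iff.1 (hfill _ hW.compl this)
  exact { toPreconnectedSpace := hpre, toNonempty := hne }

end SphereEmbedding

end Connectedness

end

noncomputable section

/-! ## The topology on the space of embeddings -/

section EmbeddingTopology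

universe w

lemma uniqueDiffOn_disk (d : ℕ) : UniqueDiffOn ℝ (Disk d) :=
  uniqueDiffOn_convex (convex_closedBall _ _)
    ⟨0, mem_interior_iff_mem_nhds.2 (disk_mem_nhds (by simp))⟩

lemma smul_mem_disk {d : ℕ} {c : ℝ} (h0 : 0 ≤ c) (h1 : c ≤ 1) {x : Euc d} (hx : x ∈ Disk d) :
    c • x ∈ Disk d := by
  rw [mem_closedBall_zero_iff] at hx ⊢
  rw [norm_smul, Real.norm_of_nonneg h0]
  nlinarith [norm_nonneg x]

/-- This is the chain rule for scaling. The preimage of the disk under scaling is larger than the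
disk, so derivatives within the two sets are compared through unique differentiability; `U` confines
the argument to a chart domain. -/
lemma iteratedFDerivWithin_comp_smul_disk {d : ℕ} {F : Type*} [NormedAddCommGroup F]
    [NormedSpace ℝ F] {f : Euc d → F} {U : Set (Euc d)} (hU : IsOpen U)
    (hf : ContDiffOn ℝ ∞ f (Disk d ∩ U)) {c : ℝ} (hc : 0 < c) (hc1 : c ≤ 1) {x : Euc d}
    (hx : x ∈ Disk d) (hxU : c • x ∈ U) (k : ℕ) :
    iteratedFDerivWithin ℝ k (fun y => f (c • y)) (Disk d) x =
      c ^ k • iteratedFDerivWithin ℝ k f (Disk d) (c • x) := by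
  let L : Euc d →L[ℝ] Euc d := c • ContinuousLinearMap.id ℝ (Euc d)
  have hL : ∀ y, L y = c • y := fun y => rfl
  have hLU : IsOpen (L ⁻¹' U) := hU.preimage L.continuous
  have hs : UniqueDiffOn ℝ (Disk d ∩ U) := (uniqueDiffOn_disk d).inter hU
  have hs' : UniqueDiffOn ℝ (L ⁻¹' (Disk d ∩ U)) := by
    rw [preimage_inter]
    refine (uniqueDiffOn_convex ((convex_closedBall _ _).linear_preimage L.toLinearMap)
      ⟨0, mem_interior_iff_mem_nhds.2 ?_⟩).inter hLU
    exact L.continuous.continuousAt.preimage_mem_nhds (by simpa using disk_mem_nhds (by simp))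
  have hxm : L x ∈ Disk d ∩ U := ⟨smul_mem_disk hc.le hc1 hx, hxU⟩
  have hk : ((k : ℕ) : ℕ∞ω) ≤ ∞ := by exact_mod_cast le_top
  have h1 := L.iteratedFDerivWithin_comp_right hf hs hs' hxm hk
  have hsub : Disk d ∩ L ⁻¹' U ⊆ L ⁻¹' (Disk d ∩ U) := fun y hy =>
    ⟨smul_mem_disk hc.le hc1 hy.1, hy.2⟩
  have hcd : ContDiffOn ℝ k (f ∘ L) (L ⁻¹' (Disk d ∩ U)) :=
    (hf.of_le hk).comp L.contDiff.contDiffOn (fun y hy => hy)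
  have h2 := iteratedFDerivWithin_subset hsub ((uniqueDiffOn_disk d).inter hLU) hs' hcd
    (x := x) ⟨hx, hxU⟩
  rw [iteratedFDerivWithin_inter_open hLU hxU, h1] at h2
  have h3 : (fun y => f (c • y)) = f ∘ L := rfl
  rw [h3, h2, iteratedFDerivWithin_inter_open hU hxm.2]
  ext v
  simp only [ContinuousMultilinearMap.compContinuousLinearMap_apply, hL,
    smul_apply]
  exact (ContinuousMultilinearMap.map_smul_univ _ (fun _ => c) v).trans (by simp)

variable {d : ℕ} [NeZero d] {M : Type w} [TopologicalSpace M]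
  [ChartedSpace (EuclideanHalfSpace d) M]

/-- The set of all `g` with `g(K)` inside the domain of the chart at `p` and which are `ε`-close to
`f` on `K` in this chart, in the `k`-th derivatives. -/
def diskNhd (f : Disk d → M) (K : Set (Euc d)) (p : M) (k : ℕ) (ε : ℝ) : Set (Disk d → M) :=
  {g | (∀ x ∈ K, diskExtend g x ∈ (extChartAt (𝓡∂ d) p).source) ∧
    ∀ x ∈ K,
      ‖iteratedFDerivWithin ℝ k (extChartAt (𝓡∂ d) p ∘ diskExtend g) (Disk d) x
        - iteratedFDerivWithin ℝ k (extChartAt (𝓡∂ d) p ∘ diskExtend f) (Disk d) x‖ < ε}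

lemma mem_diskNhd_self {f : Disk d → M} {K : Set (Euc d)} {p : M} {k : ℕ} {ε : ℝ} (hε : 0 < ε)
    (hK : ∀ x ∈ K, diskExtend f x ∈ (extChartAt (𝓡∂ d) p).source) : f ∈ diskNhd f K p k ε :=
  ⟨hK, fun x _ => by simpa using hε⟩

namespace SphereEmbedding

variable {T : Type}

lemma eventually_mem_diskNhd (e : SphereEmbedding d M T) (t : T) (s : ℤˣ) {K : Set (Euc d)} {p : M}
    {k : ℕ} {ε : ℝ} (hK : IsCompact K) (hKD : K ⊆ Disk d) (hε : 0 < ε)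
    (hp : ∀ x ∈ K, diskExtend (e.toFun t s) x ∈ (extChartAt (𝓡∂ d) p).source) :
    ∀ᶠ g in 𝓝 e, SphereEmbedding.toFun g t s ∈ diskNhd (e.toFun t s) K p k ε :=
  have h : IsOpen (e.basicNhd t s K p k ε) := TopologicalSpace.isOpen_generateFrom_of_mem
    ⟨e, t, s, K, p, k, ε, hK, hKD, hε, hp, rfl⟩
  h.mem_nhds (mem_diskNhd_self (f := e.toFun t s) hε hp)

/-- The part of the disk mapped to a chart domain is relatively open. -/
lemma exists_isOpen_chart (e : SphereEmbedding d M T) (t : T) (s : ℤˣ) (p : M) :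
    ∃ U : Set (Euc d), IsOpen U ∧ ∀ x ∈ Disk d,
      x ∈ U ↔ diskExtend (e.toFun t s) x ∈ (extChartAt (𝓡∂ d) p).source := by
  obtain ⟨U, hU, h⟩ := continuousOn_iff'.1 (e.smooth t s).continuousOn _
    (isOpen_extChartAt_source (I := 𝓡∂ d) p)
  refine ⟨U, hU, fun x hx => ?_⟩
  have := Set.ext_iff.1 h x
  simp only [mem_inter_iff, mem_preimage, hx, and_true] at this
  exact this.symm

lemma contDiffOn_chart [IsManifold (𝓡∂ d) ∞ M] (e : SphereEmbedding d M T) (t : T) (s : ℤˣ)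
    (p : M) {U : Set (Euc d)}
    (hU : ∀ x ∈ Disk d, x ∈ U → diskExtend (e.toFun t s) x ∈ (extChartAt (𝓡∂ d) p).source) :
    ContDiffOn ℝ ∞ (extChartAt (𝓡∂ d) p ∘ diskExtend (e.toFun t s)) (Disk d ∩ U) := by
  refine contMDiffOn_iff_contDiffOn.1 ((contMDiffOn_extChartAt (x := p)).comp
    ((e.smooth t s).mono inter_subset_left) fun x hx => ?_)
  have := hU x hx.1 hx.2
  rwa [extChartAt_source] at this

lemma continuousOn_iteratedFDerivWithin_chart [IsManifold (𝓡∂ d) ∞ M] (e : SphereEmbedding d M T)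
    (t : T) (s : ℤˣ) (p : M) (k : ℕ) : ContinuousOn
      (iteratedFDerivWithin ℝ k (extChartAt (𝓡∂ d) p ∘ diskExtend (e.toFun t s)) (Disk d))
      {x | x ∈ Disk d ∧ diskExtend (e.toFun t s) x ∈ (extChartAt (𝓡∂ d) p).source} := by
  obtain ⟨U, hU, hUe⟩ := e.exists_isOpen_chart t s p
  have h := (e.contDiffOn_chart t s p fun x hx hxU => (hUe x hx).1 hxU)
    |>.continuousOn_iteratedFDerivWithin (m := k) (by exact_mod_cast le_top)
      ((uniqueDiffOn_disk d).inter hU)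
  have hset : {x | x ∈ Disk d ∧ diskExtend (e.toFun t s) x ∈ (extChartAt (𝓡∂ d) p).source} =
      Disk d ∩ U := by
    ext x
    exact and_congr_right fun hx => (hUe x hx).symm
  rw [hset]
  exact h.congr fun x hx => (iteratedFDerivWithin_inter_open hU hx.2).symm

/-- Subbasic neighbourhoods may be centred at an arbitrary embedding. By compactness of `K` the
strict bound leaves a uniform slack, so neighbourhoods centred at `F z₀` suffice. -/
lemma continuousAt_of_diskNhd [IsManifold (𝓡∂ d) ∞ M] {Z : Type*} [TopologicalSpace Z]
    {F : Z → SphereEmbedding d M T} {z₀ : Z}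
    (h : ∀ (t : T) (s : ℤˣ) (K : Set (Euc d)) (p : M) (k : ℕ) (ε : ℝ), IsCompact K → K ⊆ Disk d →
      0 < ε → (∀ x ∈ K, diskExtend ((F z₀).toFun t s) x ∈ (extChartAt (𝓡∂ d) p).source) →
      ∀ᶠ z in 𝓝 z₀, (F z).toFun t s ∈ diskNhd ((F z₀).toFun t s) K p k ε) :
    ContinuousAt F z₀ := by
  refine TopologicalSpace.tendsto_nhds_generateFrom_iff.2 ?_
  rintro _ ⟨e, t, s, K, p, k, ε, hK, hKD, hε, hp, rfl⟩ ⟨hm1, hm2⟩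
  have hcont : ContinuousOn (fun x =>
      ‖iteratedFDerivWithin ℝ k (extChartAt (𝓡∂ d) p ∘ diskExtend ((F z₀).toFun t s)) (Disk d) x
        - iteratedFDerivWithin ℝ k (extChartAt (𝓡∂ d) p ∘ diskExtend (e.toFun t s)) (Disk d) x‖)
      K :=
    (((F z₀).continuousOn_iteratedFDerivWithin_chart t s p k).mono
      fun x hx => ⟨hKD hx, hm1 x hx⟩).sub ((e.continuousOn_iteratedFDerivWithin_chart t s p k).mono
      fun x hx => ⟨hKD hx, hp x hx⟩) |>.norm
  obtain ⟨ε', hε', hlt⟩ : ∃ ε' < ε, ∀ x ∈ K,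
      ‖iteratedFDerivWithin ℝ k (extChartAt (𝓡∂ d) p ∘ diskExtend ((F z₀).toFun t s)) (Disk d) x
        - iteratedFDerivWithin ℝ k (extChartAt (𝓡∂ d) p ∘ diskExtend (e.toFun t s)) (Disk d) x‖
        ≤ ε' := by
    rcases K.eq_empty_or_nonempty with rfl | hne
    · exact ⟨0, hε, by simp⟩
    · obtain ⟨x, hx, hmax⟩ := hK.exists_isMaxOn hne hcont
      exact ⟨_, hm2 x hx, fun y hy => hmax hy⟩
  filter_upwards [h t s K p k (ε - ε') hK hKD (sub_pos.2 hε') hm1] with z hz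
  refine ⟨hz.1, fun x hx => ?_⟩
  have h1 := hz.2 x hx
  have h2 := hlt x hx
  calc _ ≤ _ := norm_sub_le_norm_sub_add_norm_sub _ (iteratedFDerivWithin ℝ k
        (extChartAt (𝓡∂ d) p ∘ diskExtend ((F z₀).toFun t s)) (Disk d) x) _
    _ < ε := by linarith

/-- The evaluation map is continuous. -/
lemma continuous_eval [IsManifold (𝓡∂ d) ∞ M] (t : T) (s : ℤˣ) : Continuous
    (fun q : SphereEmbedding d M T × Disk d => q.1.toFun t s q.2) := by
  rw [continuous_iff_continuousAt]
  rintro ⟨e, x⟩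
  set p := e.toFun t s x with hp
  set φ := extChartAt (𝓡∂ d) p with hφ
  have hsrc : e.toFun t s x ∈ φ.source := mem_extChartAt_source p
  have hopen : IsOpen φ.source := isOpen_extChartAt_source p
  -- On a compact neighbourhood of `x` mapped into one chart, the order-zero condition gives uniform
  -- closeness to `e`.
  obtain ⟨K, hKn, hKs, hKc⟩ := local_compact_nhds
    (((e.continuous_toFun t s).continuousAt (x := x)).preimage_mem_nhds (hopen.mem_nhds hsrc))
  set K' : Set (Euc d) := Subtype.val '' K
  have hK' : IsCompact K' := hKc.image continuous_subtype_val
  have hK'D : K' ⊆ Disk d := by rintro _ ⟨y, -, rfl⟩; exact y.2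
  have hK's : ∀ y ∈ K', diskExtend (e.toFun t s) y ∈ φ.source := by
    rintro _ ⟨y, hy, rfl⟩; rw [diskExtend_coe]; exact hKs hy
  have hev : ∀ ε > 0, ∀ᶠ g : SphereEmbedding d M T in 𝓝 e, ∀ y ∈ K, g.toFun t s y ∈ φ.source ∧
      ‖φ (g.toFun t s y) - φ (e.toFun t s y)‖ < ε := by
    intro ε hε
    filter_upwards [e.eventually_mem_diskNhd t s (k := 0) hK' hK'D hε hK's] with g hg y hy
    have h1 := hg.1 y ⟨y, hy, rfl⟩
    have h2 := hg.2 y ⟨y, hy, rfl⟩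
    rw [diskExtend_coe] at h1
    simp only [iteratedFDerivWithin_zero_eq_comp, Function.comp_apply, ← map_sub,
      LinearIsometryEquiv.norm_map, diskExtend_coe] at h2
    exact ⟨h1, h2⟩
  have hφc : ContinuousAt (fun y : Disk d => φ (e.toFun t s y)) x :=
    (continuousAt_extChartAt' hsrc).comp (e.continuous_toFun t s).continuousAt
  have htend : Filter.Tendsto (fun q : SphereEmbedding d M T × Disk d => φ (q.1.toFun t s q.2))
      (𝓝 (e, x)) (𝓝 (φ p)) := by
    rw [Metric.tendsto_nhds]
    intro ε hε
    rw [nhds_prod_eq]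
    filter_upwards [(hev (ε / 2) (half_pos hε)).prod_mk ((Filter.eventually_of_mem hKn
      fun y hy => hy).and (Metric.continuousAt_iff'.1 hφc (ε / 2) (half_pos hε)))] with q hq
    have h1 := (hq.1 q.2 hq.2.1).2
    have h2 := hq.2.2
    rw [← dist_eq_norm] at h1
    calc _ ≤ _ := dist_triangle _ (φ (e.toFun t s q.2)) _
      _ < ε := by rw [← hp] at h2; linarith
  have hin : ∀ᶠ q : SphereEmbedding d M T × Disk d in 𝓝 (e, x), q.1.toFun t s q.2 ∈ φ.source := by
    rw [nhds_prod_eq]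
    filter_upwards [(hev 1 one_pos).prod_mk (Filter.eventually_of_mem hKn fun y hy => hy)]
      with q hq
    exact (hq.1 q.2 hq.2).1
  have hmap : Filter.Tendsto φ.symm (𝓝[φ.target] (φ p)) (𝓝 p) := by
    have h := (continuousOn_extChartAt_symm (I := 𝓡∂ d) p) (φ p) (mem_extChartAt_target p)
    have h2 : φ.symm (φ p) = p := φ.left_inv (mem_extChartAt_source p)
    rw [ContinuousWithinAt, ← hφ, h2] at h
    exact h
  have h3 := hmap.comp (tendsto_nhdsWithin_of_tendsto_nhds_of_eventually_within _ htend
    (hin.mono fun q hq => φ.map_source hq))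
  refine h3.congr' (hin.mono fun q hq => ?_)
  exact φ.left_inv hq

end SphereEmbedding

end EmbeddingTopology

end

noncomputable section

/-! ## Shrinking embedded disks -/

section Shrink

universe w

variable {d : ℕ} [NeZero d] {M : Type w} [TopologicalSpace M]
  [ChartedSpace (EuclideanHalfSpace d) M]

/-- Scaling of the disk by a factor `c ∈ (0, 1]`. -/
def diskScale {d : ℕ} (c : Ioc (0 : ℝ) 1) (x : Disk d) : Disk d :=
  ⟨(c : ℝ) • (x : Euc d), smul_mem_disk c.2.1.le c.2.2 x.2⟩

lemma diskScale_injective {d : ℕ} (c : Ioc (0 : ℝ) 1) :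
    Function.Injective (diskScale c : Disk d → Disk d) := fun _ _ h =>
  Subtype.ext (smul_right_injective _ c.2.1.ne' (congrArg Subtype.val h))

@[simp] lemma diskScale_center {d : ℕ} (c : Ioc (0 : ℝ) 1) : diskScale c (diskCenter d) = diskCenter d :=
  Subtype.ext (smul_zero _)

@[simp] lemma diskScale_one {d : ℕ} (x : Disk d) : diskScale 1 x = x :=
  Subtype.ext (one_smul _ _)

lemma diskExtend_scale {d : ℕ} {M : Type*} (f : Disk d → M) (c : Ioc (0 : ℝ) 1) {x : Euc d}
    (hx : x ∈ Disk d) :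
    diskExtend (fun y => f (diskScale c y)) x = diskExtend f ((c : ℝ) • x) := by
  rw [diskExtend_of_mem _ hx, diskExtend_of_mem _ (smul_mem_disk c.2.1.le c.2.2 hx)]
  rfl

/-- The derivative of a map on the disk. -/
def diskDeriv (f : Disk d → M) (x : Euc d) : Euc d →L[ℝ] Euc d :=
  mfderivWithin 𝓘(ℝ, Euc d) (𝓡∂ d) (diskExtend f) (Disk d) x

lemma contMDiffOn_diskExtend_scale {f : Disk d → M}
    (hf : ContMDiffOn 𝓘(ℝ, Euc d) (𝓡∂ d) ∞ (diskExtend f) (Disk d)) (c : Ioc (0 : ℝ) 1) :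
    ContMDiffOn 𝓘(ℝ, Euc d) (𝓡∂ d) ∞ (diskExtend (fun y => f (diskScale c y))) (Disk d) := by
  have h1 : ContMDiffOn 𝓘(ℝ, Euc d) 𝓘(ℝ, Euc d) ∞ (fun x : Euc d => (c : ℝ) • x) (Disk d) :=
    (contDiff_const_smul (c : ℝ)).contMDiff.contMDiffOn
  exact (hf.comp h1 fun x hx => smul_mem_disk c.2.1.le c.2.2 hx).congr
    fun x hx => diskExtend_scale f c hx

lemma diskDeriv_scale {f : Disk d → M}
    (hf : ContMDiffOn 𝓘(ℝ, Euc d) (𝓡∂ d) ∞ (diskExtend f) (Disk d)) (c : Ioc (0 : ℝ) 1)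
    {x : Euc d} (hx : x ∈ Disk d) :
    diskDeriv (fun y => f (diskScale c y)) x =
      (diskDeriv f ((c : ℝ) • x)).comp ((c : ℝ) • ContinuousLinearMap.id ℝ (Euc d)) := by
  have hu : UniqueDiffWithinAt ℝ (Disk d) x := uniqueDiffOn_disk d x hx
  have hcx : (c : ℝ) • x ∈ Disk d := smul_mem_disk c.2.1.le c.2.2 hx
  have h1 : HasFDerivAt (fun x : Euc d => (c : ℝ) • x)
      ((c : ℝ) • ContinuousLinearMap.id ℝ (Euc d)) x := (hasFDerivAt_id x).const_smul (c : ℝ)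
  have h2 : HasMFDerivWithinAt 𝓘(ℝ, Euc d) 𝓘(ℝ, Euc d) (fun x : Euc d => (c : ℝ) • x) (Disk d) x
      ((c : ℝ) • ContinuousLinearMap.id ℝ (Euc d)) := h1.hasFDerivWithinAt.hasMFDerivWithinAt
  have h3 : HasMFDerivWithinAt 𝓘(ℝ, Euc d) (𝓡∂ d) (diskExtend f) (Disk d) ((c : ℝ) • x)
      (diskDeriv f ((c : ℝ) • x)) :=
    (hf.mdifferentiableOn (by simp) _ hcx).hasMFDerivWithinAt
  have h4 : HasMFDerivWithinAt 𝓘(ℝ, Euc d) (𝓡∂ d) (diskExtend f ∘ fun x : Euc d => (c : ℝ) • x)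
      (Disk d) x ((diskDeriv f ((c : ℝ) • x)).comp ((c : ℝ) • ContinuousLinearMap.id ℝ (Euc d))) :=
    h3.comp x h2 fun x hx => smul_mem_disk c.2.1.le c.2.2 hx
  have h5 := h4.congr_of_eventuallyEq (f₁ := diskExtend (fun y => f (diskScale c y)))
    (Filter.eventually_of_mem self_mem_nhdsWithin fun y hy => diskExtend_scale f c hy)
    (diskExtend_scale f c hx)
  exact h5.mfderivWithin hu.uniqueMDiffWithinAt

/-- Multiplication of a linear automorphism by a scale factor. -/
def scaleEquiv {d : ℕ} (c : Ioc (0 : ℝ) 1) (f : Euc d ≃L[ℝ] Euc d) : Euc d ≃L[ℝ] Euc d :=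
  f.trans (ContinuousLinearEquiv.smulLeft (Units.mk0 (c : ℝ) c.2.1.ne'))

@[simp] lemma scaleEquiv_apply {d : ℕ} (c : Ioc (0 : ℝ) 1) (f : Euc d ≃L[ℝ] Euc d) (v : Euc d) :
    scaleEquiv c f v = (c : ℝ) • f v := rfl

lemma norm_pow_smul_sub_le {E : Type*} [NormedAddCommGroup E] [NormedSpace ℝ E]
    (b : Ioc (0 : ℝ) 1) (k : ℕ) (u v : E) :
    ‖(b : ℝ) ^ k • u - (b : ℝ) ^ k • v‖ ≤ ‖u - v‖ := by
  rw [← smul_sub, norm_smul]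
  refine mul_le_of_le_one_left (norm_nonneg _) ?_
  rw [norm_pow, Real.norm_of_nonneg b.2.1.le]
  exact pow_le_one₀ b.2.1.le b.2.2

/-- The difference is continuous in `(b, x)` and vanishes at `b = c`; compactness of `K` makes it
uniformly small for `b` near `c`. -/
lemma eventually_norm_pow_smul_sub_lt {V E : Type*} [NormedAddCommGroup V] [NormedSpace ℝ V]
    [NormedAddCommGroup E] [NormedSpace ℝ E] {G : V → E} {A K : Set V} (hG : ContinuousOn G A)
    (hK : IsCompact K) {c : Ioc (0 : ℝ) 1} {N : Set (Ioc (0 : ℝ) 1)} (hN : N ∈ 𝓝 c)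
    (hNA : ∀ b ∈ N, ∀ x ∈ K, (b : ℝ) • x ∈ A) (hcA : ∀ x ∈ K, (c : ℝ) • x ∈ A) (k : ℕ) {ε : ℝ}
    (hε : 0 < ε) : ∀ᶠ b : Ioc (0 : ℝ) 1 in 𝓝 c, ∀ x ∈ K, b ∈ N →
      ‖(b : ℝ) ^ k • G ((b : ℝ) • x) - (c : ℝ) ^ k • G ((c : ℝ) • x)‖ < ε := by
  have hcont : ContinuousOn (fun z : Ioc (0 : ℝ) 1 × V =>
      ‖(z.1 : ℝ) ^ k • G ((z.1 : ℝ) • z.2) - (c : ℝ) ^ k • G ((c : ℝ) • z.2)‖) (N ×ˢ K) := by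
    refine ((ContinuousOn.smul (by fun_prop) (hG.comp (by fun_prop) ?_)).sub
      (ContinuousOn.smul (by fun_prop) (hG.comp (by fun_prop) ?_))).norm
    · rintro ⟨b, x⟩ ⟨hb, hx⟩
      exact hNA b hb x hx
    · rintro ⟨b, x⟩ ⟨hb, hx⟩
      exact hcA x hx
  have h := hK.eventually_forall_of_forall_eventually (x₀ := c)
    (P := fun b x => x ∈ K → b ∈ N →
      ‖(b : ℝ) ^ k • G ((b : ℝ) • x) - (c : ℝ) ^ k • G ((c : ℝ) • x)‖ < ε) fun x hx => by
    have h1 := hcont (c, x) ⟨mem_of_mem_nhds hN, hx⟩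
    have h2 := h1.eventually_lt_const (u := ε) (by simpa using hε)
    filter_upwards [eventually_nhdsWithin_iff.1 h2] with z hz hz1 hz2
    exact hz ⟨hz2, hz1⟩
  filter_upwards [h] with b hb x hx using hb x hx hx

namespace SphereEmbedding

variable {T : Type}

@[ext] lemma ext {e e' : SphereEmbedding d M T} (h : e.toFun = e'.toFun) : e = e' := by
  cases e; cases e'; cases h; rfl

/-- Restriction of an embedding to smaller concentric disks. -/
def shrink (e : SphereEmbedding d M T) (c : Ioc (0 : ℝ) 1) : SphereEmbedding d M T where
  toFun t s x := e.toFun t s (diskScale c x)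
  smooth t s := contMDiffOn_diskExtend_scale (e.smooth t s) c
  immersive t s x hx := by
    have h := diskDeriv_scale (e.smooth t s) c hx
    have h2 : Function.Injective (diskDeriv (fun y => e.toFun t s (diskScale c y)) x) := by
      rw [h]
      exact (e.immersive t s _ (smul_mem_disk c.2.1.le c.2.2 hx)).comp
        (smul_right_injective _ c.2.1.ne')
    exact h2
  injective := by
    rintro ⟨t, s, x⟩ ⟨t', s', x'⟩ h
    have h1 := e.injective (a₁ := (t, s, diskScale c x)) (a₂ := (t', s', diskScale c x')) h
    simp only [Prod.mk.injEq] at h1 ⊢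
    exact ⟨h1.1, h1.2.1, diskScale_injective c h1.2.2⟩
  mem_interior t s x := e.mem_interior t s _

@[simp] lemma shrink_one (e : SphereEmbedding d M T) : e.shrink 1 = e := by
  ext t s x; simp [shrink]

/-- The union of two disjoint embeddings. -/
def sum {T' : Type} (e : SphereEmbedding d M T) (e' : SphereEmbedding d M T')
    (h : ∀ t s x t' s' x', e.toFun t s x ≠ e'.toFun t' s' x') :
    SphereEmbedding d M (T ⊕ T') where
  toFun := Sum.elim e.toFun e'.toFun
  smooth := by rintro (t | t) s; exacts [e.smooth t s, e'.smooth t s]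
  immersive := by rintro (t | t) s; exacts [e.immersive t s, e'.immersive t s]
  injective := by
    rintro ⟨t | t, s, x⟩ ⟨t' | t', s', x'⟩ hh
    · have := e.injective (a₁ := (t, s, x)) (a₂ := (t', s', x')) hh
      simp only [Prod.mk.injEq] at this ⊢
      exact ⟨congrArg _ this.1, this.2⟩
    · exact absurd hh (h _ _ _ _ _ _)
    · exact absurd hh.symm (h _ _ _ _ _ _)
    · have := e'.injective (a₁ := (t, s, x)) (a₂ := (t', s', x')) hh
      simp only [Prod.mk.injEq] at this ⊢
      exact ⟨congrArg _ this.1, this.2⟩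
  mem_interior := by rintro (t | t) s x; exacts [e.mem_interior t s x, e'.mem_interior t s x]

/-- The condition involves centres only, and additional pairs only strengthen the hypothesis on the
clopen set. -/
lemma isConnecting_of_center_eq {T' : Type} {e : SphereEmbedding d M T}
    {e' : SphereEmbedding d M T'} (k : T → T') (h : ∀ t s, e'.center (k t) s = e.center t s)
    (he : e.IsConnecting) : e'.IsConnecting := fun U hU hc =>
  he U hU fun t => by rw [← h, ← h]; exact hc (k t)

lemma frameBundle_mk_congr [IsManifold (𝓡∂ d) ∞ M] {b b' : M} (hb : b = b')
    {f f' : Euc d →L[ℝ] Euc d} (hff : f = f') (hf : Function.Bijective f)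
    (hf' : Function.Bijective f') :
    FrameBundle.mk (F := Euc d) (V := fun p : M => TangentSpace (𝓡∂ d) p) b f hf =
      FrameBundle.mk (F := Euc d) (V := fun p : M => TangentSpace (𝓡∂ d) p) b' f' hf' := by
  subst hb; subst hff; rfl

/-- By the chain rule, shrinking by `c` multiplies the frame of the disk by `c` before applying the
differential at the scaled point. -/
lemma frame_shrink [IsManifold (𝓡∂ d) ∞ M] (e : SphereEmbedding d M T) (c : Ioc (0 : ℝ) 1) (t : T)
    (s : ℤˣ) (x : Disk d) (f : Euc d ≃L[ℝ] Euc d) :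
    (e.shrink c).frame t s x f = e.frame t s (diskScale c x) (scaleEquiv c f) := by
  refine frameBundle_mk_congr (diskExtend_scale _ c x.2) ?_ _ _
  have h := diskDeriv_scale (e.smooth t s) c x.2
  change (diskDeriv _ (x : Euc d)).comp _ = (diskDeriv _ (diskScale c x : Euc d)).comp _
  refine ContinuousLinearMap.ext fun v => ?_
  exact DFunLike.congr_fun h (f v)

/-- Shrinking is continuous in the `C^∞` topology. -/
lemma eventually_shrink_mem_diskNhd [IsManifold (𝓡∂ d) ∞ M] (e : SphereEmbedding d M T)
    (c : Ioc (0 : ℝ) 1) (t : T) (s : ℤˣ) {K : Set (Euc d)} {p : M} {k : ℕ} {ε : ℝ}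
    (hK : IsCompact K) (hKD : K ⊆ Disk d) (hε : 0 < ε)
    (hp : ∀ x ∈ K, diskExtend ((e.shrink c).toFun t s) x ∈ (extChartAt (𝓡∂ d) p).source) :
    ∀ᶠ q : SphereEmbedding d M T × Ioc (0 : ℝ) 1 in 𝓝 (e, c),
      (q.1.shrink q.2).toFun t s ∈ diskNhd ((e.shrink c).toFun t s) K p k ε := by
  set ψ := extChartAt (𝓡∂ d) p with hψ
  have hformula : ∀ (g : SphereEmbedding d M T) (b : Ioc (0 : ℝ) 1) (x : Euc d), x ∈ Disk d →
      diskExtend (g.toFun t s) ((b : ℝ) • x) ∈ ψ.source →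
      iteratedFDerivWithin ℝ k (ψ ∘ diskExtend ((g.shrink b).toFun t s)) (Disk d) x =
        (b : ℝ) ^ k • iteratedFDerivWithin ℝ k (ψ ∘ diskExtend (g.toFun t s)) (Disk d)
          ((b : ℝ) • x) := by
    intro g b x hx hs
    obtain ⟨U, hU, hUe⟩ := g.exists_isOpen_chart t s p
    have hcd := g.contDiffOn_chart t s p fun x hx hxU => (hUe x hx).1 hxU
    have hbx : (b : ℝ) • x ∈ Disk d := smul_mem_disk b.2.1.le b.2.2 hx
    rw [← iteratedFDerivWithin_comp_smul_disk hU hcd b.2.1 b.2.2 hx ((hUe _ hbx).2 hs)]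
    refine iteratedFDerivWithin_congr (fun y hy => ?_) hx k
    exact congrArg ψ (diskExtend_scale (g.toFun t s) b hy)
  set A : Set (Euc d) := {x | x ∈ Disk d ∧ diskExtend (e.toFun t s) x ∈ ψ.source} with hA
  have hcA : ∀ x ∈ K, (c : ℝ) • x ∈ A := fun x hx => by
    have := hp x hx
    rw [show (e.shrink c).toFun t s = fun y => e.toFun t s (diskScale c y) from rfl,
      diskExtend_scale _ _ (hKD hx)] at this
    exact ⟨smul_mem_disk c.2.1.le c.2.2 (hKD hx), this⟩
  obtain ⟨U, hU, hUe⟩ := e.exists_isOpen_chart t s p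
  -- a compact neighbourhood of `c` whose product with `K` stays in the chart domain
  have hev : ∀ᶠ b : Ioc (0 : ℝ) 1 in 𝓝 c, ∀ x ∈ K, (b : ℝ) • x ∈ U := by
    refine hK.eventually_forall_of_forall_eventually fun x hx => ?_
    have : Continuous fun z : Ioc (0 : ℝ) 1 × Euc d => (z.1 : ℝ) • z.2 := by fun_prop
    exact this.continuousAt.eventually_mem (hU.mem_nhds ((hUe _ (hcA x hx).1).2 (hcA x hx).2))
  have : LocallyCompactSpace (Ioc (0 : ℝ) 1) := by
    have h : IsLocallyClosed (Ioc (0 : ℝ) 1) := by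
      rw [← Ioi_inter_Iic]
      exact isOpen_Ioi.isLocallyClosed.inter isClosed_Iic.isLocallyClosed
    exact h.locallyCompactSpace
  obtain ⟨N, hNn, hNs, hNc⟩ := local_compact_nhds hev
  -- Closeness of the embeddings is required at all points `b • x` simultaneously, so `K` is
  -- replaced by a compact set containing them.
  set K' : Set (Euc d) := (fun z : Ioc (0 : ℝ) 1 × Euc d => (z.1 : ℝ) • z.2) '' (N ×ˢ K)
  have hK' : IsCompact K' := (hNc.prod hK).image (by fun_prop)
  have hK'A : K' ⊆ A := by
    rintro _ ⟨⟨b, x⟩, ⟨hb, hx⟩, rfl⟩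
    have h1 : (b : ℝ) • x ∈ Disk d := smul_mem_disk b.2.1.le b.2.2 (hKD hx)
    exact ⟨h1, (hUe _ h1).1 (hNs hb x hx)⟩
  have hG := e.continuousOn_iteratedFDerivWithin_chart t s p k
  set G := iteratedFDerivWithin ℝ k (ψ ∘ diskExtend (e.toFun t s)) (Disk d)
  have hev2 := eventually_norm_pow_smul_sub_lt hG hK hNn (fun b hb x hx => hK'A ⟨(b, x), ⟨hb, hx⟩, rfl⟩)
    hcA k (half_pos hε)
  rw [nhds_prod_eq]
  filter_upwards [(e.eventually_mem_diskNhd t s (k := k) hK' (fun x hx => (hK'A hx).1)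
    (half_pos hε) (fun x hx => (hK'A hx).2)).prod_mk
      (hev2.and (Filter.eventually_of_mem hNn fun b hb => hb))] with q hq
  obtain ⟨hq1, hq2, hq3⟩ := hq
  have hmem : ∀ x ∈ K, (q.2 : ℝ) • x ∈ K' := fun x hx => ⟨(q.2, x), ⟨hq3, hx⟩, rfl⟩
  refine ⟨fun x hx => ?_, fun x hx => ?_⟩
  · rw [show (q.1.shrink q.2).toFun t s = fun y => q.1.toFun t s (diskScale q.2 y) from rfl,
      diskExtend_scale _ _ (hKD hx)]
    exact hq1.1 _ (hmem x hx)
  · rw [hformula q.1 q.2 x (hKD hx) (hq1.1 _ (hmem x hx)), hformula e c x (hKD hx) (hcA x hx).2]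
    have h1 := hq1.2 _ (hmem x hx)
    have h2 := hq2 x hx hq3
    -- The first error comes from changing the embedding and is not enlarged, since the factor is at
    -- most 1; the second comes from changing the scaling factor of the fixed embedding.
    refine (norm_sub_le_norm_sub_add_norm_sub _ ((q.2 : ℝ) ^ k • G ((q.2 : ℝ) • x)) _).trans_lt ?_
    have h3 := norm_pow_smul_sub_le q.2 k (iteratedFDerivWithin ℝ k
      (ψ ∘ diskExtend (q.1.toFun t s)) (Disk d) ((q.2 : ℝ) • x)) (G ((q.2 : ℝ) • x))
    linarith

end SphereEmbedding

end Shrink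

end

noncomputable section

/-! ## Frames of Euclidean space -/

section EuclideanFrames

/-- The frame bundle of the tangent bundle of `ℝⁿ`. -/
abbrev EucFrame (n : ℕ) : Type :=
  FrameBundle n (Euc n) (fun p : Euc n => TangentSpace 𝓘(ℝ, Euc n) p)

namespace EucFrame

variable {n : ℕ}

/-- The frame at `v` given by a bijective endomorphism of `ℝⁿ`. -/
def of (v : Euc n) (f : Euc n →L[ℝ] Euc n) (hf : Function.Bijective f) : EucFrame n :=
  FrameBundle.mk (F := Euc n) (V := fun p : Euc n => TangentSpace 𝓘(ℝ, Euc n) p) v f hf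

/-- The endomorphism of `ℝⁿ` belonging to a frame. -/
def endo (y : EucFrame n) : Euc n →L[ℝ] Euc n := y.lin

lemma endo_bijective (y : EucFrame n) : Function.Bijective y.endo := y.2

lemma of_congr {v v' : Euc n} {f f' : Euc n →L[ℝ] Euc n} (hv : v = v') (hff : f = f')
    (hf : Function.Bijective f) (hf' : Function.Bijective f') : of v f hf = of v' f' hf' := by
  subst hv; subst hff; rfl

/-- The preferred trivializations of the tangent bundle of the model space are identities, so the
frame bundle has the product topology. -/
lemma inCoordinates_eq (b x : Euc n) (f : Euc n →L[ℝ] Euc n) :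
    ContinuousLinearMap.inCoordinates (Euc n) (Bundle.Trivial (Euc n) (Euc n)) (Euc n)
      (fun p : Euc n => TangentSpace 𝓘(ℝ, Euc n) p) b x b x f = f := by
  have h1 : Bundle.Trivialization.continuousLinearMapAt ℝ
    (trivializationAt (Euc n) (fun p : Euc n => TangentSpace 𝓘(ℝ, Euc n) p) b) x =
      ContinuousLinearMap.id ℝ (Euc n) :=
    TangentBundle.continuousLinearMapAt_model_space b x
  have h2 : Bundle.Trivialization.symmL ℝ
    (trivializationAt (Euc n) (Bundle.Trivial (Euc n) (Euc n)) b) x =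
      ContinuousLinearMap.id ℝ (Euc n) :=
    Bundle.Trivial.symmL_trivialization ℝ (Euc n) (Euc n) x
  unfold ContinuousLinearMap.inCoordinates
  rw [h1, h2]
  rfl

lemma continuous_of {Z : Type*} [TopologicalSpace Z] {v : Z → Euc n} {f : Z → Euc n →L[ℝ] Euc n}
    (hv : Continuous v) (hf : Continuous f) (hb : ∀ z, Function.Bijective (f z)) :
    Continuous (fun z => of (v z) (f z) (hb z)) := by
  refine Continuous.subtype_mk (continuous_iff_continuousAt.2 fun z => ?_) _
  refine (continuousAt_hom_bundle (RingHom.id ℝ) _).2 ⟨hv.continuousAt, ?_⟩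
  exact hf.continuousAt.congr
    (Filter.Eventually.of_forall fun y => (inCoordinates_eq _ (v y) (f y)).symm)

lemma continuous_base : Continuous (fun y : EucFrame n => y.base) :=
  continuous_iff_continuousAt.2 fun y₀ => ((continuousAt_hom_bundle (RingHom.id ℝ)
    (fun y : EucFrame n => y.1) (x₀ := y₀)).1 continuous_subtype_val.continuousAt).1

lemma continuous_endo : Continuous (fun y : EucFrame n => y.endo) :=
  continuous_iff_continuousAt.2 fun y₀ => by
    have h := ((continuousAt_hom_bundle (RingHom.id ℝ)
      (fun y : EucFrame n => y.1) (x₀ := y₀)).1 continuous_subtype_val.continuousAt).2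
    exact h.congr (Filter.Eventually.of_forall fun y => inCoordinates_eq _ y.base _)

/-- Frames are an open subset of `ℝⁿ × End(ℝⁿ)`. Local compactness makes composition of maps of
frame bundles continuous in the compact-open topology. -/
instance : LocallyCompactSpace (EucFrame n) := by
  have hopen : IsOpen {f : Euc n →L[ℝ] Euc n | Function.Bijective f} := by
    have h : {f : Euc n →L[ℝ] Euc n | Function.Bijective f} = {f | IsUnit f} := by
      ext f; exact ContinuousLinearMap.isUnit_iff_bijective.symm
    rw [h]; exact Units.isOpen
  have := hopen.locallyCompactSpace
  let φ : EucFrame n ≃ₜ Euc n × {f : Euc n →L[ℝ] Euc n | Function.Bijective f} :=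
    { toFun := fun y => (y.base, ⟨y.endo, y.endo_bijective⟩)
      invFun := fun p => of p.1 p.2.1 p.2.2
      left_inv := fun y => rfl
      right_inv := fun p => rfl
      continuous_toFun := continuous_base.prodMk (continuous_endo.subtype_mk _)
      continuous_invFun :=
        continuous_of continuous_fst (continuous_subtype_val.comp continuous_snd) _ }
  exact φ.isOpenEmbedding.locallyCompactSpace

end EucFrame

/-! ## Pulling back `Θ`-orientations along bundle maps -/

variable {n : ℕ} {Θ : Type*} [TopologicalSpace Θ] [StableGLAction Θ]

/-- The `Θ`-orientations obtained from equivariant self-maps of the frame bundle. -/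
def EucThetaOrientation.pullback (o : EucThetaOrientation n Θ) (φ : C(EucFrame n, EucFrame n))
    (hφ : ∀ (y : EucFrame n) g, φ (y.rightMul g) = (φ y).rightMul g) : EucThetaOrientation n Θ where
  toMap := o.toMap.comp φ
  equivariant y g := by
    rw [ContinuousMap.comp_apply, hφ, o.equivariant]; rfl

lemma EucThetaOrientation.continuous_pullback {Z : Type*} [TopologicalSpace Z]
    {o : Z → EucThetaOrientation n Θ} (ho : Continuous o)
    {φ : Z → C(EucFrame n, EucFrame n)} (hφ : Continuous φ)
    (hφe : ∀ z (y : EucFrame n) g, φ z (y.rightMul g) = (φ z y).rightMul g) :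
    Continuous fun z => (o z).pullback (φ z) (hφe z) := by
  refine continuous_induced_rng.2 ?_
  have h : Continuous fun z => (o z).toMap := continuous_induced_dom.comp ho
  exact h.compCM hφ

@[ext] lemma ThetaOrientation.ext {B F : Type*} [TopologicalSpace B] [NormedAddCommGroup F]
    [NormedSpace ℝ F] {V : B → Type*} [TopologicalSpace (Bundle.TotalSpace F V)]
    [∀ b, AddCommGroup (V b)] [∀ b, Module ℝ (V b)] [∀ b, TopologicalSpace (V b)]
    [∀ b, IsTopologicalAddGroup (V b)] [∀ b, ContinuousSMul ℝ (V b)]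
    [FiberBundle F V] [VectorBundle ℝ F V] {o o' : ThetaOrientation n F V Θ}
    (h : ∀ y, o.toMap y = o'.toMap y) : o = o' := by
  cases o; cases o'
  congr
  exact ContinuousMap.ext h

end EuclideanFrames

/-! ## The bundle maps which shrink the thickened spheres in `ℝ^{d+1}` -/

section SaddleShrink

variable {d : ℕ}

lemma contDiff_saddlePoint (s : ℤˣ) : ContDiff ℝ 1 (saddlePoint s : Euc d → Euc (d + 1)) := by
  have hn : ContDiff ℝ 1 (fun x : Euc d => ‖x‖ ^ 2) := contDiff_norm_sq ℝ
  have hr : ContDiff ℝ 1 (saddleRadius : Euc d → ℝ) := by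
    unfold saddleRadius
    have h1 : ContDiff ℝ 1 (fun x : Euc d => √(1 + 4 * ‖x‖ ^ 2)) :=
      (contDiff_const.add (contDiff_const.mul hn)).sqrt fun x => by positivity
    exact ((contDiff_const.add h1).div_const 2).sqrt fun x => by positivity
  have hri : ContDiff ℝ 1 (fun x : Euc d => (saddleRadius x)⁻¹) :=
    hr.inv fun x => (saddleRadius_pos x).ne'
  rw [contDiff_euclidean]
  intro i
  refine Fin.lastCases ?_ (fun j => ?_) i
  · simpa [saddlePoint, eucSnoc] using hr.mul contDiff_const
  · have : ContDiff ℝ 1 (fun x : Euc d => x j) :=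
      (EuclideanSpace.proj (𝕜 := ℝ) j : Euc d →L[ℝ] ℝ).contDiff
    simpa [saddlePoint, eucSnoc] using hri.mul this

lemma saddlePoint_ne_zero (s : ℤˣ) (x : Euc d) : saddlePoint s x ≠ 0 := by
  intro h
  have := morseFn_saddlePoint s x
  rw [h] at this
  simp [morseFn] at this

lemma continuous_eucSnoc {Z : Type*} [TopologicalSpace Z] {x : Z → Euc d} {c : Z → ℝ}
    (hx : Continuous x) (hc : Continuous c) : Continuous fun z => eucSnoc (x z) (c z) := by
  refine (PiLp.continuous_toLp 2 _).comp (continuous_pi fun i => ?_)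
  refine Fin.lastCases ?_ (fun j => ?_) i
  · simpa using hc
  · have h : Continuous fun z => x z j :=
      (EuclideanSpace.proj (𝕜 := ℝ) j : Euc d →L[ℝ] ℝ).continuous.comp hx
    simpa using h

/-- The extension of `c` times the identity of the tangent space of `D^d` at `x` by the normal
vector. -/
def saddleLin (s : ℤˣ) (c : ℝ) (x : Euc d) : Euc (d + 1) →L[ℝ] Euc (d + 1) :=
  c • (fderiv ℝ (saddlePoint s) x).comp (eucInit d) +
    (eucLast d).smulRight (morseNormal (saddlePoint s x))

lemma continuous_saddleLin (s : ℤˣ) :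
    Continuous fun p : ℝ × Euc d => saddleLin s p.1 p.2 := by
  have h1 : Continuous fun x : Euc d => fderiv ℝ (saddlePoint s) x :=
    (contDiff_saddlePoint s).continuous_fderiv one_ne_zero
  have h2 : Continuous (saddlePoint s : Euc d → _) := (contDiff_saddlePoint s).continuous
  have h3 : Continuous fun x : Euc d => morseNormal (saddlePoint s x) := by
    refine Continuous.smul (Continuous.inv₀ (continuous_const.mul (h2.norm.pow 2)) fun x => ?_)
      (continuous_eucSnoc ?_ ?_)
    · exact (mul_pos two_pos (pow_pos (norm_pos_iff.2 (saddlePoint_ne_zero s x)) 2)).ne'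
    · exact (eucInit d).continuous.comp h2
    · exact ((eucLast d).continuous.comp h2).neg
  refine continuous_clm_apply.2 fun w => ?_
  change Continuous fun p : ℝ × Euc d => p.1 • (fderiv ℝ (saddlePoint s) p.2) (eucInit d w) +
    eucLast d w • morseNormal (saddlePoint s p.2)
  exact (continuous_fst.smul ((h1.comp continuous_snd).clm_apply continuous_const)).add
    ((continuous_const (y := eucLast d w)).smul (h3.comp continuous_snd))

lemma isUnit_saddleLin (s : ℤˣ) {c : ℝ} (hc : c ≠ 0) (x : Euc d) : IsUnit (saddleLin s c x) := by
  rw [ContinuousLinearMap.isUnit_iff_bijective]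
  convert saddleFrameMap_bijective s x (ContinuousLinearEquiv.smulLeft (Units.mk0 c hc)) using 2
  ext1 w
  simp [saddleLin, saddleFrameMap]

/-- The factor by which the shrinking map scales at `v`: it is `1` for `|v₋| ≤ 1/2`, and `c` for
`1 ≤ |v₋|`. -/
def saddleScale (c : ℝ) (v : Euc (d + 1)) : ℝ :=
  1 + max 0 (min 1 (2 * |eucLast d v| - 1)) * (c - 1)

lemma continuous_saddleScale : Continuous fun p : ℝ × Euc (d + 1) => saddleScale p.1 p.2 := by
  unfold saddleScale
  fun_prop

lemma saddleScale_pos (c : Ioc (0 : ℝ) 1) (v : Euc (d + 1)) : 0 < saddleScale c v := by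
  have h1 : max 0 (min 1 (2 * |eucLast d v| - 1)) ≤ 1 := max_le zero_le_one (min_le_left _ _)
  have h2 : 0 ≤ max 0 (min 1 (2 * |eucLast d v| - 1)) := le_max_left _ _
  have h3 := c.2.1
  have h4 := c.2.2
  unfold saddleScale
  nlinarith

@[simp] lemma saddleScale_one (v : Euc (d + 1)) : saddleScale 1 v = 1 := by simp [saddleScale]

lemma saddleScale_of_eucLast_eq_zero (c : ℝ) {v : Euc (d + 1)} (hv : eucLast d v = 0) :
    saddleScale c v = 1 := by simp [saddleScale, hv]

lemma saddleScale_of_one_le (c : ℝ) {v : Euc (d + 1)} (hv : 1 ≤ |eucLast d v|) :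
    saddleScale c v = c := by
  rw [saddleScale, min_eq_left (by linarith), max_eq_right zero_le_one]
  ring

/-- The point of the disk belonging to a point of `ℝ^{d+1}`. -/
def saddleCoord (v : Euc (d + 1)) : Euc d := |eucLast d v| • eucInit d v

lemma continuous_saddleCoord : Continuous (saddleCoord : Euc (d + 1) → Euc d) :=
  (eucLast d).continuous.abs.smul (eucInit d).continuous

lemma abs_eucLast_saddlePoint (s : ℤˣ) (x : Euc d) :
    |eucLast d (saddlePoint s x)| = saddleRadius x := by
  have h := saddleRadius_pos x
  rcases Int.units_eq_one_or s with rfl | rfl <;> simp [saddlePoint, abs_of_pos h]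

@[simp] lemma saddleCoord_saddlePoint (s : ℤˣ) (x : Euc d) :
    saddleCoord (saddlePoint s x) = x := by
  rw [saddleCoord, abs_eucLast_saddlePoint, saddlePoint, eucInit_snoc,
    smul_inv_smul₀ (saddleRadius_pos x).ne']

lemma one_le_saddleRadius (x : Euc d) : 1 ≤ saddleRadius x := by
  have h := saddleRadius_eq x
  have h0 := saddleRadius_pos x
  by_contra hlt
  push Not at hlt
  have h1 : saddleRadius x ^ 2 < 1 := by nlinarith
  have h2 : 0 < saddleRadius x ^ 2 := by positivity
  nlinarith [sq_nonneg ‖x‖]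

/-- The effect of the shrinking map on the points of one side of `ℝ^{d+1}`. -/
def sideShift (s : ℤˣ) (c : ℝ) (v : Euc (d + 1)) : Euc (d + 1) :=
  v + saddlePoint s (saddleScale c v • saddleCoord v) - saddlePoint s (saddleCoord v)

/-- The effect of the shrinking map on the tangent vectors of one side of `ℝ^{d+1}`. -/
def sideLin (s : ℤˣ) (c : ℝ) (v : Euc (d + 1)) : Euc (d + 1) →L[ℝ] Euc (d + 1) :=
  saddleLin s (saddleScale c v) (saddleScale c v • saddleCoord v) *
    Ring.inverse (saddleLin s 1 (saddleCoord v))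

lemma continuous_sideShift (s : ℤˣ) :
    Continuous fun p : ℝ × Euc (d + 1) => sideShift s p.1 p.2 := by
  have h2 : Continuous (saddlePoint s : Euc d → _) := (contDiff_saddlePoint s).continuous
  have h3 := continuous_saddleCoord (d := d)
  exact (continuous_snd.add (h2.comp (continuous_saddleScale.smul (h3.comp continuous_snd)))).sub
    (h2.comp (h3.comp continuous_snd))

lemma continuous_sideLin (s : ℤˣ) :
    Continuous fun p : ℝ × Euc (d + 1) => sideLin s p.1 p.2 := by
  have h3 := continuous_saddleCoord (d := d)
  refine Continuous.mul ((continuous_saddleLin s).comp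
    (continuous_saddleScale.prodMk (continuous_saddleScale.smul (h3.comp continuous_snd)))) ?_
  refine continuous_iff_continuousAt.2 fun p => ?_
  obtain ⟨u, hu⟩ := isUnit_saddleLin s one_ne_zero (saddleCoord p.2)
  have h4 : ContinuousAt (Ring.inverse (M₀ := Euc (d + 1) →L[ℝ] Euc (d + 1)))
      (saddleLin s 1 (saddleCoord p.2)) := by
    rw [← hu]; exact NormedRing.inverse_continuousAt u
  have h5 : Continuous fun p : ℝ × Euc (d + 1) => saddleLin s 1 (saddleCoord p.2) :=
    (continuous_saddleLin s).comp (continuous_const.prodMk (h3.comp continuous_snd))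
  exact ContinuousAt.comp (f := fun p : ℝ × Euc (d + 1) => saddleLin s 1 (saddleCoord p.2))
    h4 h5.continuousAt

lemma sideShift_of_scale_eq_one (s : ℤˣ) {c : ℝ} {v : Euc (d + 1)} (h : saddleScale c v = 1) :
    sideShift s c v = v := by simp [sideShift, h]

lemma sideLin_of_scale_eq_one (s : ℤˣ) {c : ℝ} {v : Euc (d + 1)} (h : saddleScale c v = 1) :
    sideLin s c v = 1 := by
  rw [sideLin, h, one_smul, Ring.mul_inverse_cancel _ (isUnit_saddleLin s one_ne_zero _)]

lemma isUnit_sideLin (s : ℤˣ) (c : Ioc (0 : ℝ) 1) (v : Euc (d + 1)) : IsUnit (sideLin s c v) :=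
  (isUnit_saddleLin s (saddleScale_pos c v).ne' _).mul
    (isUnit_saddleLin s one_ne_zero _).ringInverse

/-- The side of `ℝ^{d+1}` on which a point lies. -/
def eucSide (v : Euc (d + 1)) : ℤˣ := if 0 ≤ eucLast d v then 1 else -1

lemma eucSide_saddlePoint (s : ℤˣ) (x : Euc d) : eucSide (saddlePoint s x) = s := by
  have h := saddleRadius_pos x
  rcases Int.units_eq_one_or s with rfl | rfl
  · simp [eucSide, saddlePoint, h.le]
  · simp [eucSide, saddlePoint, h]

/-- The formulas for the two sides are glued along the hyperplane `v₋ = 0`; there the scale is 1 and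
both shrinking maps are the identity. -/
lemma continuous_comp_eucSide {X : Type*} [TopologicalSpace X] {f : ℤˣ → ℝ × Euc (d + 1) → X}
    (hf : ∀ s, Continuous (f s))
    (h : ∀ c v, eucLast d v = 0 → f 1 (c, v) = f (-1) (c, v)) :
    Continuous fun p : ℝ × Euc (d + 1) => f (eucSide p.2) p := by
  have h1 := Continuous.if_le (f := fun _ : ℝ × Euc (d + 1) => (0 : ℝ))
    (g := fun p : ℝ × Euc (d + 1) => eucLast d p.2) (hf 1) (hf (-1)) continuous_const
    ((eucLast d).continuous.comp continuous_snd) (fun p hp => h p.1 p.2 hp.symm)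
  convert h1 using 2 with p
  unfold eucSide
  split_ifs <;> rfl

/-- The bundle maps which shrink the thickened spheres in `ℝ^{d+1}`. -/
def shrinkFrame (c : Ioc (0 : ℝ) 1) (y : EucFrame (d + 1)) : EucFrame (d + 1) :=
  EucFrame.of (sideShift (eucSide y.base) c y.base) ((sideLin (eucSide y.base) c y.base) * y.endo)
    (ContinuousLinearMap.isUnit_iff_bijective.1 ((isUnit_sideLin _ c _).mul
      (ContinuousLinearMap.isUnit_iff_bijective.2 y.endo_bijective)))

lemma continuous_shrinkFrame :
    Continuous fun p : Ioc (0 : ℝ) 1 × EucFrame (d + 1) => shrinkFrame p.1 p.2 := by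
  have hp : Continuous fun p : Ioc (0 : ℝ) 1 × EucFrame (d + 1) => ((p.1 : ℝ), p.2.base) :=
    (continuous_subtype_val.comp continuous_fst).prodMk
      (EucFrame.continuous_base.comp continuous_snd)
  have h1 := continuous_comp_eucSide (f := fun s (p : ℝ × Euc (d + 1)) => sideShift s p.1 p.2)
    continuous_sideShift fun c v hv => by
      simp only [sideShift_of_scale_eq_one _ (saddleScale_of_eucLast_eq_zero c hv)]
  have h2 := continuous_comp_eucSide (f := fun s (p : ℝ × Euc (d + 1)) => sideLin s p.1 p.2)
    continuous_sideLin fun c v hv => by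
      simp only [sideLin_of_scale_eq_one _ (saddleScale_of_eucLast_eq_zero c hv)]
  exact EucFrame.continuous_of (h1.comp hp)
    ((h2.comp hp).mul (EucFrame.continuous_endo.comp continuous_snd)) _

lemma shrinkFrame_one (y : EucFrame (d + 1)) : shrinkFrame 1 y = y := by
  have h : saddleScale ((1 : Ioc (0 : ℝ) 1) : ℝ) y.base = 1 := saddleScale_one y.base
  exact EucFrame.of_congr (sideShift_of_scale_eq_one _ h)
    (by rw [sideLin_of_scale_eq_one _ h, one_mul]) _ y.endo_bijective

/-- Both extended frames factor through `f ⊕ 1`, followed by `saddleLin` at the respective point and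
scale. -/
lemma saddleFrameMap_scaleEquiv (s : ℤˣ) (c : Ioc (0 : ℝ) 1) (x y : Euc d)
    (f : Euc d ≃L[ℝ] Euc d) :
    saddleLin s c y * Ring.inverse (saddleLin s 1 x) * saddleFrameMap s x f =
      saddleFrameMap s y (scaleEquiv c f) := by
  let g : Euc (d + 1) →L[ℝ] Euc (d + 1) := LinearMap.toContinuousLinearMap
    { toFun := fun w => eucSnoc (f (eucInit d w)) (eucLast d w)
      map_add' := fun v w => euc_ext (by simp) (by simp)
      map_smul' := fun c v => euc_ext (by simp) (by simp) }
  have hg : ∀ w, g w = eucSnoc (f (eucInit d w)) (eucLast d w) := fun w => rfl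
  have h1 : saddleFrameMap s x f = saddleLin s 1 x * g := by
    ext1 w
    simp [saddleFrameMap, saddleLin, hg]
  have h2 : saddleFrameMap s y (scaleEquiv c f) = saddleLin s c y * g := by
    ext1 w
    simp [saddleFrameMap, saddleLin, hg]
  rw [h1, h2, mul_assoc, Ring.inverse_mul_cancel_left _ _ (isUnit_saddleLin s one_ne_zero x)]

/-- On the thickened sphere `|v₋| ≥ 1`, so the full factor `c` is in force. The frame map is a
bundle map and need not be the differential of its base map; on the thickened sphere it has the
effect required for the shrunk embedding. -/
lemma shrinkFrame_saddleFrame (s : ℤˣ) (c : Ioc (0 : ℝ) 1) (x : Euc d) (f : Euc d ≃L[ℝ] Euc d) :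
    shrinkFrame c (saddleFrame s x f) = saddleFrame s ((c : ℝ) • x) (scaleEquiv c f) := by
  have hb : (saddleFrame s x f).base = saddlePoint s x := rfl
  have hc : saddleScale (c : ℝ) (saddlePoint s x) = c := saddleScale_of_one_le _ (by
    rw [abs_eucLast_saddlePoint]; exact one_le_saddleRadius x)
  refine EucFrame.of_congr ?_ ?_ _ (saddleFrameMap_bijective _ _ _)
  · rw [hb, eucSide_saddlePoint, sideShift, hc, saddleCoord_saddlePoint]
    abel
  · rw [hb, eucSide_saddlePoint, sideLin, hc, saddleCoord_saddlePoint]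
    exact saddleFrameMap_scaleEquiv s c x _ f

variable {Θ : Type*} [TopologicalSpace Θ] [StableGLAction Θ]

/-- The shrinking maps as continuous maps. -/
def shrinkFrameMap : C(Ioc (0 : ℝ) 1, C(EucFrame (d + 1), EucFrame (d + 1))) :=
  ContinuousMap.curry ⟨fun p => shrinkFrame p.1 p.2, continuous_shrinkFrame⟩

/-- The `Θ`-orientation of `ℝ^{d+1}` which belongs to the shrunk thickened sphere. -/
def EucThetaOrientation.shrink (o : EucThetaOrientation (d + 1) Θ) (c : Ioc (0 : ℝ) 1) :
    EucThetaOrientation (d + 1) Θ :=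
  o.pullback (shrinkFrameMap c) fun _ _ => rfl

lemma EucThetaOrientation.continuous_shrink :
    Continuous fun p : EucThetaOrientation (d + 1) Θ × Ioc (0 : ℝ) 1 => p.1.shrink p.2 :=
  EucThetaOrientation.continuous_pullback continuous_fst
    (shrinkFrameMap.continuous.comp continuous_snd) _

@[simp] lemma EucThetaOrientation.shrink_one (o : EucThetaOrientation (d + 1) Θ) :
    o.shrink 1 = o :=
  ThetaOrientation.ext fun y => congrArg o.toMap (shrinkFrame_one y)

lemma EucThetaOrientation.shrink_apply (o : EucThetaOrientation (d + 1) Θ) (c : Ioc (0 : ℝ) 1)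
    (y : EucFrame (d + 1)) : (o.shrink c).toMap y = o.toMap (shrinkFrame c y) := rfl

lemma SphereEmbedding.RespectsOrientation.shrink [NeZero d] {M : Type*} [TopologicalSpace M]
    [ChartedSpace (EuclideanHalfSpace d) M] [IsManifold (𝓡∂ d) ∞ M]
    {oM : TangentThetaOrientation d M Θ} {T : Type} {e : SphereEmbedding d M T}
    {o : T → EucThetaOrientation (d + 1) Θ} (h : e.RespectsOrientation oM o)
    (c : Ioc (0 : ℝ) 1) : (e.shrink c).RespectsOrientation oM fun t => (o t).shrink c := by
  intro t s x f
  rw [e.frame_shrink, h, EucThetaOrientation.shrink_apply, shrinkFrame_saddleFrame]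
  rfl

end SaddleShrink

end

noncomputable section

/-! ## Path components of the general linear group -/

section GeneralLinear

variable {n : ℕ}

lemma continuous_generalLinearGroup {Z : Type*} [TopologicalSpace Z] {f : Z → GL (Fin n) ℝ}
    (hf : Continuous fun z => (f z : Matrix (Fin n) (Fin n) ℝ)) : Continuous f := by
  refine Units.continuous_iff.2 ⟨hf, ?_⟩
  have h : (fun z => ((f z)⁻¹ : GL (Fin n) ℝ).val) = fun z =>
      (f z : Matrix (Fin n) (Fin n) ℝ).det⁻¹ • (f z : Matrix (Fin n) (Fin n) ℝ).adjugate := by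
    funext z
    rw [Matrix.coe_units_inv, Matrix.inv_def, Ring.inverse_eq_inv']
  rw [h]
  exact (hf.matrix_det.inv₀ fun z => ((Matrix.isUnit_iff_isUnit_det _).1 (f z).isUnit).ne_zero).smul
    hf.matrix_adjugate

lemma joined_generalLinearGroup {A : ℝ → Matrix (Fin n) (Fin n) ℝ} (hA : Continuous A)
    (hdet : ∀ t ∈ Icc (0 : ℝ) 1, (A t).det ≠ 0) {g h : GL (Fin n) ℝ} (h0 : A 0 = g) (h1 : A 1 = h) :
    Joined g h := by
  let f : unitInterval → GL (Fin n) ℝ := fun t =>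
    Matrix.GeneralLinearGroup.mkOfDetNeZero (A t) (hdet t t.2)
  have hf : Continuous f := continuous_generalLinearGroup (hA.comp continuous_subtype_val)
  exact ⟨⟨⟨f, hf⟩, Units.ext (by simpa [f] using h0), Units.ext (by simpa [f] using h1)⟩⟩

/-- The group of invertible matrices which are joined to the identity. -/
abbrev glOne (n : ℕ) : Subgroup (GL (Fin n) ℝ) := Subgroup.pathComponentOne (GL (Fin n) ℝ)

/-- Diagonal matrices with invertible entries. -/
def glDiag (n : ℕ) : (Fin n → ℝˣ) →* GL (Fin n) ℝ where
  toFun D := ⟨Matrix.diagonal fun i => (D i : ℝ), Matrix.diagonal fun i => ((D i)⁻¹ : ℝˣ).val,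
    by simp [Matrix.diagonal_mul_diagonal], by simp [Matrix.diagonal_mul_diagonal]⟩
  map_one' := Units.ext (by simp)
  map_mul' D D' := Units.ext (by simp [Matrix.diagonal_mul_diagonal])

lemma glDiag_val (D : Fin n → ℝˣ) :
    (glDiag n D : Matrix (Fin n) (Fin n) ℝ) = Matrix.diagonal fun i => (D i : ℝ) := rfl

/-- The reflection in the `i`-th coordinate. -/
def glRefl (i : Fin n) : GL (Fin n) ℝ := glDiag n (Pi.mulSingle i (-1))

lemma glRefl_mul_self (i : Fin n) : glRefl i * glRefl i = 1 := by
  rw [glRefl, ← map_mul, ← Pi.mulSingle_mul]; simp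

/-- An elementary matrix as an element of the general linear group. -/
def glTransvection {i j : Fin n} (hij : i ≠ j) (c : ℝ) : GL (Fin n) ℝ :=
  ⟨Matrix.transvection i j c, Matrix.transvection i j (-c),
    by rw [Matrix.transvection_mul_transvection_same _ _ hij]; simp,
    by rw [Matrix.transvection_mul_transvection_same _ _ hij]; simp⟩

lemma glTransvection_mem {i j : Fin n} (hij : i ≠ j) (c : ℝ) : glTransvection hij c ∈ glOne n := by
  refine joined_generalLinearGroup (A := fun t => Matrix.transvection i j (t * c)) ?_
    (fun t _ => by simp [Matrix.det_transvection_of_ne _ _ hij]) (by simp) (by simp [glTransvection])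
  unfold Matrix.transvection
  refine continuous_const.add ?_
  exact (continuous_matrix fun a b => by
    simp only [Matrix.single_apply]
    split_ifs <;> fun_prop)

/-- A product `q` of transvections, joined to the identity, conjugates one reflection into the
other. The product of the reflections is thus a conjugate of `q⁻¹` times `q`, and the identity
component is normal. -/
lemma glRefl_mul_mem (i j : Fin n) : glRefl i * glRefl j ∈ glOne n := by
  by_cases hij : i = j
  · subst hij; rw [glRefl_mul_self]; exact one_mem _
  -- The quarter turn in the `(i, j)`-plane, written as three transvections.
  set q : GL (Fin n) ℝ := glTransvection hij 1 * glTransvection (Ne.symm hij) (-1) *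
    glTransvection hij 1 with hq
  have hqm : q ∈ glOne n := mul_mem (mul_mem (glTransvection_mem _ _) (glTransvection_mem _ _))
    (glTransvection_mem _ _)
  have hr : ∀ k : Fin n, (glRefl k : Matrix (Fin n) (Fin n) ℝ) = 1 - 2 • Matrix.single k k 1 := by
    intro k
    ext a b
    rw [glRefl, glDiag_val]
    by_cases hab : a = b
    · subst hab
      by_cases hak : a = k
      · subst hak; simp; norm_num
      · simp [hak, Ne.symm hak]
    · rw [Matrix.diagonal_apply_ne _ hab]
      have : ¬ (k = a ∧ k = b) := fun h => hab (h.1.symm.trans h.2)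
      simp [Matrix.one_apply_ne hab, this]
  have hconj : glRefl i * q = q * glRefl j := by
    refine Units.ext ?_
    simp only [Units.val_mul, hr, hq]
    change (1 - 2 • Matrix.single i i 1) * (Matrix.transvection i j 1 * Matrix.transvection j i (-1) *
      Matrix.transvection i j 1) = (Matrix.transvection i j 1 * Matrix.transvection j i (-1) *
      Matrix.transvection i j 1) * (1 - 2 • Matrix.single j j 1)
    have hji := Ne.symm hij
    have hneg : Matrix.single j i (-1 : ℝ) = - Matrix.single j i (1 : ℝ) := by
      rw [← Matrix.single_neg]
    simp only [Matrix.transvection, hneg, mul_add, add_mul, mul_one, one_mul, sub_mul, mul_sub,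
      smul_mul_assoc, mul_smul_comm, Matrix.single_mul_single_same, mul_neg, neg_mul,
      Matrix.single_mul_single_of_ne _ _ _ _ hij, Matrix.single_mul_single_of_ne _ _ _ _ hji,
      add_zero, smul_zero, neg_zero]
    abel
  have h2 : glRefl i * glRefl j = (glRefl i * q⁻¹ * (glRefl i)⁻¹) * q := by
    have h3 : (glRefl i)⁻¹ = glRefl i := inv_eq_of_mul_eq_one_left (glRefl_mul_self i)
    have h4 : glRefl j = q⁻¹ * (glRefl i * q) := by rw [hconj]; group
    rw [h3, h4]
    simp only [mul_assoc]
  rw [h2]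
  exact mul_mem ((Subgroup.Normal.pathComponentOne _).conj_mem _ (inv_mem hqm) _) hqm

lemma det_glRefl (i : Fin n) : (glRefl i : Matrix (Fin n) (Fin n) ℝ).det = -1 := by
  rw [glRefl, glDiag_val, Matrix.det_diagonal, Finset.prod_eq_single i]
  · simp
  · intro j _ hj; simp [hj]
  · simp

variable [NeZero n]

/-- The matrices which are joined to the identity or to a reflection, according to the sign of the
determinant. -/
def glSigned (n : ℕ) [NeZero n] : Submonoid (GL (Fin n) ℝ) where
  carrier := {g | (0 < (g : Matrix (Fin n) (Fin n) ℝ).det → g ∈ glOne n) ∧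
    ((g : Matrix (Fin n) (Fin n) ℝ).det < 0 → glRefl 0 * g ∈ glOne n)}
  one_mem' := ⟨fun _ => one_mem _, fun h => by simp at h; linarith⟩
  mul_mem' := by
    rintro a b ⟨ha1, ha2⟩ ⟨hb1, hb2⟩
    have hN := Subgroup.Normal.pathComponentOne (GL (Fin n) ℝ)
    have hr : (glRefl (0 : Fin n))⁻¹ = glRefl 0 := inv_eq_of_mul_eq_one_left (glRefl_mul_self _)
    have hda := ((Matrix.isUnit_iff_isUnit_det _).1 a.isUnit).ne_zero
    have hdb := ((Matrix.isUnit_iff_isUnit_det _).1 b.isUnit).ne_zero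
    simp only [mem_ofPred_eq, Units.val_mul, Matrix.det_mul]
    rcases hda.lt_or_gt with ha | ha <;> rcases hdb.lt_or_gt with hb | hb
    · refine ⟨fun _ => ?_, fun h => absurd (mul_pos_of_neg_of_neg ha hb) h.not_gt⟩
      have h := mul_mem (hN.conj_mem _ (ha2 ha) (glRefl 0)) (hb2 hb)
      rw [hr] at h
      convert h using 1
      have h1 := glRefl_mul_self (0 : Fin n)
      calc a * b = (glRefl 0 * glRefl 0) * a * (glRefl 0 * glRefl 0) * b := by rw [h1]; simp
        _ = _ := by simp only [mul_assoc]
    · refine ⟨fun h => absurd (mul_neg_of_neg_of_pos ha hb) h.not_gt, fun _ => ?_⟩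
      rw [← mul_assoc]
      exact mul_mem (ha2 ha) (hb1 hb)
    · refine ⟨fun h => absurd (mul_neg_of_pos_of_neg ha hb) h.not_gt, fun _ => ?_⟩
      have h := mul_mem (hN.conj_mem _ (ha1 ha) (glRefl 0)) (hb2 hb)
      rw [hr] at h
      convert h using 1
      have h1 := glRefl_mul_self (0 : Fin n)
      calc glRefl 0 * (a * b) = glRefl 0 * a * (glRefl 0 * glRefl 0) * b := by
            rw [h1]; simp [mul_assoc]
        _ = _ := by simp only [mul_assoc]
    · exact ⟨fun _ => mul_mem (ha1 ha) (hb1 hb), fun h => absurd (mul_pos ha hb) h.not_gt⟩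

lemma glSigned_of_mem_glOne {g : GL (Fin n) ℝ} (hg : g ∈ glOne n)
    (hdet : 0 < (g : Matrix (Fin n) (Fin n) ℝ).det) : g ∈ glSigned n :=
  ⟨fun _ => hg, fun h => absurd hdet h.not_gt⟩

lemma glDiag_mulSingle_mem (i : Fin n) {δ : ℝˣ} (hδ : 0 < (δ : ℝ)) :
    glDiag n (Pi.mulSingle i δ) ∈ glSigned n := by
  have hdet : ∀ δ : ℝˣ, (glDiag n (Pi.mulSingle i δ) : Matrix (Fin n) (Fin n) ℝ).det = δ := by
    intro δ
    rw [glDiag_val, Matrix.det_diagonal, Finset.prod_eq_single i]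
    · simp
    · intro j _ hj; simp [hj]
    · simp
  refine glSigned_of_mem_glOne ?_ (by rw [hdet]; exact hδ)
  refine joined_generalLinearGroup
    (A := fun t => Matrix.diagonal fun j => if j = i then 1 + t * ((δ : ℝ) - 1) else 1) ?_ ?_ ?_ ?_
  · exact Continuous.matrix_diagonal (continuous_pi fun j => by split_ifs <;> fun_prop)
  · intro t ht
    rw [Matrix.det_diagonal, Finset.prod_ne_zero_iff]
    intro j _
    split_ifs
    · have h1 := ht.1
      have h2 := ht.2
      rcases h1.eq_or_lt with rfl | h0
      · simp
      · have h3 := mul_pos h0 hδ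
        intro h4
        nlinarith
    · exact one_ne_zero
  · simp
  · rw [glDiag_val]
    congr 1
    funext j
    by_cases h : j = i
    · subst h; simp
    · simp [h]

/-- Invertible matrices are products of transvections and diagonal matrices, diagonal ones are
products of single entries, and a negative entry is a reflection times a positive one. -/
lemma mem_glSigned (g : GL (Fin n) ℝ) : g ∈ glSigned n := by
  have hrefl : ∀ i : Fin n, glRefl i ∈ glSigned n := fun i =>
    ⟨fun h => by rw [det_glRefl] at h; linarith, fun _ => glRefl_mul_mem 0 i⟩
  have hsingle : ∀ (i : Fin n) (δ : ℝˣ), glDiag n (Pi.mulSingle i δ) ∈ glSigned n := by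
    intro i δ
    rcases δ.ne_zero.lt_or_gt with h | h
    · have h1 : glDiag n (Pi.mulSingle i δ) = glRefl i * glDiag n (Pi.mulSingle i (-δ)) := by
        rw [glRefl, ← map_mul, ← Pi.mulSingle_mul]; simp
      rw [h1]
      exact mul_mem (hrefl i) (glDiag_mulSingle_mem i (by simpa using h))
    · exact glDiag_mulSingle_mem i h
  refine Matrix.diagonal_transvection_induction_of_det_ne_zero
    (fun M => ∀ g : GL (Fin n) ℝ, (g : Matrix (Fin n) (Fin n) ℝ) = M → g ∈ glSigned n) g
    ((Matrix.isUnit_iff_isUnit_det _).1 g.isUnit).ne_zero ?_ ?_ ?_ g rfl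
  · intro D hD g hg
    rw [Matrix.det_diagonal, Finset.prod_ne_zero_iff] at hD
    have h : g = glDiag n fun i => Units.mk0 (D i) (hD i (Finset.mem_univ i)) :=
      Units.ext (by rw [hg, glDiag_val]; rfl)
    rw [h, ← Submonoid.mem_comap, ← Finset.univ_prod_mulSingle
      (fun i => Units.mk0 (D i) (hD i (Finset.mem_univ i)))]
    exact Submonoid.prod_mem _ fun i _ => hsingle i _
  · rintro ⟨i, j, hij, c⟩ g hg
    have h : g = glTransvection hij c := Units.ext hg
    rw [h]
    exact glSigned_of_mem_glOne (glTransvection_mem hij c)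
      (by simp [glTransvection, Matrix.det_transvection_of_ne _ _ hij])
  · intro A B hA hB hPA hPB g hg
    have h : g = Matrix.GeneralLinearGroup.mkOfDetNeZero A hA *
        Matrix.GeneralLinearGroup.mkOfDetNeZero B hB := Units.ext hg
    rw [h]
    exact mul_mem (hPA _ rfl) (hPB _ rfl)

section Action

variable {Θ : Type*} [TopologicalSpace Θ] [StableGLAction Θ]

open StableGLAction

lemma continuous_act_left (n : ℕ) (θ : Θ) : Continuous fun g : GL (Fin n) ℝ => act n θ g :=
  (continuous_act n).comp (continuous_const.prodMk continuous_id)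

lemma glRefl_val (n : ℕ) [NeZero n] : (glRefl (0 : Fin n) : Matrix (Fin n) (Fin n) ℝ) =
    Matrix.diagonal fun k : Fin n => if (k : ℕ) = 0 then -1 else 1 := by
  rw [glRefl, glDiag_val]
  congr 1
  funext k
  by_cases h : k = 0
  · subst h; simp
  · have : (k : ℕ) ≠ 0 := fun h' => h (Fin.ext (by simpa using h'))
    simp [h, this]

/-- The reflection is in the first coordinate, while stabilization appends a last one. The action of
the reflection on `Θ` is therefore independent of `n`. -/
lemma glStab_glRefl {n : ℕ} [NeZero n] :
    glStab n (glRefl (0 : Fin n)) = glRefl (0 : Fin (n + 1)) := by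
  refine Units.ext ?_
  change matrixStab n (glRefl (0 : Fin n)).val = _
  have h0 : n ≠ 0 := NeZero.ne n
  ext a b
  simp only [matrixStab, MonoidHom.coe_mk, OneHom.coe_mk, Matrix.submatrix_apply, glRefl_val]
  refine Fin.lastCases ?_ (fun a => ?_) a <;> refine Fin.lastCases ?_ (fun b => ?_) b
  · simp [h0]
  · rw [Matrix.diagonal_apply_ne _ (Fin.castSucc_lt_last b).ne']
    simp
  · rw [Matrix.diagonal_apply_ne _ (Fin.castSucc_lt_last a).ne]
    simp
  · by_cases hab : a = b
    · subst hab; simp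
    · rw [Matrix.diagonal_apply_ne _ fun h => hab (Fin.castSucc_injective _ h)]
      simp [hab]

lemma act_glRefl_succ (m : ℕ) (θ : Θ) : act (m + 1) θ (glRefl 0) = act 1 θ (glRefl 0) := by
  induction m with
  | zero => rfl
  | succ m ih =>
    have h1 := act_stab (m + 1) θ (glRefl 0)
    rw [glStab_glRefl] at h1
    exact h1.trans ih

lemma act_glRefl (n : ℕ) [NeZero n] (θ : Θ) : act n θ (glRefl 0) = act 1 θ (glRefl 0) := by
  cases n with
  | zero => exact absurd rfl (NeZero.ne 0)
  | succ m => exact act_glRefl_succ m θ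

lemma joined_act {n : ℕ} [NeZero n] (θ : Θ) {g : GL (Fin n) ℝ}
    (hg : 0 < (g : Matrix (Fin n) (Fin n) ℝ).det) : Joined (act n θ g) θ := by
  have h := ((mem_glSigned g).1 hg : Joined 1 g).map (continuous_act_left n θ)
  rw [act_one] at h
  exact h.symm

lemma joined_act_refl {n : ℕ} [NeZero n] (θ : Θ) {g : GL (Fin n) ℝ}
    (hg : (g : Matrix (Fin n) (Fin n) ℝ).det < 0) :
    Joined (act n θ g) (act 1 θ (glRefl 0)) := by
  have h := ((mem_glSigned g).2 hg : Joined 1 (glRefl 0 * g)).map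
    (continuous_act_left n (act n θ (glRefl 0)))
  rw [act_one, ← act_mul, ← mul_assoc, glRefl_mul_self, one_mul, act_glRefl] at h
  exact h.symm

/-- Up to a reflection, any two points of `Θ` can be joined. -/
lemma joined_or_joined_refl (hΘ : PiZeroTransitive Θ) (θ θ' : Θ) :
    Joined θ θ' ∨ Joined (act 1 θ (glRefl 0)) θ' := by
  obtain ⟨n, g, hg⟩ := hΘ θ θ'
  rcases n with _ | n
  · have h : g = 1 := Subsingleton.elim _ _
    rw [h, act_one] at hg
    exact Or.inl hg
  · rcases ((Matrix.isUnit_iff_isUnit_det _).1 g.isUnit).ne_zero.lt_or_gt with h | h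
    · exact Or.inr ((joined_act_refl θ h).symm.trans hg)
    · exact Or.inl ((joined_act θ h).symm.trans hg)

/-- The matrix of a bijective endomorphism. -/
def endoGL {n : ℕ} (f : Euc n →L[ℝ] Euc n) (hf : Function.Bijective f) : GL (Fin n) ℝ :=
  Units.map (Matrix.toEuclideanCLM (n := Fin n) (𝕜 := ℝ)).symm.toMulEquiv.toMonoidHom
    (ContinuousLinearMap.isUnit_iff_bijective.2 hf).unit

lemma endoGL_val {n : ℕ} (f : Euc n →L[ℝ] Euc n) (hf : Function.Bijective f) :
    (endoGL f hf : Matrix (Fin n) (Fin n) ℝ) =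
      (Matrix.toEuclideanCLM (n := Fin n) (𝕜 := ℝ)).symm f := rfl

lemma endoGL_mul {n : ℕ} (f g h : Euc n →L[ℝ] Euc n) (hf : Function.Bijective f)
    (hg : Function.Bijective g) (hh : Function.Bijective h) (hfg : h = f * g) :
    endoGL h hh = endoGL f hf * endoGL g hg := by
  subst hfg
  exact Units.ext (by rw [Units.val_mul, endoGL_val, endoGL_val, endoGL_val, map_mul])

lemma endoGL_toEuclideanCLM {n : ℕ} (g : GL (Fin n) ℝ) :
    endoGL (Matrix.toEuclideanCLM (n := Fin n) (𝕜 := ℝ) (g : Matrix (Fin n) (Fin n) ℝ))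
      (toEuclideanCLM_bijective g) = g :=
  Units.ext (by rw [endoGL_val, StarAlgEquiv.symm_apply_apply])

lemma continuous_endoGL {n : ℕ} {Z : Type*} [TopologicalSpace Z] {f : Z → Euc n →L[ℝ] Euc n}
    (hf : Continuous f) (hb : ∀ z, Function.Bijective (f z)) :
    Continuous fun z => endoGL (f z) (hb z) := by
  refine continuous_generalLinearGroup ?_
  have h : Continuous ((Matrix.toEuclideanCLM (n := Fin n) (𝕜 := ℝ)).symm.toAlgEquiv.toLinearMap) :=
    LinearMap.continuous_of_finiteDimensional _
  exact h.comp hf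

/-- The `Θ`-orientation of `ℝⁿ` with given values on the standard frames. -/
def EucThetaOrientation.ofMap {n : ℕ} (θ : C(Euc n, Θ)) : EucThetaOrientation n Θ where
  toMap := ⟨fun y : EucFrame n => act n (θ y.base) (endoGL y.endo y.endo_bijective),
    (continuous_act n).comp ((θ.continuous.comp EucFrame.continuous_base).prodMk
      (continuous_endoGL EucFrame.continuous_endo EucFrame.endo_bijective))⟩
  equivariant y g := by
    have h := endoGL_mul (EucFrame.endo y) _ (EucFrame.endo (y.rightMul g)) (EucFrame.endo_bijective y)
      (toEuclideanCLM_bijective g) (EucFrame.endo_bijective _) rfl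
    rw [endoGL_toEuclideanCLM] at h
    change act n (θ y.base) (endoGL (EucFrame.endo (y.rightMul g)) _) =
      act n (act n (θ y.base) (endoGL (EucFrame.endo y) (EucFrame.endo_bijective y))) g
    rw [← act_mul, h]

end Action

end GeneralLinear

end

noncomputable section

/-! ## Constructing `Θ`-orientations of `ℝ^{d+1}` -/

section Extension

variable {d : ℕ} {Θ : Type*} [TopologicalSpace Θ]

/-- The retraction of Euclidean space onto the disk. -/
def diskRetract (x : Euc d) : Disk d :=
  ⟨(max 1 ‖x‖)⁻¹ • x, by
    have h : 0 < max 1 ‖x‖ := lt_max_of_lt_left one_pos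
    rw [mem_closedBall_zero_iff, norm_smul, norm_inv, Real.norm_of_nonneg h.le,
      inv_mul_le_iff₀ h, mul_one]
    exact le_max_right _ _⟩

lemma continuous_diskRetract : Continuous (diskRetract : Euc d → Disk d) := by
  refine Continuous.subtype_mk (Continuous.smul (Continuous.inv₀
    (continuous_const.max continuous_norm) fun x => ?_) continuous_id) _
  exact (lt_max_of_lt_left one_pos).ne'

@[simp] lemma diskRetract_coe (x : Disk d) : diskRetract (x : Euc d) = x := by
  have h : ‖(x : Euc d)‖ ≤ 1 := mem_closedBall_zero_iff.1 x.2
  exact Subtype.ext (by simp [diskRetract, max_eq_left h])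

/-- Functions on the two components of the thickened sphere whose values at the centers can be
joined extend to `ℝ^{d+1}`. -/
lemma exists_extension_saddlePoint {θ : ℤˣ → Disk d → Θ} (hθ : ∀ s, Continuous (θ s))
    (hj : Joined (θ 1 (diskCenter d)) (θ (-1) (diskCenter d))) :
    ∃ ω' : C(Euc (d + 1), Θ), ∀ s (x : Disk d), ω' (saddlePoint s (x : Euc d)) = θ s x := by
  obtain ⟨γ⟩ := hj
  -- As `|v₋|` falls from 1 to `1/2` the disk is contracted to its centre; the strip `|v₋| ≤ 1/2`
  -- runs along the path `γ` between the two central values.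
  let μ : Euc (d + 1) → ℝ := fun v => max 0 (min 1 (2 * |eucLast d v| - 1))
  let r : Euc (d + 1) → Disk d := fun v => diskRetract (μ v • saddleCoord v)
  have hμ : Continuous μ := by unfold μ; fun_prop
  have hr : Continuous r := continuous_diskRetract.comp (hμ.smul continuous_saddleCoord)
  have hr0 : ∀ v, |eucLast d v| = 1 / 2 → r v = diskCenter d := fun v hv => by
    have : μ v = 0 := by simp [μ, hv]
    have h0 : diskRetract (((diskCenter d : Disk d) : Euc d)) = diskCenter d := diskRetract_coe _
    simpa [r, this, diskCenter] using h0
  have hl : Continuous fun v : Euc (d + 1) => eucLast d v := (eucLast d).continuous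
  let h₁ : Euc (d + 1) → Θ := fun v =>
    if 1 / 2 ≤ eucLast d v then θ 1 (r v) else γ.extend (1 / 2 - eucLast d v)
  have hh₁ : Continuous h₁ := by
    refine Continuous.if_le ((hθ 1).comp hr) (γ.continuous_extend.comp (continuous_const.sub hl))
      continuous_const hl fun v hv => ?_
    rw [hr0 v (by rw [← hv]; norm_num), ← hv]
    simp
  let h₂ : Euc (d + 1) → Θ := fun v =>
    if eucLast d v ≤ -(1 / 2) then θ (-1) (r v) else h₁ v
  have hh₂ : Continuous h₂ := by
    refine Continuous.if_le ((hθ (-1)).comp hr) hh₁ hl continuous_const fun v hv => ?_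
    rw [hr0 v (by rw [hv]; norm_num)]
    have h : ¬ (1 / 2 ≤ eucLast d v) := by rw [hv]; norm_num
    simp only [h₁, if_neg h, hv]
    norm_num
  refine ⟨⟨h₂, hh₂⟩, fun s x => ?_⟩
  have h1 := one_le_saddleRadius (x : Euc d)
  have hrx : r (saddlePoint s (x : Euc d)) = x := by
    have : μ (saddlePoint s (x : Euc d)) = 1 := by
      simp only [μ, abs_eucLast_saddlePoint]
      rw [min_eq_left (by linarith), max_eq_right zero_le_one]
    simp [r, this]
  change h₂ _ = _
  rcases Int.units_eq_one_or s with rfl | rfl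
  · have hs : eucLast d (saddlePoint 1 (x : Euc d)) = saddleRadius (x : Euc d) := by
      simp [saddlePoint]
    simp only [h₂, h₁, hrx, hs]
    rw [if_neg (by linarith), if_pos (by linarith)]
  · have hs : eucLast d (saddlePoint (-1) (x : Euc d)) = -saddleRadius (x : Euc d) := by
      simp [saddlePoint]
    simp only [h₂, hrx, hs]
    rw [if_pos (by linarith)]

end Extension

/-! ### Orienting `ℝ^{d+1}` compatibly with an embedded thickened sphere -/

section Frames

variable {d : ℕ} [NeZero d] {M : Type*} [TopologicalSpace M]
  [ChartedSpace (EuclideanHalfSpace d) M] [IsManifold (𝓡∂ d) ∞ M]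

lemma inCoordinates_trivial_apply (b x : M) (f : Euc d →L[ℝ] TangentSpace (𝓡∂ d) x) (w : Euc d)
    (hx : x ∈ (trivializationAt (Euc d) (fun p : M => TangentSpace (𝓡∂ d) p) b).baseSet) :
    ContinuousLinearMap.inCoordinates (Euc d) (Bundle.Trivial M (Euc d)) (Euc d)
      (fun p : M => TangentSpace (𝓡∂ d) p) b x b x f w =
        (trivializationAt (Euc d) (fun p : M => TangentSpace (𝓡∂ d) p) b ⟨x, f w⟩).2 := by
  have h3 : Bundle.Trivialization.symmL ℝ (trivializationAt (Euc d) (Bundle.Trivial M (Euc d)) b) x =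
      ContinuousLinearMap.id ℝ (Euc d) := Bundle.Trivial.symmL_trivialization ℝ M (Euc d) x
  unfold ContinuousLinearMap.inCoordinates
  rw [h3]
  exact congrFun ((trivializationAt (Euc d) (fun p : M => TangentSpace (𝓡∂ d) p)
    b).coe_linearMapAt_of_mem (R := ℝ) hx) (f w)

namespace SphereEmbedding

/-- The image of the standard frame of the disk. -/
def stdFrame {T : Type} (e : SphereEmbedding d M T) (t : T) (s : ℤˣ) (x : Disk d) :
    FrameBundle d (Euc d) (fun p : M => TangentSpace (𝓡∂ d) p) :=
  e.frame t s x (ContinuousLinearEquiv.refl ℝ (Euc d))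

/-- Applied to a fixed vector `w`, the frame is the tangent map evaluated on a constant vector
field, and tangent maps of smooth maps are continuous. -/
lemma continuous_stdFrame {T : Type} (e : SphereEmbedding d M T) (t : T) (s : ℤˣ) :
    Continuous (e.stdFrame t s) := by
  refine Continuous.subtype_mk (continuous_iff_continuousAt.2 fun x => ?_) _
  have hT : ContinuousOn (tangentMapWithin 𝓘(ℝ, Euc d) (𝓡∂ d) (diskExtend (e.toFun t s)) (Disk d))
      (Bundle.TotalSpace.proj ⁻¹' (Disk d)) :=
    (e.smooth t s).continuousOn_tangentMapWithin (by simp)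
      (uniqueDiffOn_disk d).uniqueMDiffOn
  have hb : Continuous fun y : Disk d => diskExtend (e.toFun t s) (y : Euc d) := by
    simpa using e.continuous_toFun t s
  refine (continuousAt_hom_bundle (RingHom.id ℝ) _).2 ⟨hb.continuousAt, ?_⟩
  rw [continuousAt_clm_apply]
  intro w
  have hw : ContinuousAt (fun y : Disk d => tangentMapWithin 𝓘(ℝ, Euc d) (𝓡∂ d)
      (diskExtend (e.toFun t s)) (Disk d) ⟨(y : Euc d), w⟩) x := by
    have h1 : Continuous fun y : Disk d =>
        (⟨(y : Euc d), w⟩ : TangentBundle 𝓘(ℝ, Euc d) (Euc d)) :=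
      (tangentBundleModelSpaceHomeomorph 𝓘(ℝ, Euc d)).symm.continuous.comp
        (continuous_subtype_val.prodMk continuous_const)
    exact (hT.comp_continuous h1 fun y => y.2).continuousAt
  have h2 := ((FiberBundle.continuousAt_totalSpace (Euc d) _).1 hw).2
  have hmem := hb.continuousAt.eventually_mem (((trivializationAt (Euc d)
    (fun p : M => TangentSpace (𝓡∂ d) p) (diskExtend (e.toFun t s) (x : Euc d))).open_baseSet).mem_nhds
      (FiberBundle.mem_baseSet_trivializationAt' _))
  exact h2.congr (hmem.mono fun y hy => (inCoordinates_trivial_apply _ _ _ w hy).symm)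

end SphereEmbedding

open StableGLAction

variable {Θ : Type*} [TopologicalSpace Θ] [StableGLAction Θ]

lemma toEuclideanCLM_glStab {d : ℕ} (g : GL (Fin d) ℝ) (w : Euc (d + 1)) :
    Matrix.toEuclideanCLM (n := Fin (d + 1)) (𝕜 := ℝ) (glStab d g).val w =
      eucSnoc (Matrix.toEuclideanCLM (n := Fin d) (𝕜 := ℝ) g.val (eucInit d w)) (eucLast d w) := by
  have hval : (glStab d g).val = matrixStab d g.val := rfl
  rw [hval]
  ext i
  rw [Matrix.ofLp_toEuclideanCLM, Matrix.mulVec, dotProduct, Fin.sum_univ_castSucc]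
  refine Fin.lastCases ?_ (fun i => ?_) i
  · simp [matrixStab, eucSnoc, eucLast]
  · simp [matrixStab, eucSnoc, eucInit, Matrix.mulVec, dotProduct]

/-- The matrix of a linear automorphism. -/
def equivGL (f : Euc d ≃L[ℝ] Euc d) : GL (Fin d) ℝ := endoGL (f : Euc d →L[ℝ] Euc d) f.bijective

lemma toEuclideanCLM_equivGL {d : ℕ} (f : Euc d ≃L[ℝ] Euc d) :
    Matrix.toEuclideanCLM (n := Fin d) (𝕜 := ℝ) (equivGL f).val = f :=
  (Matrix.toEuclideanCLM (n := Fin d) (𝕜 := ℝ)).apply_symm_apply (f : Euc d →L[ℝ] Euc d)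

/-- A change of frame of the disk acts as `f ⊕ 1` on the frame extended by `ν`. Compatibility with
stabilization then identifies the actions on `Θ` in dimensions `d` and `d + 1`. -/
lemma endoGL_saddleFrameMap {d : ℕ} (s : ℤˣ) (x : Euc d) (f : Euc d ≃L[ℝ] Euc d) :
    endoGL (saddleFrameMap s x f) (saddleFrameMap_bijective s x f) =
      endoGL (saddleFrameMap s x (ContinuousLinearEquiv.refl ℝ (Euc d)))
        (saddleFrameMap_bijective s x _) *
        glStab d (equivGL f) := by
  refine (endoGL_mul _ _ _ _ (toEuclideanCLM_bijective _) _ ?_).trans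
    (congrArg _ (endoGL_toEuclideanCLM (glStab d (equivGL f))))
  ext1 w
  rw [mul_apply_eq_comp, toEuclideanCLM_glStab, toEuclideanCLM_equivGL]
  simp [saddleFrameMap]

namespace SphereEmbedding

variable {T : Type} (e : SphereEmbedding d M T) (oM : TangentThetaOrientation d M Θ)

/-- The value which a `Θ`-orientation of `ℝ^{d+1}` needs to have on the standard frame at the points
of the thickened sphere. -/
def frameValue (t : T) (s : ℤˣ) (x : Disk d) : Θ :=
  act (d + 1) (oM.toMap (e.stdFrame t s x))
    (endoGL (saddleFrameMap s (x : Euc d) (ContinuousLinearEquiv.refl ℝ (Euc d)))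
      (saddleFrameMap_bijective s (x : Euc d) _))⁻¹

lemma saddleFrameMap_refl {d : ℕ} (s : ℤˣ) (x : Euc d) :
    saddleFrameMap s x (ContinuousLinearEquiv.refl ℝ (Euc d)) = saddleLin s 1 x := by
  ext1 w
  simp [saddleFrameMap, saddleLin]

lemma continuous_frameValue (t : T) (s : ℤˣ) : Continuous (e.frameValue oM t s) := by
  refine (continuous_act (d + 1)).comp
    ((oM.toMap.continuous.comp (e.continuous_stdFrame t s)).prodMk (Continuous.inv ?_))
  refine continuous_endoGL ?_ _
  simp only [saddleFrameMap_refl]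
  exact (continuous_saddleLin s).comp (continuous_const.prodMk continuous_subtype_val)

lemma stdFrame_rightMul (t : T) (s : ℤˣ) (x : Disk d) (f : Euc d ≃L[ℝ] Euc d) :
    (e.stdFrame t s x).rightMul (equivGL f) = e.frame t s x f := by
  refine frameBundle_mk_congr rfl ?_ _ _
  rw [toEuclideanCLM_equivGL]
  rfl

/-- By equivariance only standard frames matter. The required values on `D^d × S^0` extend over
`ℝ^{d+1}` once the two central values are joined. -/
lemma exists_thetaOrientation {t : T}
    (h : Joined (e.frameValue oM t 1 (diskCenter d)) (e.frameValue oM t (-1) (diskCenter d))) :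
    ∃ o : EucThetaOrientation (d + 1) Θ, ∀ (s : ℤˣ) (x : Disk d) (f : Euc d ≃L[ℝ] Euc d),
      oM.toMap (e.frame t s x f) = o.toMap (saddleFrame s (x : Euc d) f) := by
  obtain ⟨θ, hθ⟩ := exists_extension_saddlePoint (fun s => e.continuous_frameValue oM t s) h
  refine ⟨EucThetaOrientation.ofMap θ, fun s x f => ?_⟩
  have h1 : (EucThetaOrientation.ofMap θ).toMap (saddleFrame s (x : Euc d) f) =
      act (d + 1) (θ (saddlePoint s (x : Euc d)))
        (endoGL (saddleFrameMap s (x : Euc d) f) (saddleFrameMap_bijective s (x : Euc d) f)) := rfl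
  rw [h1, hθ, frameValue, ← act_mul, endoGL_saddleFrameMap s (x : Euc d) f, inv_mul_cancel_left, act_stab,
    ← oM.equivariant, stdFrame_rightMul]

/-- Moving the reflection past `B` replaces it by a conjugate, which still has determinant `-1`. -/
lemma joined_act_reflect (θ : Θ) (B : GL (Fin (d + 1)) ℝ) :
    Joined (act (d + 1) (act d θ (glRefl 0)) B) (act 1 (act (d + 1) θ B) (glRefl 0)) := by
  rw [← act_stab d, glStab_glRefl, ← act_mul]
  have h : glRefl 0 * B = B * (B⁻¹ * glRefl 0 * B) := by group
  rw [h, act_mul]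
  refine joined_act_refl _ ?_
  rw [Units.val_mul, Units.val_mul, Matrix.det_mul, Matrix.det_mul, mul_right_comm, ← Matrix.det_mul,
    ← Units.val_mul, inv_mul_cancel, Units.val_one, Matrix.det_one, one_mul, det_glRefl]
  norm_num

end SphereEmbedding

end Frames

end

noncomputable section

/-! ## Disjoint embedded disks -/

section Disks

variable {d : ℕ} [NeZero d] {M : Type*} [TopologicalSpace M]
  [ChartedSpace (EuclideanHalfSpace d) M]

/-- The disk around the point `z` of the chart at `p`. -/
def chartDisk (p : M) (z : Euc d) (r : ℝ) (R : Euc d ≃ₗᵢ[ℝ] Euc d) (x : Disk d) : M :=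
  (extChartAt (𝓡∂ d) p).symm (z + r • R x)

lemma add_smul_mem_closedBall {d : ℕ} {z : Euc d} {r : ℝ} (hr : 0 ≤ r) (R : Euc d ≃ₗᵢ[ℝ] Euc d)
    {x : Euc d} (hx : x ∈ Disk d) : z + r • R x ∈ Metric.closedBall z r := by
  rw [mem_closedBall_zero_iff] at hx
  rw [Metric.mem_closedBall, dist_self_add_left, norm_smul, Real.norm_of_nonneg hr, R.norm_map]
  exact mul_le_of_le_one_right hr hx

lemma diskExtend_chartDisk (p : M) (z : Euc d) (r : ℝ) (R : Euc d ≃ₗᵢ[ℝ] Euc d) {x : Euc d}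
    (hx : x ∈ Disk d) :
    diskExtend (chartDisk p z r R) x = (extChartAt (𝓡∂ d) p).symm (z + r • R x) :=
  diskExtend_of_mem _ hx

/-- The derivative of the inverse of a chart. -/
def chartSymmDeriv (p : M) (w : Euc d) : Euc d →L[ℝ] Euc d :=
  mfderivWithin 𝓘(ℝ, Euc d) (𝓡∂ d) (extChartAt (𝓡∂ d) p).symm (range (𝓡∂ d)) w

variable {p : M} {z : Euc d} {r : ℝ}

lemma contMDiffOn_chartDisk [IsManifold (𝓡∂ d) ∞ M] (hr : 0 < r)
    (hB : Metric.closedBall z r ⊆ interior (extChartAt (𝓡∂ d) p).target) (R : Euc d ≃ₗᵢ[ℝ] Euc d) :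
    ContMDiffOn 𝓘(ℝ, Euc d) (𝓡∂ d) ∞ (diskExtend (chartDisk p z r R)) (Disk d) := by
  have h1 : ContMDiffOn 𝓘(ℝ, Euc d) 𝓘(ℝ, Euc d) ∞ (fun x : Euc d => z + r • R x) (Disk d) :=
    ContDiff.contMDiff (contDiff_const.add (R.contDiff.const_smul r)) |>.contMDiffOn
  have h2 : MapsTo (fun x : Euc d => z + r • R x) (Disk d) (extChartAt (𝓡∂ d) p).target :=
    fun x hx => interior_subset (hB (add_smul_mem_closedBall hr.le R hx))
  exact ((contMDiffOn_extChartAt_symm p).comp h1 h2).congr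
    fun x hx => diskExtend_chartDisk p z r R hx

lemma diskDeriv_chartDisk [IsManifold (𝓡∂ d) ∞ M] (hr : 0 < r)
    (hB : Metric.closedBall z r ⊆ interior (extChartAt (𝓡∂ d) p).target) (R : Euc d ≃ₗᵢ[ℝ] Euc d)
    {x : Euc d} (hx : x ∈ Disk d) :
    diskDeriv (chartDisk p z r R) x =
      (chartSymmDeriv p (z + r • R x)).comp (r • (R.toContinuousLinearEquiv : Euc d →L[ℝ] Euc d)) := by
  have hmem := hB (add_smul_mem_closedBall hr.le R hx)
  have h1 : HasFDerivAt (fun x : Euc d => z + r • R x)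
      (r • (R.toContinuousLinearEquiv : Euc d →L[ℝ] Euc d)) x :=
    ((R.toContinuousLinearEquiv : Euc d →L[ℝ] Euc d).hasFDerivAt.const_smul r).const_add z
  have h2 : HasMFDerivWithinAt 𝓘(ℝ, Euc d) 𝓘(ℝ, Euc d) (fun x : Euc d => z + r • R x) (Disk d) x
      (r • (R.toContinuousLinearEquiv : Euc d →L[ℝ] Euc d)) :=
    h1.hasFDerivWithinAt.hasMFDerivWithinAt
  have h3 : HasMFDerivWithinAt 𝓘(ℝ, Euc d) (𝓡∂ d) (extChartAt (𝓡∂ d) p).symm (range (𝓡∂ d))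
      (z + r • R x) (chartSymmDeriv p (z + r • R x)) :=
    (mdifferentiableWithinAt_extChartAt_symm (interior_subset hmem)).hasMFDerivWithinAt
  have hmaps : Disk d ⊆ (fun x : Euc d => z + r • R x) ⁻¹' range (𝓡∂ d) := fun y hy =>
    extChartAt_target_subset_range (I := 𝓡∂ d) p
      (interior_subset (hB (add_smul_mem_closedBall hr.le R hy)))
  have h4 : HasMFDerivWithinAt 𝓘(ℝ, Euc d) (𝓡∂ d)
      ((extChartAt (𝓡∂ d) p).symm ∘ fun x : Euc d => z + r • R x) (Disk d) x
      ((chartSymmDeriv p (z + r • R x)).comp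
        (r • (R.toContinuousLinearEquiv : Euc d →L[ℝ] Euc d))) :=
    h3.comp x h2 hmaps
  have h5 := h4.congr_of_eventuallyEq (f₁ := diskExtend (chartDisk p z r R))
    (Filter.eventually_of_mem self_mem_nhdsWithin fun y hy => diskExtend_chartDisk p z r R hy)
    (diskExtend_chartDisk p z r R hx)
  exact h5.mfderivWithin (uniqueDiffOn_disk d x hx).uniqueMDiffWithinAt

lemma diskDeriv_chartDisk_injective [IsManifold (𝓡∂ d) ∞ M] (hr : 0 < r)
    (hB : Metric.closedBall z r ⊆ interior (extChartAt (𝓡∂ d) p).target) (R : Euc d ≃ₗᵢ[ℝ] Euc d)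
    {x : Euc d} (hx : x ∈ Disk d) :
    Function.Injective (diskDeriv (chartDisk p z r R) x) := by
  rw [diskDeriv_chartDisk hr hB R hx]
  have hmem := hB (add_smul_mem_closedBall hr.le R hx)
  have h1 : Function.Injective (chartSymmDeriv p (z + r • R x)) :=
    (isInvertible_mfderivWithin_extChartAt_symm (I := 𝓡∂ d) (interior_subset hmem)).injective
  exact h1.comp ((smul_right_injective _ hr.ne').comp R.injective)

lemma chartDisk_mem_source (hr : 0 < r)
    (hB : Metric.closedBall z r ⊆ interior (extChartAt (𝓡∂ d) p).target) (R : Euc d ≃ₗᵢ[ℝ] Euc d)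
    (x : Disk d) :
    chartDisk p z r R x ∈ (extChartAt (𝓡∂ d) p).source :=
  (extChartAt (𝓡∂ d) p).map_target (interior_subset (hB (add_smul_mem_closedBall hr.le R x.2)))

lemma extChartAt_chartDisk (hr : 0 < r)
    (hB : Metric.closedBall z r ⊆ interior (extChartAt (𝓡∂ d) p).target) (R : Euc d ≃ₗᵢ[ℝ] Euc d)
    (x : Disk d) :
    extChartAt (𝓡∂ d) p (chartDisk p z r R x) = z + r • R x :=
  (extChartAt (𝓡∂ d) p).right_inv (interior_subset (hB (add_smul_mem_closedBall hr.le R x.2)))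

lemma chartDisk_mem_interior [IsManifold (𝓡∂ d) ∞ M] (hr : 0 < r)
    (hB : Metric.closedBall z r ⊆ interior (extChartAt (𝓡∂ d) p).target) (R : Euc d ≃ₗᵢ[ℝ] Euc d)
    (x : Disk d) : chartDisk p z r R x ∈ (𝓡∂ d).interior M := by
  have h := chartDisk_mem_source hr hB R x
  have h2 := extChartAt_chartDisk hr hB R x
  refine ((𝓡∂ d).isInteriorPoint_iff_of_mem_atlas (n := ∞) (by simp) (chart_mem_atlas _ p)
    (by rwa [extChartAt_source] at h)).2 ?_
  have h3 := hB (add_smul_mem_closedBall hr.le R x.2)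
  rw [← h2] at h3
  exact h3

lemma chartDisk_injective (hr : 0 < r)
    (hB : Metric.closedBall z r ⊆ interior (extChartAt (𝓡∂ d) p).target) (R : Euc d ≃ₗᵢ[ℝ] Euc d) : Function.Injective (chartDisk p z r R) := by
  intro x y hxy
  have h1 := extChartAt_chartDisk hr hB R x
  rw [hxy, extChartAt_chartDisk hr hB R y] at h1
  exact Subtype.ext (R.injective (smul_right_injective _ hr.ne' (add_left_cancel h1))).symm

variable (d M) in
/-- A family of pairs of disjoint disks in charts of `M`, with disjoint neighbourhoods. -/
structure DiskFamily (T : Type) where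
  point : T → ℤˣ → M
  ctr : T → ℤˣ → Euc d
  radius : T → ℤˣ → ℝ
  radius_pos : ∀ t s, 0 < radius t s
  subset : ∀ t s, Metric.closedBall (ctr t s) (radius t s) ⊆
    interior (extChartAt (𝓡∂ d) (point t s)).target
  region : T → ℤˣ → Set M
  isOpen_region : ∀ t s, IsOpen (region t s)
  mem_region : ∀ t s, ∀ w ∈ Metric.closedBall (ctr t s) (radius t s),
    (extChartAt (𝓡∂ d) (point t s)).symm w ∈ region t s
  disjoint : ∀ t s t' s', (t, s) ≠ (t', s') → Disjoint (region t s) (region t' s')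

/-- The reflection in the first coordinate as an isometry. -/
def reflIso (d : ℕ) [NeZero d] : Euc d ≃ₗᵢ[ℝ] Euc d :=
  LinearIsometry.toLinearIsometryEquiv
    { toLinearMap := (Matrix.toEuclideanCLM (n := Fin d) (𝕜 := ℝ) (glRefl (0 : Fin d)).val).toLinearMap
      norm_map' := fun x => by
        rw [EuclideanSpace.norm_eq, EuclideanSpace.norm_eq]
        congr 1
        refine Finset.sum_congr rfl fun i _ => ?_
        change ‖(Matrix.toEuclideanCLM (n := Fin d) (𝕜 := ℝ) (glRefl (0 : Fin d)).val x) i‖ ^ 2 = _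
        rw [Matrix.ofLp_toEuclideanCLM, glRefl_val, Matrix.mulVec_diagonal]
        split_ifs <;> simp } rfl

lemma reflIso_coe (d : ℕ) [NeZero d] : ((reflIso d).toContinuousLinearEquiv : Euc d →L[ℝ] Euc d) =
    Matrix.toEuclideanCLM (n := Fin d) (𝕜 := ℝ) (glRefl (0 : Fin d)).val := rfl

namespace DiskFamily

variable {T : Type} (F : DiskFamily d M T)

lemma chartDisk_mem_region (R : Euc d ≃ₗᵢ[ℝ] Euc d) (t : T) (s : ℤˣ) (x : Disk d) :
    chartDisk (F.point t s) (F.ctr t s) (F.radius t s) R x ∈ F.region t s :=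
  F.mem_region t s _ (add_smul_mem_closedBall (F.radius_pos t s).le R x.2)

variable [IsManifold (𝓡∂ d) ∞ M]

/-- The embedding given by a family of disks and a choice of parametrizations of these disks. -/
def embedding (R : T → ℤˣ → (Euc d ≃ₗᵢ[ℝ] Euc d)) : SphereEmbedding d M T where
  toFun t s := chartDisk (F.point t s) (F.ctr t s) (F.radius t s) (R t s)
  smooth t s := contMDiffOn_chartDisk (F.radius_pos t s) (F.subset t s) _
  immersive t s _ hx := diskDeriv_chartDisk_injective (F.radius_pos t s) (F.subset t s) _ hx
  injective := by
    rintro ⟨t, s, x⟩ ⟨t', s', x'⟩ h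
    by_cases hts : (t, s) = (t', s')
    · simp only [Prod.mk.injEq] at hts
      obtain ⟨rfl, rfl⟩ := hts
      exact congrArg (fun y => (t, s, y))
        (chartDisk_injective (F.radius_pos t s) (F.subset t s) _ h)
    · refine absurd h ((F.disjoint t s t' s' hts).ne_of_mem
        (F.chartDisk_mem_region (R t s) t s x) (F.chartDisk_mem_region (R t' s') t' s' x'))
  mem_interior t s := chartDisk_mem_interior (F.radius_pos t s) (F.subset t s) _

lemma embedding_mem_region (R : T → ℤˣ → (Euc d ≃ₗᵢ[ℝ] Euc d)) (t : T) (s : ℤˣ) (x : Disk d) :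
    (F.embedding R).toFun t s x ∈ F.region t s := F.chartDisk_mem_region _ _ _ _

/-- Reparametrizing a disk by a linear isometry fixes its centre and multiplies the central frame by
the matrix of the isometry. -/
lemma stdFrame_embedding_center (R : T → ℤˣ → (Euc d ≃ₗᵢ[ℝ] Euc d)) (t : T) (s : ℤˣ)
    (g : GL (Fin d) ℝ) (h : ((R t s).toContinuousLinearEquiv : Euc d →L[ℝ] Euc d) =
      Matrix.toEuclideanCLM (n := Fin d) (𝕜 := ℝ) g.val) :
    (F.embedding R).stdFrame t s (diskCenter d) =
      ((F.embedding fun _ _ => LinearIsometryEquiv.refl ℝ (Euc d)).stdFrame t s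
        (diskCenter d)).rightMul g := by
  have h0 : ∀ R', diskExtend ((F.embedding R').toFun t s) (diskCenter d : Euc d) =
      (extChartAt (𝓡∂ d) (F.point t s)).symm (F.ctr t s) := fun R' => by
    rw [diskExtend_coe]
    simp [embedding, chartDisk, diskCenter]
  have h1 : ∀ R', diskDeriv ((F.embedding R').toFun t s) (diskCenter d : Euc d) =
      (chartSymmDeriv (F.point t s) (F.ctr t s)).comp
        (F.radius t s • ((R' t s).toContinuousLinearEquiv : Euc d →L[ℝ] Euc d)) := fun R' => by
    refine (diskDeriv_chartDisk (F.radius_pos t s) (F.subset t s) (R' t s) (diskCenter d).2).trans ?_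
    simp [diskCenter]
  refine SphereEmbedding.frameBundle_mk_congr ((h0 _).trans (h0 _).symm) ?_ _ _
  change (diskDeriv _ (diskCenter d : Euc d)).comp _ =
    ((diskDeriv _ (diskCenter d : Euc d)).comp _).comp _
  rw [h1, h1, h]
  ext1 v
  simp

open StableGLAction

variable {Θ : Type*} [TopologicalSpace Θ] [StableGLAction Θ]

/-- After reflecting some of the disks, the embedding given by a family of disks respects some
`Θ`-orientation. -/
lemma exists_respectsOrientation (hΘ : PiZeroTransitive Θ) (oM : TangentThetaOrientation d M Θ) :
    ∃ (R : T → ℤˣ → (Euc d ≃ₗᵢ[ℝ] Euc d)) (o : T → EucThetaOrientation (d + 1) Θ),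
      (F.embedding R).RespectsOrientation oM o := by
  classical
  let R₁ : T → ℤˣ → (Euc d ≃ₗᵢ[ℝ] Euc d) := fun _ _ => LinearIsometryEquiv.refl ℝ (Euc d)
  let v : T → ℤˣ → Θ := fun t s => (F.embedding R₁).frameValue oM t s (diskCenter d)
  -- The second disk of a pair is reflected exactly when the two central values are not already
  -- joined.
  let R : T → ℤˣ → (Euc d ≃ₗᵢ[ℝ] Euc d) := fun t s =>
    if s = -1 ∧ ¬ Joined (v t (-1)) (v t 1) then reflIso d else LinearIsometryEquiv.refl ℝ (Euc d)
  have hrefl : ∀ t s, R t s = LinearIsometryEquiv.refl ℝ (Euc d) →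
      (F.embedding R).frameValue oM t s (diskCenter d) = v t s := by
    intro t s h
    have h1 := F.stdFrame_embedding_center R t s 1 (by rw [h]; ext1 v; simp)
    simp only [v, SphereEmbedding.frameValue]
    rw [h1, oM.equivariant, act_one]
  have hj : ∀ t, Joined ((F.embedding R).frameValue oM t 1 (diskCenter d))
      ((F.embedding R).frameValue oM t (-1) (diskCenter d)) := by
    intro t
    have hR1 : R t 1 = LinearIsometryEquiv.refl ℝ (Euc d) := if_neg fun h => by
      have := h.1; revert this; decide
    rw [hrefl t 1 hR1]
    by_cases h : Joined (v t (-1)) (v t 1)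
    · rw [hrefl t (-1) (if_neg fun h' => h'.2 h)]
      exact h.symm
    · have hR2 : R t (-1) = reflIso d := if_pos ⟨rfl, h⟩
      have h1 := F.stdFrame_embedding_center R t (-1) (glRefl 0) (by rw [hR2, reflIso_coe])
      have h2 : Joined ((F.embedding R).frameValue oM t (-1) (diskCenter d))
          (act 1 (v t (-1)) (glRefl 0)) := by
        simp only [v, SphereEmbedding.frameValue]
        rw [h1, oM.equivariant]
        exact SphereEmbedding.joined_act_reflect _ _
      exact (h2.trans ((joined_or_joined_refl hΘ _ _).resolve_left h)).symm
  choose o ho using fun t => (F.embedding R).exists_thetaOrientation oM (hj t)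
  exact ⟨R, o, fun t s x f => ho t s x f⟩

end DiskFamily

/-- Every nonempty open set contains a ball of a chart. -/
lemma exists_chart_ball {O : Set M} (hO : IsOpen O) {x : M} (hx : x ∈ O) :
    ∃ (z : Euc d) (ρ : ℝ), 0 < ρ ∧
      Metric.closedBall z ρ ⊆ interior (extChartAt (𝓡∂ d) x).target ∧
      ∀ w ∈ Metric.closedBall z ρ, (extChartAt (𝓡∂ d) x).symm w ∈ O := by
  set φ := extChartAt (𝓡∂ d) x with hφ
  obtain ⟨u, hu, hxu, hut⟩ := mem_nhdsWithin.1 (extChartAt_target_mem_nhdsWithin (I := 𝓡∂ d) x)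
  have h1 : φ.symm ⁻¹' O ∈ 𝓝 (φ x) := by
    refine (continuousAt_extChartAt_symm (I := 𝓡∂ d) x).preimage_mem_nhds ?_
    rw [extChartAt_to_inv]
    exact hO.mem_nhds hx
  obtain ⟨v, hvO, hv, hxv⟩ := mem_nhds_iff.1 h1
  -- `x` may be a boundary point; the ball is centred at a nearby point in the interior of the half
  -- space.
  have h2 : φ x ∈ closure (interior (range (𝓡∂ d))) :=
    (𝓡∂ d).range_subset_closure_interior
      (extChartAt_target_subset_range (I := 𝓡∂ d) x (mem_extChartAt_target x))
  obtain ⟨w, ⟨hwu, hwv⟩, hwr⟩ := mem_closure_iff.1 h2 (u ∩ v) (hu.inter hv) ⟨hxu, hxv⟩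
  have hW : IsOpen (u ∩ v ∩ interior (range (𝓡∂ d))) := (hu.inter hv).inter isOpen_interior
  have hWt : u ∩ v ∩ interior (range (𝓡∂ d)) ⊆ interior φ.target :=
    interior_maximal (fun y hy => hut ⟨hy.1.1, interior_subset hy.2⟩) hW
  obtain ⟨ρ, hρ, hball⟩ := Metric.nhds_basis_closedBall.mem_iff.1
    (hW.mem_nhds ⟨⟨hwu, hwv⟩, hwr⟩)
  exact ⟨w, ρ, hρ, hball.trans hWt, fun y hy => hvO (hball hy).1.2⟩

lemma dist_le_of_pow_half {m k : ℕ} (h : m ≠ k) :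
    (1 / 2 : ℝ) ^ m / 8 + (1 / 2 : ℝ) ^ k / 8 ≤ |(1 / 2 : ℝ) ^ m / 2 - (1 / 2 : ℝ) ^ k / 2| := by
  wlog hmk : m < k generalizing m k
  · rw [add_comm, abs_sub_comm]
    exact this h.symm (lt_of_le_of_ne (not_lt.1 hmk) h.symm)
  have h1 : (1 / 2 : ℝ) ^ k ≤ (1 / 2 : ℝ) ^ (m + 1) :=
    pow_le_pow_of_le_one (by norm_num) (by norm_num) hmk
  rw [pow_succ] at h1
  have h2 : (0 : ℝ) < (1 / 2 : ℝ) ^ k := by positivity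
  rw [abs_of_nonneg (by linarith)]
  linarith

/-- There are infinitely many disjoint disks in prescribed open sets which are pairwise equal or
disjoint. -/
lemma exists_diskFamily_subset {T : Type} [Encodable T] {κ : Type*} (c : T → ℤˣ → κ) (O : κ → Set M)
    (hO : ∀ a, IsOpen (O a)) (hne : ∀ a, (O a).Nonempty)
    (hdisj : ∀ a b, a ≠ b → Disjoint (O a) (O b)) :
    ∃ F : DiskFamily d M T, ∀ t s, F.region t s ⊆ O (c t s) := by
  choose x hx using hne
  choose z ρ hρ hball hOw using fun a => exists_chart_ball (d := d) (hO a) (hx a)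
  let m : T → ℤˣ → ℕ := fun t s => Encodable.encode (t, decide (s = 1))
  have hm : ∀ t s t' s', m t s = m t' s' → (t, s) = (t', s') := by
    intro t s t' s' h
    have h1 := Encodable.encode_injective h
    simp only [Prod.mk.injEq, decide_eq_decide] at h1
    obtain ⟨rfl, h2⟩ := h1
    rcases Int.units_eq_one_or s with rfl | rfl <;>
      rcases Int.units_eq_one_or s' with rfl | rfl <;> simp_all
  let q : T → ℤˣ → ℝ := fun t s => (1 / 2) ^ m t s
  have hq : ∀ t s, 0 < q t s := fun t s => by positivity
  have hq1 : ∀ t s, q t s ≤ 1 := fun t s => pow_le_one₀ (by norm_num) (by norm_num)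
  let e₀ : Euc d := EuclideanSpace.single 0 1
  have he₀ : ‖e₀‖ = 1 := by simp [e₀]
  -- All disks prescribed for the same open set lie in one chart ball, with centres converging
  -- geometrically to its centre. Regions have radius factor `q / 8`, and the disks inside them `q /
  -- 16`.
  let ctr : T → ℤˣ → Euc d := fun t s => z (c t s) + (ρ (c t s) * (q t s / 2)) • e₀
  have hctr : ∀ t s, Metric.ball (ctr t s) (ρ (c t s) * (q t s / 8)) ⊆
      Metric.closedBall (z (c t s)) (ρ (c t s)) := by
    intro t s w hw
    have h1 : dist (ctr t s) (z (c t s)) = ρ (c t s) * (q t s / 2) := by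
      rw [dist_self_add_left, norm_smul, he₀, mul_one, Real.norm_of_nonneg]
      exact (mul_pos (hρ _) (half_pos (hq t s))).le
    have h2 := dist_triangle w (ctr t s) (z (c t s))
    rw [Metric.mem_ball] at hw
    rw [Metric.mem_closedBall]
    nlinarith [mul_le_mul_of_nonneg_left (hq1 t s) (hρ (c t s)).le, mul_pos (hρ (c t s)) (hq t s)]
  have hsub : ∀ t s, Metric.closedBall (ctr t s) (ρ (c t s) * (q t s / 16)) ⊆
      Metric.ball (ctr t s) (ρ (c t s) * (q t s / 8)) := fun t s =>
    Metric.closedBall_subset_ball (mul_lt_mul_of_pos_left (by linarith [hq t s]) (hρ _))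
  have hreg : ∀ t s, ∀ y ∈ (extChartAt (𝓡∂ d) (x (c t s))).source,
      extChartAt (𝓡∂ d) (x (c t s)) y ∈ Metric.ball (ctr t s) (ρ (c t s) * (q t s / 8)) →
      y ∈ O (c t s) := by
    intro t s y hy hyb
    rw [← (extChartAt (𝓡∂ d) (x (c t s))).left_inv hy]
    exact hOw _ _ (hctr t s hyb)
  refine ⟨{
    point := fun t s => x (c t s)
    ctr := ctr
    radius := fun t s => ρ (c t s) * (q t s / 16)
    radius_pos := fun t s => mul_pos (hρ _) (by linarith [hq t s])
    subset := fun t s => ((hsub t s).trans (hctr t s)).trans (hball _)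
    region := fun t s => (extChartAt (𝓡∂ d) (x (c t s))).source ∩
      extChartAt (𝓡∂ d) (x (c t s)) ⁻¹' Metric.ball (ctr t s) (ρ (c t s) * (q t s / 8))
    isOpen_region := fun t s => isOpen_extChartAt_preimage' _ Metric.isOpen_ball
    mem_region := fun t s w hw => ?_
    disjoint := fun t s t' s' h => ?_ }, fun t s y hy => hreg t s y hy.1 hy.2⟩
  · have hwt := interior_subset (hball _ (hctr t s (hsub t s hw)))
    refine ⟨PartialEquiv.map_target _ hwt, ?_⟩
    rw [mem_preimage, PartialEquiv.right_inv _ hwt]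
    exact hsub t s hw
  · refine disjoint_left.2 fun y hy hy' => ?_
    by_cases hc : c t s = c t' s'
    · have h1 := hy.2
      have h2 := hy'.2
      rw [mem_preimage, Metric.mem_ball] at h1 h2
      simp only [ctr] at h1 h2
      rw [← hc] at h2
      have h3 := dist_triangle_left (z (c t s) + (ρ (c t s) * (q t s / 2)) • e₀)
        (z (c t s) + (ρ (c t s) * (q t' s' / 2)) • e₀) (extChartAt (𝓡∂ d) (x (c t s)) y)
      rw [dist_add_left, dist_eq_norm, ← sub_smul, norm_smul, he₀, mul_one, ← mul_sub, norm_mul,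
        Real.norm_of_nonneg (hρ _).le, Real.norm_eq_abs] at h3
      have h4 := mul_le_mul_of_nonneg_left (dist_le_of_pow_half fun h' => h (hm t s t' s' h'))
        (hρ (c t s)).le
      change ρ (c t s) * (q t s / 8 + q t' s' / 8) ≤ ρ (c t s) * |q t s / 2 - q t' s' / 2| at h4
      linarith
    · exact disjoint_left.1 (hdisj _ _ hc) (hreg t s y hy.1 hy.2) (hreg t' s' y hy'.1 hy'.2)

/-- There are infinitely many disjoint finite systems of disks each of which makes `M` connected. -/
lemma exists_diskFamily_connecting [IsManifold (𝓡∂ d) ∞ M] [CompactSpace M] [Nonempty M] :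
    ∃ (n : ℕ) (F : DiskFamily d M (ℕ × Fin n)), ∀ (R : ℕ × Fin n → ℤˣ → (Euc d ≃ₗᵢ[ℝ] Euc d)) (i : ℕ)
      (U : Set M), IsClopen U → (∀ j, (F.embedding R).center (i, j) 1 ∈ U ↔
        (F.embedding R).center (i, j) (-1) ∈ U) → U = ∅ ∨ U = univ := by
  -- Together with compactness, this makes the set of components finite and discrete.
  have hlc : LocallyConnectedSpace M := ChartedSpace.locallyConnectedSpace (EuclideanHalfSpace d) M
  let ε := Finite.equivFin (ConnectedComponents M)
  let a₀ : ConnectedComponents M := ConnectedComponents.mk (Classical.arbitrary M)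
  let O : ConnectedComponents M → Set M := fun a => ConnectedComponents.mk ⁻¹' {a}
  -- In each system the `j`-th pair has one disk in a base component and the other in the `j`-th
  -- component, so all components are linked to the base one.
  obtain ⟨F, hF⟩ := exists_diskFamily_subset (d := d) (T := ℕ × Fin (Nat.card (ConnectedComponents M)))
    (fun t s => if s = 1 then a₀ else ε.symm t.2) O
    (fun a => (isOpen_discrete {a}).preimage ConnectedComponents.continuous_coe)
    (fun a => by obtain ⟨x, rfl⟩ := ConnectedComponents.surjective_coe a; exact ⟨x, rfl⟩)
    (fun a b hab => disjoint_left.2 fun x hx hx' => hab (hx.symm.trans hx'))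
  refine ⟨_, F, fun R i U hU hc => ?_⟩
  have hmk : ∀ j s, ConnectedComponents.mk ((F.embedding R).center (i, j) s) =
      if s = 1 then a₀ else ε.symm j := fun j s => hF (i, j) s (F.embedding_mem_region R _ _ _)
  have hsat : ∀ x y : M, ConnectedComponents.mk x = ConnectedComponents.mk y → x ∈ U → y ∈ U := by
    intro x y hxy hx
    refine hU.connectedComponent_subset hx ?_
    rw [ConnectedComponents.coe_eq_coe.1 hxy]
    exact mem_connectedComponent
  have key : ∀ x y : M, x ∈ U → y ∈ U := by
    have h1 : ∀ x : M, x ∈ U ↔ (F.embedding R).center (i, ε (ConnectedComponents.mk x)) 1 ∈ U := by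
      intro x
      have h2 := hmk (ε (ConnectedComponents.mk x)) (-1)
      rw [if_neg (by decide), Equiv.symm_apply_apply] at h2
      rw [hc]
      exact ⟨hsat _ _ h2.symm, hsat _ _ h2⟩
    intro x y hx
    rw [h1] at hx ⊢
    have h2 := hmk (ε (ConnectedComponents.mk x)) 1
    have h3 := hmk (ε (ConnectedComponents.mk y)) 1
    rw [if_pos rfl] at h2 h3
    exact hsat _ _ (h2.trans h3.symm) hx
  rcases U.eq_empty_or_nonempty with h | ⟨x, hx⟩
  · exact Or.inl h
  · exact Or.inr (eq_univ_of_forall fun y => key x y hx)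

end Disks

end

noncomputable section

/-! ## Adding standard surgeries -/

section StandardSurgeries

universe w u

/-- The factor in `(0, 1]` belonging to a positive real number. -/
def toScale (s : ℝ) : Ioc (0 : ℝ) 1 :=
  if h : 0 < s then ⟨min s 1, lt_min h one_pos, min_le_right _ _⟩ else 1

lemma toScale_coe {s : ℝ} (hs : 0 < s) : (toScale s : ℝ) = min s 1 := by
  rw [toScale, dif_pos hs]

@[simp] lemma toScale_one : toScale 1 = 1 := Subtype.ext (by rw [toScale_coe one_pos]; simp)

lemma continuousAt_toScale {s : ℝ} (hs : 0 < s) : ContinuousAt toScale s := by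
  refine IsInducing.subtypeVal.continuousAt_iff.2 ?_
  have h : ContinuousAt (fun s : ℝ => min s 1) s := by fun_prop
  exact h.congr ((eventually_gt_nhds hs).mono fun t ht => (toScale_coe ht).symm)

/-- Scaling of the disk by the factor `s`, truncated to the unit interval. -/
def diskContract {d : ℕ} (s : ℝ) (x : Disk d) : Disk d :=
  ⟨max 0 (min s 1) • (x : Euc d),
    smul_mem_disk (le_max_left _ _) (max_le zero_le_one (min_le_right _ _)) x.2⟩

lemma continuous_diskContract {d : ℕ} :
    Continuous (fun p : ℝ × Disk d => diskContract p.1 p.2) :=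
  Continuous.subtype_mk (by fun_prop) _

/-- Distances use `diskContract`, which makes sense at `s = 0` as well; embeddings can be shrunk
only by positive factors, where the two agree. -/
lemma diskContract_eq_diskScale {d : ℕ} {s : ℝ} (hs : 0 < s) (x : Disk d) :
    diskContract s x = diskScale (toScale s) x := by
  refine Subtype.ext ?_
  change max 0 (min s 1) • (x : Euc d) = (toScale s : ℝ) • (x : Euc d)
  rw [toScale_coe hs, max_eq_right (le_min hs.le zero_le_one)]

lemma exists_diskContract_eq {d : ℕ} {s s' : ℝ} (h : s ≤ s') (x : Disk d) :
    ∃ y : Disk d, diskContract s' y = diskContract s x := by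
  set a := max 0 (min s 1) with ha
  set b := max 0 (min s' 1) with hb
  have hab : a ≤ b := max_le_max le_rfl (min_le_min_right _ h)
  have ha0 : 0 ≤ a := le_max_left _ _
  rcases (ha0.trans hab).eq_or_lt with hb0 | hb0
  · refine ⟨x, Subtype.ext ?_⟩
    have ha' : a = 0 := le_antisymm (hb0 ▸ hab) ha0
    change b • (x : Euc d) = a • (x : Euc d)
    rw [← hb0, ha']
  · refine ⟨⟨(a / b) • (x : Euc d), smul_mem_disk (by positivity) ((div_le_one hb0).2 hab) x.2⟩,
      Subtype.ext ?_⟩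
    change b • (a / b) • (x : Euc d) = a • (x : Euc d)
    rw [smul_smul, mul_div_cancel₀ _ hb0.ne']

variable {d : ℕ} [NeZero d] {M : Type w} [TopologicalSpace M]
  [ChartedSpace (EuclideanHalfSpace d) M]

/-- The restriction of an embedding to a subset of its components. -/
def SphereEmbedding.comap {T T' : Type} (e : SphereEmbedding d M T) (k : T' → T)
    (hk : Function.Injective k) : SphereEmbedding d M T' where
  toFun t := e.toFun (k t)
  smooth t := e.smooth (k t)
  immersive t := e.immersive (k t)
  injective := by
    rintro ⟨t, s, x⟩ ⟨t', s', x'⟩ h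
    have h1 := e.injective (a₁ := (k t, s, x)) (a₂ := (k t', s', x')) h
    simp only [Prod.mk.injEq] at h1 ⊢
    exact ⟨hk h1.1, h1.2⟩
  mem_interior t := e.mem_interior (k t)

variable [IsManifold (𝓡∂ d) ∞ M] {Θ : Type u} [TopologicalSpace Θ] [StableGLAction Θ]

/-- A sequence of disjoint finite surgery data each of which makes `M` connected, together with
functions which separate them from each other. -/
structure StandardSystem (oM : TangentThetaOrientation d M Θ) where
  n : ℕ
  emb : SphereEmbedding d M (ℕ × Fin n)
  orient : ℕ × Fin n → EucThetaOrientation (d + 1) Θ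
  respects : emb.RespectsOrientation oM orient
  connecting : ∀ (i : ℕ) (U : Set M), IsClopen U →
    (∀ j, emb.center (i, j) 1 ∈ U ↔ emb.center (i, j) (-1) ∈ U) → U = ∅ ∨ U = univ
  sep : ℕ → M → ℝ
  continuous_sep : ∀ i, Continuous (sep i)
  sep_mem : ∀ i p, sep i p ∈ Icc (0 : ℝ) 1
  sep_emb : ∀ i j s x, sep i (emb.toFun (i, j) s x) = 0
  subsingleton_sep : ∀ p, {i | sep i p ≠ 1}.Subsingleton

/-- The separating functions are Urysohn functions, 0 on the closed disks of a datum and 1 outside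
its open regions. Regions of different data are disjoint, so at most one function differs from 1 at
a given point. -/
lemma nonempty_standardSystem [T2Space M] [CompactSpace M] [Nonempty M]
    (hΘ : StableGLAction.PiZeroTransitive Θ) (oM : TangentThetaOrientation d M Θ) :
    Nonempty (StandardSystem oM) := by
  obtain ⟨n, F, hF⟩ := exists_diskFamily_connecting (d := d) (M := M)
  obtain ⟨R, o, hR⟩ := F.exists_respectsOrientation hΘ oM
  let Y : ℕ → Set M := fun i => ⋃ (j : Fin n) (s : ℤˣ), range ((F.embedding R).toFun (i, j) s)
  let V : ℕ → Set M := fun i => ⋃ (j : Fin n) (s : ℤˣ), F.region (i, j) s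
  have hY : ∀ i, IsClosed (Y i) := fun i => isClosed_iUnion_of_finite fun j =>
    isClosed_iUnion_of_finite fun s => (isCompact_range ((F.embedding R).continuous_toFun _ s)).isClosed
  have hV : ∀ i, IsOpen (V i) := fun i => isOpen_iUnion fun j => isOpen_iUnion fun s =>
    F.isOpen_region _ s
  have hYV : ∀ i, Y i ⊆ V i := fun i => iUnion_mono fun j => iUnion_mono fun s => by
    rintro _ ⟨x, rfl⟩
    exact F.embedding_mem_region R _ _ _
  choose f hf0 hf1 hf using fun i => exists_continuous_zero_one_of_isClosed (hY i)
    (hV i).isClosed_compl (disjoint_compl_right_iff_subset.2 (hYV i))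
  refine ⟨{
    n := n
    emb := F.embedding R
    orient := o
    respects := hR
    connecting := hF R
    sep := fun i => f i
    continuous_sep := fun i => (f i).continuous
    sep_mem := hf
    sep_emb := fun i j s x => hf0 i (mem_iUnion₂.2 ⟨j, s, x, rfl⟩)
    subsingleton_sep := fun p i hi i' hi' => ?_ }⟩
  have hmem : ∀ i, f i p ≠ 1 → p ∈ V i := fun i h => by
    by_contra h'
    exact h (hf1 i h')
  obtain ⟨j, s, hp⟩ := mem_iUnion₂.1 (hmem i hi)
  obtain ⟨j', s', hp'⟩ := mem_iUnion₂.1 (hmem i' hi')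
  by_contra hne
  exact disjoint_left.1 (F.disjoint (i, j) s (i', j') s' fun h =>
    hne (congrArg (fun q => q.1.1) h)) hp hp'

namespace SurgeryCat

variable {oM : TangentThetaOrientation d M Θ}

/-- The embedded thickened spheres of an object together with their orientations. -/
def pairs (X : SurgeryCat oM) : Set ((ℤˣ → Disk d → M) × EucThetaOrientation (d + 1) Θ) :=
  range fun t : X.1.1 => (X.2.1.1.toFun t, X.2.1.2 t)

/-- Injectivity of the embedding lets each sphere be recovered from its image, so the map of index
sets is determined by the inclusion and is injective. Existence of morphisms becomes a matter of set
inclusion. -/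
lemma nonempty_hom_iff {X Y : SurgeryCat oM} : Nonempty (X ⟶ Y) ↔ X.pairs ⊆ Y.pairs := by
  constructor
  · rintro ⟨(f : Hom X Y)⟩ _ ⟨t, rfl⟩
    exact ⟨f.map t, Prod.ext (f.embedding t) (f.orientation t)⟩
  · intro h
    choose k hk using fun t => h ⟨t, rfl⟩
    have h1 : ∀ t, Y.2.1.1.toFun (k t) = X.2.1.1.toFun t := fun t => congrArg Prod.fst (hk t)
    refine ⟨(⟨k, fun t t' htt => ?_, h1, fun t => congrArg Prod.snd (hk t)⟩ : Hom X Y)⟩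
    have h2 : X.2.1.1.toFun t = X.2.1.1.toFun t' := by rw [← h1, ← h1, htt]
    have h3 := X.2.1.1.injective (a₁ := (t, 1, diskCenter d)) (a₂ := (t', 1, diskCenter d))
      (congrFun (congrFun h2 1) _)
    exact congrArg Prod.fst h3

end SurgeryCat

namespace SurgeryDatum

variable {oM : TangentThetaOrientation d M Θ} {T T' : Type}

lemma continuousAt_of_components {Z : Type*} [TopologicalSpace Z] {F : Z → SurgeryDatum oM T} {z : Z}
    (h1 : ContinuousAt (fun z => (F z).1.1) z) (h2 : ∀ t, ContinuousAt (fun z => (F z).1.2 t) z) :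
    ContinuousAt F z := by
  have hind : IsInducing (fun p : SurgeryDatum oM T => p.1) := IsInducing.subtypeVal
  exact hind.continuousAt_iff.2 (h1.prodMk (continuousAt_pi.2 h2))

lemma continuous_emb : Continuous fun p : SurgeryDatum oM T => p.1.1 :=
  continuous_fst.comp continuous_subtype_val

lemma continuous_orient (t : T) : Continuous fun p : SurgeryDatum oM T => p.1.2 t :=
  (continuous_apply t).comp (continuous_snd.comp continuous_subtype_val)

lemma isConnecting (p : SurgeryDatum oM T) : p.1.1.IsConnecting :=
  SphereEmbedding.isConnecting_of_connectedSpace p.2.2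

variable [T2Space M] [Nonempty M] (hd : 2 ≤ d)

/-- Shrinking of a surgery datum. -/
def shrink [Finite T] (p : SurgeryDatum oM T) (c : Ioc (0 : ℝ) 1) : SurgeryDatum oM T :=
  ⟨(p.1.1.shrink c, fun t => (p.1.2 t).shrink c), p.2.1.shrink c,
    (SphereEmbedding.isConnecting_of_center_eq id
      (fun t s => by simp [SphereEmbedding.center, SphereEmbedding.shrink])
      p.isConnecting).connectedSpace hd⟩

/-- The union of two disjoint surgery data. -/
def sum [Finite T] [Finite T'] (p : SurgeryDatum oM T) {e : SphereEmbedding d M T'}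
    {o : T' → EucThetaOrientation (d + 1) Θ} (he : e.RespectsOrientation oM o)
    (h : ∀ t s x t' s' x', p.1.1.toFun t s x ≠ e.toFun t' s' x') : SurgeryDatum oM (T ⊕ T') :=
  ⟨(p.1.1.sum e h, Sum.elim p.1.2 o), by rintro (t | t); exacts [p.2.1 t, he t],
    (SphereEmbedding.isConnecting_of_center_eq (e := p.1.1) Sum.inl (fun _ _ => rfl)
      p.isConnecting).connectedSpace hd⟩

lemma continuousAt_shrink [Finite T] (q : SurgeryDatum oM T × Ioc (0 : ℝ) 1) :
    ContinuousAt (fun q : SurgeryDatum oM T × Ioc (0 : ℝ) 1 => q.1.shrink hd q.2) q := by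
  refine continuousAt_of_components ?_ fun t => ?_
  · refine SphereEmbedding.continuousAt_of_diskNhd fun t s K p k ε hK hKD hε hp => ?_
    have hc : ContinuousAt (fun q : SurgeryDatum oM T × Ioc (0 : ℝ) 1 => (q.1.1.1, q.2)) q :=
      ((continuous_emb.comp continuous_fst).prodMk continuous_snd).continuousAt
    exact hc.eventually (q.1.1.1.eventually_shrink_mem_diskNhd q.2 t s hK hKD hε hp)
  · exact (EucThetaOrientation.continuous_shrink.comp
      (((continuous_orient t).comp continuous_fst).prodMk continuous_snd)).continuousAt

end SurgeryDatum

end StandardSurgeries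

end

noncomputable section

/-! ## The join system of standard surgeries -/

section SurgeryJoinSystem

universe w u

variable {d : ℕ} [NeZero d] {M : Type w} [TopologicalSpace M]
  [ChartedSpace (EuclideanHalfSpace d) M] [IsManifold (𝓡∂ d) ∞ M]
  {Θ : Type u} [TopologicalSpace Θ] [StableGLAction Θ] {oM : TangentThetaOrientation d M Θ}

lemma SurgeryCat.isOpenEmbedding_mk (T : FiniteSet) : IsOpenEmbedding
    (fun p : SurgeryDatum oM T.1 × ℝ => ((⟨T, p.1⟩ : SurgeryCat oM), p.2)) :=
  (IsOpenEmbedding.sigmaMk (σ := fun T : FiniteSet => SurgeryDatum oM T.1) (i := T)).prodMap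
    IsOpenEmbedding.id

lemma SurgeryCat.continuous_mk (T : FiniteSet) :
    Continuous (fun p : SurgeryDatum oM T.1 => (⟨T, p⟩ : SurgeryCat oM)) :=
  continuous_sigmaMk (σ := fun T : FiniteSet => SurgeryDatum oM T.1)

/-- Subbasic neighbourhoods test one sphere at a time, and the second summand is constant. -/
lemma SurgeryDatum.continuousAt_sum [T2Space M] [Nonempty M] (hd : 2 ≤ d) {T T' : Type} [Finite T]
    [Finite T'] {e : SphereEmbedding d M T'} {o : T' → EucThetaOrientation (d + 1) Θ}
    (he : e.RespectsOrientation oM o) {Z : Type*} [TopologicalSpace Z] {F : Z → SurgeryDatum oM T}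
    (h : ∀ z t s x t' s' x', (F z).1.1.toFun t s x ≠ e.toFun t' s' x') {z : Z}
    (hF : ContinuousAt F z) : ContinuousAt (fun z => (F z).sum hd he (h z)) z := by
  refine continuousAt_of_components ?_ ?_
  · refine SphereEmbedding.continuousAt_of_diskNhd fun t s K p k ε hK hKD hε hp => ?_
    rcases t with t | t
    · exact (continuous_emb.continuousAt.comp hF).eventually
        ((F z).1.1.eventually_mem_diskNhd t s hK hKD hε hp)
    · exact Filter.Eventually.of_forall fun _ => mem_diskNhd_self (f := e.toFun t s) hε hp
  · rintro (t | t)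
    · exact (continuous_orient t).continuousAt.comp hF
    · exact continuousAt_const

namespace StandardSystem

variable (Y : StandardSystem oM)

/-- The embedding formed by the data whose index lies in a finite set. -/
def restrict (S : Finset ℕ) : SphereEmbedding d M ({i // i ∈ S} × Fin Y.n) :=
  Y.emb.comap (fun q => (q.1.1, q.2)) fun q q' h => by
    simp only [Prod.mk.injEq] at h
    exact Prod.ext (Subtype.ext h.1) h.2

/-- The orientations of the data whose index lies in a finite set. -/
def restrictOrient (S : Finset ℕ) (q : {i // i ∈ S} × Fin Y.n) : EucThetaOrientation (d + 1) Θ :=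
  Y.orient (q.1.1, q.2)

lemma respects_restrict (S : Finset ℕ) :
    (Y.restrict S).RespectsOrientation oM (Y.restrictOrient S) :=
  fun q => Y.respects (q.1.1, q.2)

/-- The embedded thickened spheres whose index lies in a finite set, with their orientations. -/
def pairs (S : Finset ℕ) : Set ((ℤˣ → Disk d → M) × EucThetaOrientation (d + 1) Θ) :=
  range fun q => ((Y.restrict S).toFun q, Y.restrictOrient S q)

lemma pairs_mono {S S' : Finset ℕ} (h : S ⊆ S') : Y.pairs S ⊆ Y.pairs S' := by
  rintro _ ⟨⟨⟨i, hi⟩, j⟩, rfl⟩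
  exact ⟨⟨⟨i, h hi⟩, j⟩, rfl⟩

/-- How far a family of thickened spheres, contracted by the factor `s`, enters the neighbourhood
of the `i`-th standard datum. -/
def overlap {T : Type} (i : ℕ) (e : SphereEmbedding d M T) (s : ℝ) : ℝ :=
  ⨆ q : T × ℤˣ × Disk d, (1 - Y.sep i (e.toFun q.1 q.2.1 (diskContract s q.2.2)))

/-! ### Distance from the standard data -/

section Overlap

variable {T T' : Type} (i : ℕ) {e : SphereEmbedding d M T} {e' : SphereEmbedding d M T'} {s s' : ℝ}

lemma bddAbove_overlap (e : SphereEmbedding d M T) (s : ℝ) : BddAbove (range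
    fun q : T × ℤˣ × Disk d => 1 - Y.sep i (e.toFun q.1 q.2.1 (diskContract s q.2.2))) := by
  refine ⟨1, ?_⟩
  rintro _ ⟨q, rfl⟩
  exact sub_le_self _ (Y.sep_mem i _).1

lemma overlap_nonneg : 0 ≤ Y.overlap i e s :=
  Real.iSup_nonneg fun _ => sub_nonneg.2 (Y.sep_mem i _).2

lemma overlap_le_one : Y.overlap i e s ≤ 1 :=
  Real.iSup_le (fun _ => sub_le_self _ (Y.sep_mem i _).1) zero_le_one

lemma overlap_le (h : ∀ t σ x, ∃ t' x', e'.toFun t' σ (diskContract s' x') =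
    e.toFun t σ (diskContract s x)) : Y.overlap i e s ≤ Y.overlap i e' s' := by
  refine Real.iSup_le (fun ⟨t, σ, x⟩ => ?_) (Y.overlap_nonneg i)
  obtain ⟨t', x', hx⟩ := h t σ x
  refine le_trans (le_of_eq ?_) (le_ciSup (Y.bddAbove_overlap i e' s') (t', σ, x'))
  rw [← hx]

lemma sep_pos_of_overlap_lt_one (h : Y.overlap i e s < 1) (t : T) (σ : ℤˣ) (x : Disk d) :
    0 < Y.sep i (e.toFun t σ (diskContract s x)) := by
  have := (le_ciSup (Y.bddAbove_overlap i e s) (t, σ, x)).trans_lt h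
  linarith

lemma overlap_zero (h : ∀ t σ, Y.sep i (e.center t σ) = 1) : Y.overlap i e 0 = 0 := by
  refine le_antisymm (Real.iSup_le (fun ⟨t, σ, x⟩ => ?_) le_rfl) (Y.overlap_nonneg i)
  have hx : diskContract 0 x = diskCenter d := Subtype.ext (by simp [diskContract, diskCenter])
  change 1 - Y.sep i (e.toFun t σ (diskContract 0 x)) ≤ 0
  rw [hx]
  exact (sub_eq_zero.2 (h t σ).symm).le

/-- A supremum over the compact space `T × S^0 × D^d` of a jointly continuous function, `T` being
finite and discrete. -/
lemma continuous_overlap [Finite T] :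
    Continuous fun q : SurgeryDatum oM T × ℝ => Y.overlap i q.1.1.1 q.2 := by
  let : TopologicalSpace T := ⊥
  have : DiscreteTopology T := ⟨rfl⟩
  let f : SurgeryDatum oM T × ℝ → T × ℤˣ × Disk d → ℝ := fun q r =>
    1 - Y.sep i (q.1.1.1.toFun r.1 r.2.1 (diskContract q.2 r.2.2))
  have h1 : Continuous fun r : T × ℤˣ × (SurgeryDatum oM T × ℝ) × Disk d =>
      r.2.2.1.1.1.1.toFun r.1 r.2.1 (diskContract r.2.2.1.2 r.2.2.2) := by
    refine continuous_prod_of_discrete_left.2 fun t => continuous_prod_of_discrete_left.2 fun σ => ?_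
    refine (SphereEmbedding.continuous_eval t σ).comp
      (((SurgeryDatum.continuous_emb.comp (continuous_fst.comp continuous_fst))).prodMk ?_)
    exact continuous_diskContract.comp
      ((continuous_snd.comp continuous_fst).prodMk continuous_snd)
  have h2 : Continuous (↿f) := by
    refine continuous_const.sub ((Y.continuous_sep i).comp (h1.comp
      (f := fun r : (SurgeryDatum oM T × ℝ) × T × ℤˣ × Disk d =>
        (r.2.1, r.2.2.1, r.1, r.2.2.2)) ?_))
    fun_prop
  have h3 := (isCompact_univ (X := T × ℤˣ × Disk d)).continuous_sSup h2
  simp only [image_univ] at h3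
  exact h3

end Overlap

/-- The distance function to the `i`-th standard datum; it vanishes for `i = 0`. -/
def dist (i : ℕ) (x : SurgeryCat oM) (s : ℝ) : ℝ :=
  if i = 0 then 0 else 1 - Y.overlap i x.2.1.1 s

lemma continuous_dist (i : ℕ) : Continuous fun p : SurgeryCat oM × ℝ => Y.dist i p.1 p.2 := by
  by_cases hi : i = 0
  · simpa only [dist, if_pos hi] using continuous_const
  · simp only [dist, if_neg hi]
    refine continuous_iff_continuousAt.2 ?_
    rintro ⟨⟨T, p⟩, s⟩
    have := T.2
    exact ((SurgeryCat.isOpenEmbedding_mk T).continuousAt_iff (x := (p, s))).1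
      (continuous_const.sub (Y.continuous_overlap (T := T.1) i)).continuousAt

lemma dist_of_overlap_le {i : ℕ} {x x' : SurgeryCat oM} {s s' : ℝ}
    (h : Y.overlap i x.2.1.1 s ≤ Y.overlap i x'.2.1.1 s') : Y.dist i x' s' ≤ Y.dist i x s := by
  rw [dist, dist]
  split_ifs
  exacts [le_rfl, sub_le_sub_left h 1]

lemma dist_hom (i : ℕ) {x x' : SurgeryCat oM} (s : ℝ) (h : Nonempty (x ⟶ x')) :
    Y.dist i x' s ≤ Y.dist i x s := by
  obtain ⟨(f : SurgeryCat.Hom x x')⟩ := h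
  exact Y.dist_of_overlap_le (Y.overlap_le i fun t σ y => ⟨f.map t, y, by rw [f.embedding]⟩)

lemma dist_antitone (i : ℕ) (x : SurgeryCat oM) {s s' : ℝ} (h : s ≤ s') :
    Y.dist i x s' ≤ Y.dist i x s := by
  refine Y.dist_of_overlap_le (Y.overlap_le i fun t σ y => ?_)
  obtain ⟨y', hy⟩ := exists_diskContract_eq h y
  exact ⟨t, y', by rw [hy]⟩

/-- At `s = 0` only the finitely many centres matter, and each of them affects at most one index.
Some nonzero index is unaffected. -/
lemma exists_dist_pos (x : SurgeryCat oM) : ∃ i, 0 < Y.dist i x 0 := by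
  have := x.1.2
  have hfin : (⋃ q : x.1.1 × ℤˣ, {i | Y.sep i (x.2.1.1.center q.1 q.2) ≠ 1}).Finite :=
    finite_iUnion fun q => (Y.subsingleton_sep _).finite
  obtain ⟨i, hi⟩ := (hfin.insert 0).infinite_compl.nonempty
  have hi0 : i ≠ 0 := fun h => hi (Or.inl h)
  refine ⟨i, ?_⟩
  rw [dist, if_neg hi0, Y.overlap_zero i fun t σ => ?_, sub_zero]
  · exact one_pos
  · by_contra h
    exact hi (Or.inr (mem_iUnion.2 ⟨(t, σ), h⟩))

/-- The function `sep i` vanishes on the standard disks, while positive distance makes it positive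
on the shrunk ones. -/
lemma shrink_ne_restrict {x : SurgeryCat oM} {s : ℝ} {S : Finset ℕ} (hs : 0 < s)
    (h : ∀ i ∈ S, 0 < Y.dist i x s) (t σ y t' σ' y') :
    (x.2.1.1.shrink (toScale s)).toFun t σ y ≠ (Y.restrict S).toFun t' σ' y' := by
  intro heq
  obtain ⟨⟨i, hi⟩, j⟩ := t'
  have hlt : Y.overlap i x.2.1.1 s < 1 := by
    have h1 := h i hi
    rw [dist] at h1
    split_ifs at h1
    · exact absurd h1 (lt_irrefl _)
    · linarith
  have h1 := Y.sep_pos_of_overlap_lt_one i hlt t σ y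
  rw [diskContract_eq_diskScale hs] at h1
  have h2 := Y.sep_emb i j σ' y'
  change x.2.1.1.toFun t σ (diskScale (toScale s) y) = Y.emb.toFun (i, j) σ' y' at heq
  rw [heq, h2] at h1
  exact lt_irrefl _ h1

lemma isConnecting_restrict {S : Finset ℕ} (hS : S.Nonempty) : (Y.restrict S).IsConnecting := by
  obtain ⟨i, hi⟩ := hS
  exact fun U hU hc => Y.connecting i U hU fun j => hc (⟨i, hi⟩, j)

variable [T2Space M] [Nonempty M] (hd : 2 ≤ d)

open Classical in
/-- The object obtained by shrinking an object and adding standard data to it. -/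
def adjoin (s : ℝ) (x : SurgeryCat oM) (S : Finset ℕ) : SurgeryCat oM :=
  haveI := x.1.2
  -- For empty `S` the index set stays literally the same, so that shrinking by 1 returns the object
  -- itself. The final default `x` is used only when the disks meet.
  if S = ∅ then ⟨x.1, x.2.shrink hd (toScale s)⟩ else
    if h : ∀ t σ y t' σ' y', (x.2.1.1.shrink (toScale s)).toFun t σ y ≠
        (Y.restrict S).toFun t' σ' y' then
      ⟨⟨x.1.1 ⊕ {i // i ∈ S} × Fin Y.n, inferInstance⟩,
        (x.2.shrink hd (toScale s)).sum hd (Y.respects_restrict S) h⟩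
    else x

lemma adjoin_empty (s : ℝ) (x : SurgeryCat oM) :
    Y.adjoin hd s x ∅ = ⟨x.1, haveI := x.1.2; x.2.shrink hd (toScale s)⟩ :=
  if_pos rfl

lemma adjoin_of_nonempty {s : ℝ} {x : SurgeryCat oM} {S : Finset ℕ} (hS : S ≠ ∅)
    (h : ∀ t σ y t' σ' y', (x.2.1.1.shrink (toScale s)).toFun t σ y ≠
        (Y.restrict S).toFun t' σ' y') :
    Y.adjoin hd s x S = haveI := x.1.2; ⟨⟨x.1.1 ⊕ {i // i ∈ S} × Fin Y.n, inferInstance⟩,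
        (x.2.shrink hd (toScale s)).sum hd (Y.respects_restrict S) h⟩ :=
  (if_neg hS).trans (dif_pos h)

lemma adjoin_one (x : SurgeryCat oM) : Y.adjoin hd 1 x ∅ = x := by
  obtain ⟨T, p⟩ := x
  have := T.2
  have h : p.shrink hd (toScale 1) = p := by
    refine Subtype.ext (Prod.ext ?_ (funext fun t => ?_))
    · change p.1.1.shrink (toScale 1) = _
      rw [toScale_one, SphereEmbedding.shrink_one]
    · change (p.1.2 t).shrink (toScale 1) = _
      rw [toScale_one, EucThetaOrientation.shrink_one]
  exact (Y.adjoin_empty hd 1 ⟨T, p⟩).trans (congrArg (Sigma.mk T) h)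

/-- The effect of shrinking on an embedded thickened sphere with orientation. -/
def shrinkPair (s : ℝ) (a : (ℤˣ → Disk d → M) × EucThetaOrientation (d + 1) Θ) :
    (ℤˣ → Disk d → M) × EucThetaOrientation (d + 1) Θ :=
  (fun σ y => a.1 σ (diskScale (toScale s) y), a.2.shrink (toScale s))

lemma pairs_adjoin {s : ℝ} {x : SurgeryCat oM} {S : Finset ℕ} (hs : 0 < s)
    (h : ∀ i ∈ S, 0 < Y.dist i x s) :
    (Y.adjoin hd s x S).pairs = shrinkPair s '' x.pairs ∪ Y.pairs S := by
  rcases S.eq_empty_or_nonempty with rfl | hS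
  · have h1 : Y.pairs ∅ = ∅ := by
      rw [pairs, range_eq_empty_iff]
      exact ⟨fun q => absurd q.1.2 (Finset.notMem_empty _)⟩
    rw [h1, union_empty, adjoin_empty]
    exact range_comp (shrinkPair s) fun t : x.1.1 => (x.2.1.1.toFun t, x.2.1.2 t)
  · rw [adjoin_of_nonempty Y hd hS.ne_empty (Y.shrink_ne_restrict hs h)]
    exact (Sum.range_eq _).trans (congrArg (· ∪ Y.pairs S)
      (range_comp (shrinkPair s) fun t : x.1.1 => (x.2.1.1.toFun t, x.2.1.2 t)))

/-- The object formed by the standard data whose index lies in a finite nonempty set. -/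
def standardObj (S : Finset ℕ) (hS : S.Nonempty) : SurgeryCat oM :=
  ⟨⟨{i // i ∈ S} × Fin Y.n, inferInstance⟩, (Y.restrict S, Y.restrictOrient S),
    Y.respects_restrict S, (Y.isConnecting_restrict hS).connectedSpace hd⟩

/-- The index set is locally constant and positivity of the distances is open, so near `(x, s)` the
object is given by shrinking followed by a fixed disjoint union. -/
lemma continuousAt_adjoin {s : ℝ} {x : SurgeryCat oM} {S : Finset ℕ} (hs : 0 < s)
    (h : ∀ i ∈ S, 0 < Y.dist i x s) :
    ContinuousAt (fun p : SurgeryCat oM × ℝ => Y.adjoin hd p.2 p.1 S) (x, s) := by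
  obtain ⟨T, p⟩ := x
  have := T.2
  have hi := SurgeryCat.isOpenEmbedding_mk (oM := oM) T
  let U : Set (SurgeryDatum oM T.1 × ℝ) := {q | 0 < q.2} ∩
    ⋂ i ∈ S, {q | 0 < Y.dist i (⟨T, q.1⟩ : SurgeryCat oM) q.2}
  have hUo : IsOpen U := (isOpen_lt continuous_const continuous_snd).inter
    (isOpen_biInter_finset fun i _ => isOpen_lt continuous_const
      ((Y.continuous_dist i).comp hi.continuous))
  have hU : ∀ q : U, ∀ i ∈ S, 0 < Y.dist i (⟨T, q.1.1⟩ : SurgeryCat oM) q.1.2 :=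
    fun q => mem_iInter₂.1 q.2.2
  have hcont : ∀ q : U, ContinuousAt
      (fun q : U => q.1.1.shrink hd (toScale q.1.2)) q := fun q => by
    have h1 : ContinuousAt (fun q : U => (q.1.1, toScale q.1.2)) q :=
      (continuous_fst.comp continuous_subtype_val).continuousAt.prodMk
        (ContinuousAt.comp (f := fun q : U => q.1.2) (continuousAt_toScale q.2.1)
          (continuous_snd.comp continuous_subtype_val).continuousAt)
    exact ContinuousAt.comp (f := fun q : U => (q.1.1, toScale q.1.2))
      (SurgeryDatum.continuousAt_shrink hd (q.1.1, toScale q.1.2)) h1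
  refine ((hi.comp hUo.isOpenEmbedding_subtypeVal).continuousAt_iff
    (x := ⟨(p, s), hs, mem_iInter₂.2 h⟩)).1 ?_
  rcases S.eq_empty_or_nonempty with rfl | hS
  · refine ContinuousAt.congr (f := fun q : U =>
      (⟨T, q.1.1.shrink hd (toScale q.1.2)⟩ : SurgeryCat oM)) ?_ (Filter.Eventually.of_forall
        fun q => (Y.adjoin_empty hd q.1.2 ⟨T, q.1.1⟩).symm)
    exact (SurgeryCat.continuous_mk T).continuousAt.comp (hcont _)
  · refine ContinuousAt.congr (f := fun q : U =>
      (⟨⟨T.1 ⊕ {i // i ∈ S} × Fin Y.n, inferInstance⟩,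
        (q.1.1.shrink hd (toScale q.1.2)).sum hd (Y.respects_restrict S)
          (Y.shrink_ne_restrict (x := ⟨T, q.1.1⟩) q.2.1 (hU q))⟩ : SurgeryCat oM)) ?_
        (Filter.Eventually.of_forall fun q => (Y.adjoin_of_nonempty hd (x := ⟨T, q.1.1⟩)
          hS.ne_empty (Y.shrink_ne_restrict q.2.1 (hU q))).symm)
    exact (SurgeryCat.continuous_mk _).continuousAt.comp (SurgeryDatum.continuousAt_sum hd
      (Y.respects_restrict S) (fun q : U =>
        Y.shrink_ne_restrict (x := ⟨T, q.1.1⟩) q.2.1 (hU q)) (hcont _))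

/-- Any object can be joined with the standard objects. -/
def joinSystem : JoinSystem (SurgeryCat oM) where
  D := Y.dist
  obj := Y.adjoin hd
  -- An empty family need not make `M` connected, so a default is inserted; it is never used.
  y S := if hS : S.Nonempty then Y.standardObj hd S hS
    else Y.standardObj hd {0} (Finset.singleton_nonempty 0)
  continuous_D := Y.continuous_dist
  D_nonneg i x s := by
    rw [dist]
    split_ifs
    exacts [le_rfl, sub_nonneg.2 (Y.overlap_le_one i)]
  D_le_one i x s := by
    rw [dist]
    split_ifs
    exacts [zero_le_one, sub_le_self _ (Y.overlap_nonneg i)]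
  D_zero x s := if_pos rfl
  D_hom i x x' s := Y.dist_hom i s
  D_antitone i x s s' := Y.dist_antitone i x
  D_pos := Y.exists_dist_pos
  obj_one := Y.adjoin_one hd
  obj_hom s x x' S S' hs h hSS' hp := by
    rw [SurgeryCat.nonempty_hom_iff, Y.pairs_adjoin hd hs hp,
      Y.pairs_adjoin hd hs fun i hi => (hp i (hSS' hi)).trans_le (Y.dist_hom i s h)]
    exact union_subset_union (image_mono (SurgeryCat.nonempty_hom_iff.1 h)) (Y.pairs_mono hSS')
  y_hom S S' hS hSS' := by
    rw [dif_pos hS, dif_pos (hS.mono hSS'), SurgeryCat.nonempty_hom_iff]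
    exact Y.pairs_mono hSS'
  y_obj s x S S' hs hS hSS' hp := by
    rw [dif_pos hS, SurgeryCat.nonempty_hom_iff, Y.pairs_adjoin hd hs hp]
    exact (Y.pairs_mono hSS').trans subset_union_right
  continuousAt_obj s x S := Y.continuousAt_adjoin hd

end StandardSystem

end SurgeryJoinSystem

end

theorem mainTheorem11 {Θ : Type*} [TopologicalSpace Θ] [StableGLAction Θ]
    (hΘ : StableGLAction.PiZeroTransitive Θ)
    (d : ℕ) [NeZero d] (hd : 2 ≤ d)
    (M : Type*) [TopologicalSpace M] [ChartedSpace (EuclideanHalfSpace d) M]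
    [IsManifold (𝓡∂ d) ∞ M] [T2Space M] [CompactSpace M] [Nonempty M]
    (oM : TangentThetaOrientation d M Θ) :
    ContractibleSpace (ClassifyingSpace (SurgeryCat oM)) := by
  obtain ⟨Y⟩ := nonempty_standardSystem hΘ oM
  have : Quiver.IsThin (SurgeryCat oM) := fun _ _ => inferInstance
  have : Nonempty (SurgeryCat oM) := ⟨(Y.joinSystem hd).y {0}⟩
  -- The topology on morphisms is by definition the one induced by source and target.
  exact (Y.joinSystem hd).contractibleSpace ⟨rfl⟩
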